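/- Let $d\ge 1$ and let $S$ be a stationary point process on $\mathbb R^d$ of intensity $1$ with Palm version $S^{\circ}$. Two points of a configuration are neighbors if their Voronoi cells intersect in a set of dimension $d-1$; write $a(s,s')=1$ if $s,s'$ are neighbors and $a(s,s')=0$ otherwise, and $a(s)=\sum_{s'}a(s,s')$. Assume: (A1) $S$ is mixing; (A2) for every ball $B$, $|S\cap\partial B|<d+2$ a.s.; (A3) $\mathcal E\,e^{\beta a(0)}<\infty$ for some $\beta>0$; (A4) the $(d-1)$-volume of the boundary of the Voronoi cell of the origin in $S^\circ$ is square integrable; (A5) $\mathcal E\sum_{s\in S^\circ}a(0,s)|s|^{r'}<\infty$ for some $r'>4$; (A6) $S$ is a.s. not periodic. For a surface $f$ (a real function of a configuration and a point of it) put $\nabla f(s,s')=a(s,s')(f(s')-f(s))$ and $\Delta f(s)=\sum_{s'}a(s,s')(f(s')-f(s))$. For a (possibly random) nonnegative field $\zeta$ put $\mathcal C(\zeta)=\frac12\,\mathbb E\sum_{s\in S^\circ}a(0,s)\,\zeta(0,s)$. Let $T=(T_n)_{n\ge1}$ be independent rate-$1$ Poisson processes on $\mathbb R$, independent of $S^\circ$,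 attached to the points of $S^\circ=\{s_1,s_2,\dots\}$ (any measurable enumeration), and let $\mathbb E$ be the expectation with respect to the joint law. Given $(S^\circ,T)$, let $B^{s}_{[t,u]}$, $u\le t$, be the backward walk with $B^s_{[t,t]}=s$ that, going backward in time, jumps from $s_n$ to a uniformly chosen neighbor of $s_n$ at each epoch of $T_n$; let $p_t(s,s')$ be the conditional probability of $B^s_{[t,0]}=s'$ given $(S^\circ,T)$. The harness process started from a surface $\gamma$ is $\eta^\gamma_t(s)=\sum_{s'\in S^\circ}p_t(s,s')\gamma(s')$. Let $\gamma$ be a measurable surface whose gradient is covariant (invariant under translating the two points together with the configuration) and such that $\mathcal C(|\nabla\gamma|^r)<\infty$ for some $r>4$. Then, for every $t\ge0$, almost surely the sums defining $\eta^\gamma_t(s)$, $s\in S^\circ$, converge absolutely, and $\mathcal C(|\nabla\eta^\gamma_t|^2)<\infty$; and for every $t>0$, $\mathbb E\big[a(0)^{-1}|\Delta\eta^\gamma_t(0)|^2\big]<\infty$, the map $t\mapsto\mathcal C(|\nabla\eta^\gamma_t|^2)$ is differentiable at $t$ and $$\frac{d}{dt}\,\mathcal C\big(|\nabla\eta^\gamma_t|^2\big)=-\,\mathbb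 E\Big[a(0)^{-1}\,\big|\Delta\eta^\gamma_t(0)\big|^2\Big].$$ (Equivalently, $\frac{d}{dt}\,\mathbb E\sum_{s\in S^\circ}a(0,s)|\nabla\eta_t^\gamma(0,s)|^2=-2\,\mathbb E[a(0)^{-1}|\Delta\eta_t^\gamma(0)|^2]$.) -/

import Mathlib

open MeasureTheory ProbabilityTheory Filter Topology Set
open scoped ENNReal NNReal

noncomputable section

namespace Harness

/-- Locally finite subsets (point configurations) of `E`. -/
structure Config (E : Type*) [Bornology E] where
  carrier : Set E
  locallyFinite : ∀ B : Set E, Bornology.IsBounded B → (carrier ∩ B).Finite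

namespace Config

variable {E : Type*}

instance [Bornology E] : SetLike (Config E) E where
  coe := Config.carrier
  coe_injective := by
    rintro ⟨A, hA⟩ ⟨B, hB⟩ h
    cases h
    rfl

/-- The number of points of the configuration in `B` (used for bounded `B`, where it is finite). -/
def count [Bornology E] (B : Set E) (S : Config E) : ℕ := ((S : Set E) ∩ B).ncard

/-- The σ-algebra generated by the sets `{S | #(S ∩ B) = k}` with `B` bounded and Borel. -/
instance [Bornology E] [MeasurableSpace E] : MeasurableSpace (Config E) :=
  MeasurableSpace.generateFrom
    {A | ∃ (B : Set E) (k : ℕ), Bornology.IsBounded B ∧ MeasurableSet B ∧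
      A = {S : Config E | count B S = k}}

/-- The translate `τ_x S = {s - x : s ∈ S}`. -/
def shift [NormedAddCommGroup E] (x : E) (S : Config E) : Config E where
  carrier := (fun s => s - x) '' (S : Set E)
  locallyFinite := by
    intro B hB
    have hB' : Bornology.IsBounded ((fun y => y + x) '' B) := by
      obtain ⟨R, hR⟩ := hB.exists_norm_le
      refine isBounded_iff_forall_norm_le.2 ⟨R + ‖x‖, ?_⟩
      rintro _ ⟨y, hy, rfl⟩
      exact (norm_add_le y x).trans (by linarith [hR y hy])
    refine ((S.locallyFinite _ hB').image (fun s => s - x)).subset ?_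
    rintro _ ⟨⟨s, hs, rfl⟩, hsB⟩
    exact ⟨s, ⟨hs, ⟨s - x, hsB, by simp⟩⟩, rfl⟩

end Config

/-- Euclidean space `ℝ^d`. -/
abbrev Space (d : ℕ) : Type := EuclideanSpace ℝ (Fin d)

section Geometry

variable {d : ℕ}

/-- The (closed) Voronoi cell of `s` in `S`. -/
def voronoi (s : Space d) (S : Config (Space d)) : Set (Space d) :=
  {x | ∀ s' ∈ S, s' ≠ s → ‖x - s‖ ≤ ‖x - s'‖}

/-- `s` and `s'` are distinct points of `S` whose Voronoi cells (which are convex) meet in a set of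
affine dimension `d - 1`. -/
def IsNeighbor (S : Config (Space d)) (s s' : Space d) : Prop :=
  s ∈ S ∧ s' ∈ S ∧ s ≠ s' ∧ (voronoi s S ∩ voronoi s' S).Nonempty ∧
    Module.finrank ℝ (vectorSpan ℝ (voronoi s S ∩ voronoi s' S)) + 1 = d

open Classical in
/-- The conductance `a(s, s', S)`. -/
def conductance (S : Config (Space d)) (s s' : Space d) : ℝ := if IsNeighbor S s s' then 1 else 0

/-- The number of neighbors `a(s) = ∑_{s'} a(s, s', S)`. -/
def degree (S : Config (Space d)) (s : Space d) : ℕ := {s' | IsNeighbor S s s'}.ncard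

/-- The gradient `∇f(s, s') = a(s, s') (f(s') - f(s))`. -/
def grad (S : Config (Space d)) (f : Space d → ℝ) (s s' : Space d) : ℝ :=
  conductance S s s' * (f s' - f s)

/-- The Laplacian `Δf(s) = ∑_{s' ∈ S} a(s, s') (f(s') - f(s))`. -/
def laplacian (S : Config (Space d)) (f : Space d → ℝ) (s : Space d) : ℝ :=
  ∑' s' : S, conductance S s s' * (f s' - f s)

/-- A surface assigns a height to each point `s` of each configuration `S`; values at pairs
with `s ∉ S` are irrelevant. -/
abbrev Surface (d : ℕ) : Type := Space d → Config (Space d) → ℝ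

/-- Measurability of a surface on `Ξ₁ = {(s, S) : s ∈ S}`. -/
def Surface.IsMeasurable (γ : Surface d) : Prop :=
  Measurable fun p : {p : Space d × Config (Space d) // p.1 ∈ p.2} => γ p.1.1 p.1.2

/-- The gradient of the surface is a covariant field. -/
def Surface.HasCovariantGrad (γ : Surface d) : Prop :=
  ∀ (S : Config (Space d)), ∀ s ∈ S, ∀ s' ∈ S, ∀ s'' ∈ S,
    grad (S.shift s) (fun v => γ v (S.shift s)) (s' - s) (s'' - s)
      = grad S (fun v => γ v S) s' s''

end Geometry

section PointProcess

variable {d : ℕ}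

/-- The unit cube `[0,1)^d`. -/
def unitCube (d : ℕ) : Set (Space d) := {x | ∀ i, x i ∈ Ico (0 : ℝ) 1}

/-- The Palm measure of a stationary point process law of intensity one:
`palm P A = E[#{s ∈ S ∩ [0,1)^d : τ_s S ∈ A}]`. -/
def palm (P : Measure (Config (Space d))) : Measure (Config (Space d)) :=
  P.bind fun S =>
    Measure.sum fun s : {s : Space d // s ∈ S ∧ s ∈ unitCube d} => Measure.dirac (S.shift s.1)

/-- `P` is the law of a stationary point process of intensity one satisfying the standing
assumptions listed below. -/
structure Assumptions (P : Measure (Config (Space d))) : Prop where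
  isProbability : IsProbabilityMeasure P
  stationary : ∀ x : Space d, P.map (Config.shift x) = P
  intensity_one : ∫⁻ S, (Config.count (unitCube d) S : ℝ≥0∞) ∂P = 1
  /-- Mixing under translations. -/
  mixing : ∀ A B : Set (Config (Space d)), MeasurableSet A → MeasurableSet B →
    Tendsto (fun x : Space d => P (A ∩ Config.shift x ⁻¹' B)) (cocompact (Space d))
      (𝓝 (P A * P B))
  /-- Fewer than `d + 2` points on the boundary of any ball. -/
  spheres : ∀ (c : Space d) (ρ : ℝ), 0 < ρ →
    ∀ᵐ S ∂P, Config.count (Metric.sphere c ρ) S < d + 2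
  /-- The number of neighbors of the origin is (finite and) exponentially integrable. -/
  finite_neighbors : ∀ᵐ S ∂(palm P), {s' : Space d | IsNeighbor S 0 s'}.Finite
  exp_moment : ∃ β : ℝ, 0 < β ∧
    ∫⁻ S, ENNReal.ofReal (Real.exp (β * degree S 0)) ∂(palm P) < ∞
  /-- The boundary of the cell of the origin has square integrable `(d-1)`-volume. -/
  boundary_moment :
    ∫⁻ S, (Measure.hausdorffMeasure ((d : ℝ) - 1) (frontier (voronoi 0 S))) ^ 2 ∂(palm P) < ∞
  /-- More than four moments of the edge lengths. -/
  edge_moment : ∃ r : ℝ, 4 < r ∧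
    ∫⁻ S, ∑' s : S, ENNReal.ofReal (conductance S 0 s * ‖(s : Space d)‖ ^ r) ∂(palm P) < ∞
  /-- Almost surely aperiodic. -/
  aperiodic : ∀ᵐ S ∂P, ¬ ∃ x : Space d, x ≠ 0 ∧ S.shift x = S

/-- `𝒞(ζ) = (1/2) E ∑_{s ∈ S°} a(0, s) ζ(0, s)` for a nonnegative field `ζ`, where `S°` is given
as a function of a random element `x` with law `Q` (so that `ζ` may depend on additional
randomness). -/
def campbell {X : Type*} [MeasurableSpace X] (Q : Measure X) (config : X → Config (Space d))
    (ζ : Space d → Space d → X → ℝ≥0∞) : ℝ≥0∞ :=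
  2⁻¹ * ∫⁻ x, ∑' s : config x, ENNReal.ofReal (conductance (config x) 0 s) * ζ 0 s x ∂Q

/-- `e` is a measurable enumeration, without repetition, of the points of almost every
configuration. -/
structure IsEnumeration (Q : Measure (Config (Space d))) (e : ℕ → Config (Space d) → Space d) :
    Prop where
  measurable : ∀ n, Measurable (e n)
  enumerates : ∀ᵐ S ∂Q, Function.Injective (fun n => e n S) ∧
    range (fun n => e n S) = (S : Set (Space d))

/-- `T` is a homogeneous Poisson process of rate one on the line. -/
structure IsPoissonProcess {Ω : Type*} [MeasurableSpace Ω] (Pr : Measure Ω) (T : Ω → Config ℝ) :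
    Prop where
  measurable : Measurable T
  law : ∀ B : Set ℝ, Bornology.IsBounded B → MeasurableSet B →
    Pr.map (fun ω => Config.count B (T ω)) = poissonMeasure (volume B).toNNReal
  indep : ∀ (k : ℕ) (B : Fin k → Set ℝ), (∀ i, Bornology.IsBounded (B i)) →
    (∀ i, MeasurableSet (B i)) → Pairwise (fun i j => Disjoint (B i) (B j)) →
    iIndepFun (fun i ω => Config.count (B i) (T ω)) Pr

end PointProcess

section Dynamics

variable {d : ℕ}

open Classical in
/-- Given the configuration `S` and the epochs `𝒯 s` attached to its points, `jumpProb S 𝒯 s' k s u`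
is the probability that the backward walk which is at `s` at time `u` makes exactly `k` jumps
down to time `0` and ends at `s'`. The walk stays at `s` until the last epoch `τ ∈ (0, u]` of `𝒯 s`;
there it jumps to a uniformly chosen neighbor of `s`, and continues downward from time `τ`.
(Almost surely no two points of the configuration share an epoch.) -/
def jumpProb (S : Config (Space d)) (𝒯 : Space d → Set ℝ) (s' : Space d) :
    ℕ → Space d → ℝ → ℝ
  | 0, s, u => if s = s' ∧ 𝒯 s ∩ Ioc 0 u = ∅ then 1 else 0
  | k + 1, s, u =>
      if (𝒯 s ∩ Ioc 0 u).Nonempty then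
        ∑' v : S, conductance S s v / degree S s * jumpProb S 𝒯 s' k v (sSup (𝒯 s ∩ Ioc 0 u))
      else 0

/-- `p_t(s, s')`: the probability, given the configuration and the epochs, that the backward walk
started at `s` at time `t` is at `s'` at time `0`. -/
def transProb (S : Config (Space d)) (𝒯 : Space d → Set ℝ) (t : ℝ) (s s' : Space d) : ℝ :=
  ∑' k : ℕ, jumpProb S 𝒯 s' k s t

variable {Ω : Type*}

/-- The epochs attached to the point `s` of `S`: the `n`-th point `e n S` uses `T n`. -/
def epochs (e : ℕ → Config (Space d) → Space d) (T : ℕ → Ω → Config ℝ)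
    (S : Config (Space d)) (ω : Ω) (s : Space d) : Set ℝ :=
  {τ | ∃ n, e n S = s ∧ τ ∈ T n ω}

/-- The harness process `η_t^γ(s) = ∑_{s' ∈ S} p_t(s, s') γ(s')`. -/
def harness (e : ℕ → Config (Space d) → Space d) (T : ℕ → Ω → Config ℝ) (γ : Surface d)
    (t : ℝ) (x : Config (Space d) × Ω) (s : Space d) : ℝ :=
  ∑' s' : x.1, transProb x.1 (epochs e T x.1 x.2) t s s' * γ s' x.1

end Dynamics

end Harness

end

open Harness

/-!
The proof is by duality. The height `η_t(s)` is the mean of `γ` over the backward walk from `s` for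
given clocks, so that products of heights at two points are means of `γ(x) γ(y)` over two walks which
use the same clocks and jump independently. Averaged over the clocks, such a pair of walks is a Markov
chain: at distinct sites each walker moves at rate one to a uniform neighbor; at a common site both
move at once, at rate one, to independent neighbors. Speeding this up to total rate two, the joint
law at time `t` is that of the discrete chain `pairStep` after a Poisson number, of mean `2t`, of
steps (`lintegral_walkKernel_mul`). This is shown by computing the right derivative of the joint law
(`abs_pairProb_step_le`: up to probability `O(h²)` at most one relevant clock rings, once, during a
time `h`, independently of the past) and iterating the resulting integral equation
(`abs_pairProb_sub_sum_le`).

Since only the gradient of `γ` is covariant, the argument is run with the squared differences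
`(γ(y) - γ(x))²`, which form a covariant field of two points (`heightGap`), not with products. Let
`F_t(s, s')` be the mean of this field over the two-walker chain at time `t` started from `(s, s')`
(`gapFlow`), and let, under the Palm measure,

* `α` be the mean of `∑ a(0, s) F_t(0, s)` (`edgeMass`),
* `β` be the mean of `a(0) F_t(0, 0)` (`diagMass`),
* `w` be the mean of `a(0)⁻¹ ∑ a(0, s) a(0, s') F_t(s, s')` (`cornerMass`).

For given clocks the two walks are independent, so that expanding the squares, and mass transport,
express the energy `H` and the dissipation `D` by `2 H + β = α` (`energy_add_diagMass`) and
`2 D + w + β = 2 α` (`dissipation_add_cornerMass`). Under one step of the chain `β` becomes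
`(w + β) / 2` by definition, and `α` becomes `w` by the mass transport principle (`mass_transport`,
`edgeMass_pairStep`). As steps occur at rate two, `α' = 2 (w - α)` and `β' = w - β`, whence
`2 H' = α' - β' = w + β - 2 α = -2 D`.

All sums are justified by the bound `2 ^ k` for the growth of `α`, `β` and `w` over `k` steps: the
relaxed triangle inequality for squared differences reduces the two walkers to a single lazy walk,
for which the environment seen from the walker is stationary under the degree-biased Palm measure
(`diagMass_lazyMoment_le`). These bounds need no more than a finite second moment of the gradient.
-/

open MeasureTheory ProbabilityTheory Filter Topology Set
open scoped ENNReal NNReal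

noncomputable section

namespace Harness

/-! ### Configurations as counting measures -/

namespace Config

lemma measurable_count {E : Type*} [Bornology E] [MeasurableSpace E] {B : Set E}
    (hb : Bornology.IsBounded B) (hB : MeasurableSet B) : Measurable (count B) := by
  refine measurable_to_countable' fun k => ?_
  exact MeasurableSpace.measurableSet_generateFrom ⟨B, k, hb, hB, rfl⟩

section Shift

variable {E : Type*} [NormedAddCommGroup E]

lemma mem_shift {x y : E} {S : Config E} : y ∈ S.shift x ↔ y + x ∈ S := by
  constructor
  · rintro ⟨s, hs, rfl⟩
    simpa using hs
  · intro h
    exact ⟨y + x, h, by simp⟩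

lemma sub_mem_shift {x y : E} {S : Config E} : y - x ∈ S.shift x ↔ y ∈ S := by
  rw [mem_shift, sub_add_cancel]

lemma shift_shift (x y : E) (S : Config E) : (S.shift x).shift y = S.shift (x + y) := by
  refine SetLike.ext fun z => ?_
  rw [mem_shift, mem_shift, mem_shift, add_assoc, add_comm y x]

/-- Sums over a translated configuration. -/
lemma tsum_shift (x : E) (S : Config E) (f : E → ℝ≥0∞) :
    ∑' s : S.shift x, f s = ∑' s : S, f (s - x) := by
  let φ : S ≃ S.shift x :=
    { toFun := fun s => ⟨s - x, sub_mem_shift.2 s.2⟩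
      invFun := fun s => ⟨s + x, mem_shift.1 s.2⟩
      left_inv := fun s => by simp
      right_inv := fun s => by simp }
  exact (φ.tsum_eq fun s : S.shift x => f s).symm

end Shift

/-- The half-open annuli of integer radii, a bounded Borel partition of the space. -/
def annulus (E : Type*) [NormedAddCommGroup E] (n : ℕ) : Set E := {x | ⌊‖x‖⌋₊ = n}

lemma isBounded_annulus {E : Type*} [NormedAddCommGroup E] (n : ℕ) :
    Bornology.IsBounded (annulus E n) := by
  refine isBounded_iff_forall_norm_le.2 ⟨n + 1, fun x hx => ?_⟩
  have := Nat.lt_floor_add_one ‖x‖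
  rw [show ⌊‖x‖⌋₊ = n from hx] at this
  exact this.le

section Counting

variable {E : Type*} [NormedAddCommGroup E] [MeasurableSpace E] [BorelSpace E]

/-- The counting measure of the points of a configuration. -/
def pointMeasure (S : Config E) : Measure E := Measure.sum fun s : S => Measure.dirac (s : E)

lemma lintegral_pointMeasure (S : Config E) (f : E → ℝ≥0∞) :
    ∫⁻ x, f x ∂S.pointMeasure = ∑' s : S, f s := by
  rw [pointMeasure, lintegral_sum_measure]
  simp

lemma pointMeasure_apply (S : Config E) {B : Set E} (hB : MeasurableSet B) :
    S.pointMeasure B = ((S : Set E) ∩ B).encard := by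
  rw [← lintegral_indicator_one hB, lintegral_pointMeasure, ← ENNReal.tsum_set_one]
  rw [tsum_subtype ((S : Set E) ∩ B) fun _ => (1 : ℝ≥0∞)]
  have := tsum_subtype (S : Set E) (B.indicator (1 : E → ℝ≥0∞))
  refine this.trans (tsum_congr fun x => ?_)
  by_cases h1 : x ∈ (S : Set E) <;> by_cases h2 : x ∈ B <;> simp [h1, h2]

lemma pointMeasure_apply_of_isBounded (S : Config E) {B : Set E} (hB : MeasurableSet B)
    (hb : Bornology.IsBounded B) : S.pointMeasure B = count B S := by
  have h : ((S : Set E) ∩ B).Finite := S.locallyFinite B hb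
  rw [pointMeasure_apply S hB, count, ← h.cast_ncard_eq]
  simp

lemma measurableSet_annulus (n : ℕ) : MeasurableSet (annulus E n) :=
  (Nat.measurable_floor.comp measurable_norm) (measurableSet_singleton n)

lemma pointMeasure_eq_tsum (S : Config E) {B : Set E} (hB : MeasurableSet B) :
    S.pointMeasure B = ∑' n, (count (B ∩ annulus E n) S : ℝ≥0∞) := by
  have : B = ⋃ n, B ∩ annulus E n := by
    rw [← inter_iUnion]
    refine (inter_eq_left.2 fun x _ => ?_).symm
    exact mem_iUnion.2 ⟨⌊‖x‖⌋₊, rfl⟩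
  conv_lhs => rw [this]
  rw [measure_iUnion]
  · refine tsum_congr fun n => ?_
    exact pointMeasure_apply_of_isBounded S (hB.inter (measurableSet_annulus n))
      ((isBounded_annulus n).subset inter_subset_right)
  · intro m n hmn
    refine Set.disjoint_left.2 fun x hx hx' => hmn ?_
    exact (show ⌊‖x‖⌋₊ = m from hx.2).symm.trans hx'.2
  · exact fun n => hB.inter (measurableSet_annulus n)

lemma measurable_pointMeasure : Measurable (pointMeasure : Config E → Measure E) := by
  refine Measure.measurable_of_measurable_coe _ fun B hB => ?_
  simp_rw [fun S : Config E => pointMeasure_eq_tsum S hB]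
  refine Measurable.tsum fun n => ?_
  exact (measurable_from_top (f := fun k : ℕ => (k : ℝ≥0∞))).comp (measurable_count
    ((isBounded_annulus n).subset inter_subset_right) (hB.inter (measurableSet_annulus n)))

variable (E) in
/-- The kernel sending a configuration to its counting measure. -/
def pointKernel : Kernel (Config E) E := ⟨pointMeasure, measurable_pointMeasure⟩

lemma pointKernel_apply (S : Config E) : pointKernel E S = S.pointMeasure := rfl

/-- Cutting according to the annulus and to the number of points in it exhibits the counting
kernel as a countable sum of finite kernels. -/
instance : IsSFiniteKernel (pointKernel E) := by
  have hm (n k : ℕ) : MeasurableSet {S : Config E | count (annulus E n) S = k} :=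
    measurable_count (isBounded_annulus n) (measurableSet_annulus n) (measurableSet_singleton k)
  classical
  let κ (p : ℕ × ℕ) : Kernel (Config E) E :=
    Kernel.piecewise (hm p.1 p.2) ((pointKernel E).restrict (measurableSet_annulus p.1)) 0
  have hκ (p : ℕ × ℕ) : IsFiniteKernel (κ p) := by
    refine ⟨⟨p.2, ENNReal.natCast_lt_top _, fun S => ?_⟩⟩
    rw [Kernel.piecewise_apply]
    split_ifs with h
    · rw [Kernel.restrict_apply, Measure.restrict_apply_univ, pointKernel_apply,
        pointMeasure_apply_of_isBounded S (measurableSet_annulus _) (isBounded_annulus _)]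
      exact_mod_cast le_of_eq h
    · simp
  have : pointKernel E = Kernel.sum κ := by
    ext S B hB
    rw [Kernel.sum_apply' _ _ hB, ENNReal.tsum_prod', pointKernel_apply, pointMeasure_eq_tsum S hB]
    refine tsum_congr fun n => ?_
    rw [tsum_eq_single (count (annulus E n) S)]
    · have hS : S ∈ {S' : Config E | count (annulus E n) S' = count (annulus E n) S} := rfl
      simp only [κ, Kernel.piecewise_apply, if_pos hS]
      rw [Kernel.restrict_apply, Measure.restrict_apply hB, pointKernel_apply,
        pointMeasure_apply_of_isBounded]
      · exact hB.inter (measurableSet_annulus n)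
      · exact (isBounded_annulus n).subset inter_subset_right
    · intro k hk
      rw [Kernel.piecewise_apply,
        if_neg (show S ∉ {S | count (annulus E n) S = k} from fun h => hk h.symm)]
      simp
  rw [this]
  infer_instance

/-- Sums over the points of a configuration of a jointly measurable function are measurable. -/
lemma _root_.Measurable.tsum_config {α : Type*} [MeasurableSpace α] {g : α → Config E}
    (hg : Measurable g) {f : α → E → ℝ≥0∞} (hf : Measurable (Function.uncurry f)) :
    Measurable fun a => ∑' s : g a, f a s := by
  have h : Measurable fun a => ∫⁻ s, f a s ∂((pointKernel E).comap g hg) a :=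
    Measurable.lintegral_kernel_prod_right hf
  simpa only [Kernel.comap_apply, pointKernel_apply, lintegral_pointMeasure] using h

variable [SecondCountableTopology E]

/-- A point belongs to a configuration if and only if it carries an atom of the counting measure. -/
lemma measurableSet_mem : MeasurableSet {p : E × Config E | p.1 ∈ p.2} := by
  have h : Measurable fun p : E × Config E =>
      ∑' s : p.2, ({p.1} : Set E).indicator (1 : E → ℝ≥0∞) s := by
    refine measurable_snd.tsum_config (f := fun p s => ({p.1} : Set E).indicator 1 s) ?_
    have : MeasurableSet {q : (E × Config E) × E | q.2 = q.1.1} :=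
      measurableSet_eq_fun measurable_snd (measurable_fst.comp measurable_fst)
    exact (measurable_const (a := (1 : ℝ≥0∞))).indicator this
  convert h (measurableSet_singleton 0).compl using 1
  ext p
  simp only [mem_ofPred_eq, preimage_compl, mem_compl_iff, mem_preimage, mem_singleton_iff,
    ENNReal.tsum_eq_zero, indicator_apply_eq_zero, Pi.one_apply, one_ne_zero, imp_false]
  simp

lemma measurable_shift : Measurable fun p : E × Config E => p.2.shift p.1 := by
  refine measurable_generateFrom ?_
  rintro _ ⟨B, k, hb, hB, rfl⟩
  have hB' : MeasurableSet {q : (E × Config E) × E | q.2 - q.1.1 ∈ B} :=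
    (measurable_snd.sub (measurable_fst.comp measurable_fst)) hB
  have h : Measurable fun p : E × Config E => ∑' s : p.2, B.indicator (1 : E → ℝ≥0∞) (s - p.1) :=
    measurable_snd.tsum_config (f := fun p s => B.indicator (1 : E → ℝ≥0∞) (s - p.1))
      ((measurable_const (a := (1 : ℝ≥0∞))).indicator hB')
  convert h (measurableSet_singleton (k : ℝ≥0∞)) using 1
  ext p
  rw [mem_preimage, mem_preimage, mem_singleton_iff, ← tsum_shift p.1 p.2,
    ← lintegral_pointMeasure, lintegral_indicator_one hB, pointMeasure_apply_of_isBounded _ hB hb]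
  simp

lemma measurable_shift_right (x : E) : Measurable (shift x : Config E → Config E) :=
  measurable_shift.comp measurable_prodMk_left

end Counting
end Config

/-! ### The Voronoi neighbor relation -/

section Neighbors

open scoped Pointwise

variable {d : ℕ}

lemma IsNeighbor.symm {S : Config (Space d)} {s s' : Space d} (h : IsNeighbor S s s') :
    IsNeighbor S s' s := by
  obtain ⟨h1, h2, h3, h4, h5⟩ := h
  exact ⟨h2, h1, h3.symm, by rwa [inter_comm], by rwa [inter_comm]⟩

lemma mem_voronoi_iff {s x : Space d} {S : Config (Space d)} :
    x ∈ voronoi s S ↔ ∀ s' ∈ S, ‖x - s‖ ≤ ‖x - s'‖ := by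
  refine ⟨fun h s' hs' => ?_, fun h s' hs' _ => h s' hs'⟩
  rcases eq_or_ne s' s with rfl | hne
  · exact le_rfl
  · exact h s' hs' hne

lemma voronoi_shift (x s : Space d) (S : Config (Space d)) :
    voronoi (s - x) (S.shift x) = -x +ᵥ voronoi s S := by
  ext y
  rw [mem_vadd_set_iff_neg_vadd_mem, neg_neg, vadd_eq_add, mem_voronoi_iff, mem_voronoi_iff]
  constructor
  · intro h s' hs'
    have := h (s' - x) (Config.sub_mem_shift.2 hs')
    rwa [show y - (s - x) = x + y - s by abel, show y - (s' - x) = x + y - s' by abel] at this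
  · intro h s' hs'
    have := h (s' + x) (Config.mem_shift.1 hs')
    rwa [show y - (s - x) = x + y - s by abel, show y - s' = x + y - (s' + x) by abel]

lemma isNeighbor_shift (x : Space d) (S : Config (Space d)) (s s' : Space d) :
    IsNeighbor (S.shift x) (s - x) (s' - x) ↔ IsNeighbor S s s' := by
  unfold IsNeighbor
  rw [voronoi_shift, voronoi_shift, ← vadd_set_inter, vectorSpan_vadd, Config.sub_mem_shift,
    Config.sub_mem_shift, vadd_set_nonempty, Ne, Ne, sub_left_inj]

/-- The orthogonal projection to the bisecting hyperplane of `s` and `s'`. -/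
def bisectorProj (s s' z : Space d) : Space d :=
  z - (inner ℝ (z - midpoint ℝ s s') (s' - s) / ‖s' - s‖ ^ 2) • (s' - s)

lemma bisectorProj_lineCombination (s s' z w : Space d) {a b : ℝ} (hab : a + b = 1) :
    bisectorProj s s' (a • z + b • w) = a • bisectorProj s s' z + b • bisectorProj s s' w := by
  have : a • z + b • w - midpoint ℝ s s'
      = a • (z - midpoint ℝ s s') + b • (w - midpoint ℝ s s') := by
    nth_rw 1 [← one_smul ℝ (midpoint ℝ s s'), ← hab]
    module
  unfold bisectorProj
  rw [this, inner_add_left, real_inner_smul_left, real_inner_smul_left]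
  module

lemma mem_bisector {s s' x : Space d} (S : Config (Space d)) (hs : s ∈ S) (hs' : s' ∈ S)
    (hx : x ∈ voronoi s S ∩ voronoi s' S) : inner ℝ (x - midpoint ℝ s s') (s' - s) = 0 := by
  have h1 := mem_voronoi_iff.1 hx.1 s' hs'
  have h2 := mem_voronoi_iff.1 hx.2 s hs
  have := (AffineSubspace.mem_perpBisector_iff_dist_eq (c := x) (p₁ := s) (p₂ := s')).2
    (by rw [dist_eq_norm, dist_eq_norm]; exact le_antisymm h1 h2)
  exact AffineSubspace.mem_perpBisector_iff_inner_eq_zero.1 this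

/-- Two points of `S` are neighbors if and only if the cylinder of all points whose projection to
the bisecting hyperplane lies in both cells has positive volume. Unlike the dimension of the
intersection of the cells, this volume is a measurable function of the points and of `S`. -/
lemma isNeighbor_iff_volume_pos {S : Config (Space d)} {s s' : Space d} (hs : s ∈ S)
    (hs' : s' ∈ S) (hne : s ≠ s') :
    IsNeighbor S s s' ↔
      0 < volume {z | bisectorProj s s' z ∈ voronoi s S ∩ voronoi s' S} := by
  set C := voronoi s S ∩ voronoi s' S with hC
  set D := {z | bisectorProj s s' z ∈ C} with hD
  have hv : s' - s ≠ 0 := sub_ne_zero.2 hne.symm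
  have hCD : C ⊆ D := fun x hx => by
    have : bisectorProj s s' x = x := by
      rw [bisectorProj, mem_bisector S hs hs' hx]
      simp
    rw [hD, mem_ofPred_eq, this]
    exact hx
  -- the common face lies in the bisecting hyperplane, and `D` adds only the direction `s' - s`
  have hCv : vectorSpan ℝ C ≤ (ℝ ∙ (s' - s))ᗮ := by
    refine Submodule.span_le.2 ?_
    rintro _ ⟨x, hx, y, hy, rfl⟩
    refine Submodule.mem_orthogonal_singleton_iff_inner_left.2 ?_
    change inner ℝ (x - y) (s' - s) = 0
    rw [← sub_sub_sub_cancel_right x y (midpoint ℝ s s'), inner_sub_left,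
      mem_bisector S hs hs' hx, mem_bisector S hs hs' hy, sub_zero]
  have hDC : vectorSpan ℝ D ≤ vectorSpan ℝ C ⊔ ℝ ∙ (s' - s) := by
    refine Submodule.span_le.2 ?_
    rintro _ ⟨x, hx, y, hy, rfl⟩
    have h1 := vsub_mem_vectorSpan ℝ (s := C) hx hy
    refine Submodule.mem_sup.2 ⟨_, h1, _, Submodule.smul_mem _
      (inner ℝ (x - midpoint ℝ s s') (s' - s) / ‖s' - s‖ ^ 2
        - inner ℝ (y - midpoint ℝ s s') (s' - s) / ‖s' - s‖ ^ 2)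
      (Submodule.mem_span_singleton_self (s' - s)), ?_⟩
    simp only [vsub_eq_sub, bisectorProj]
    module
  have hfin : Module.finrank ℝ (ℝ ∙ (s' - s))ᗮ + 1 = d := by
    have := Submodule.finrank_add_finrank_orthogonal (ℝ ∙ (s' - s))
    rw [finrank_span_singleton hv, finrank_euclideanSpace_fin] at this
    omega
  have hvor (u : Space d) : Convex ℝ (voronoi u S) := by
    have : voronoi u S
        = ⋂ t ∈ S, {x | 0 ≤ inner ℝ x ((2 : ℝ) • (u - t)) + (‖t‖ ^ 2 - ‖u‖ ^ 2)} := by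
      ext x
      simp only [mem_voronoi_iff, mem_iInter, mem_ofPred_eq]
      refine forall₂_congr fun t _ => ?_
      rw [← sq_le_sq₀ (norm_nonneg _) (norm_nonneg _), norm_sub_sq_real, norm_sub_sq_real,
        real_inner_smul_right, inner_sub_right]
      constructor <;> intro h <;> linarith
    rw [this]
    refine convex_iInter₂ fun t _ => ?_
    intro x hx y hy a b ha hb hab
    simp only [mem_ofPred_eq, inner_add_left, real_inner_smul_left] at hx hy ⊢
    have : b = 1 - a := by linarith
    subst this
    nlinarith [mul_nonneg ha hx, mul_nonneg hb hy]
  have hDconv : Convex ℝ D := fun z hz w hw a b ha hb hab => by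
    rw [hD, mem_ofPred_eq, bisectorProj_lineCombination s s' z w hab]
    exact ((hvor s).inter (hvor s')) hz hw ha hb hab
  constructor
  · rintro ⟨-, -, -, hne', hdim⟩
    rw [← hC] at hne' hdim
    obtain ⟨c, hc⟩ := hne'
    have h1 : vectorSpan ℝ C = (ℝ ∙ (s' - s))ᗮ :=
      Submodule.eq_of_le_of_finrank_eq hCv (by omega)
    have h2 : s' - s ∈ vectorSpan ℝ D := by
      have hcD : c + (s' - s) ∈ D := by
        have : bisectorProj s s' (c + (s' - s)) = c := by
          have e : c + (s' - s) - midpoint ℝ s s' = (c - midpoint ℝ s s') + (s' - s) := by abel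
          rw [bisectorProj, e, inner_add_left, mem_bisector S hs hs' hc,
            real_inner_self_eq_norm_sq, zero_add, div_self (by simpa using hv)]
          module
        rw [hD, mem_ofPred_eq, this]
        exact hc
      simpa using vsub_mem_vectorSpan ℝ hcD (hCD hc)
    have h3 : vectorSpan ℝ D = ⊤ := by
      refine top_le_iff.1 ?_
      rw [← Submodule.sup_orthogonal_of_hasOrthogonalProjection (K := ℝ ∙ (s' - s)), ← h1]
      exact sup_le ((Submodule.span_singleton_le_iff_mem _ _).2 h2) (vectorSpan_mono ℝ hCD)
    have h4 : (interior D).Nonempty := by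
      rw [hDconv.interior_nonempty_iff_affineSpan_eq_top]
      exact (AffineSubspace.affineSpan_eq_top_iff_vectorSpan_eq_top_of_nonempty ℝ _ _
        ⟨c, hCD hc⟩).2 h3
    exact (isOpen_interior.measure_pos volume h4).trans_le (measure_mono interior_subset)
  · intro hpos
    have hDne : D.Nonempty := nonempty_of_measure_ne_zero hpos.ne'
    have h1 : affineSpan ℝ D = ⊤ := by
      by_contra hcon
      refine hpos.ne' (measure_mono_null (subset_affineSpan ℝ D) ?_)
      exact Measure.addHaar_affineSubspace volume _ hcon
    have h2 : vectorSpan ℝ D = ⊤ :=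
      (AffineSubspace.affineSpan_eq_top_iff_vectorSpan_eq_top_of_nonempty ℝ _ _ hDne).1 h1
    have h3 : d ≤ Module.finrank ℝ (vectorSpan ℝ C) + 1 := by
      have h4 := Submodule.finrank_add_le_finrank_add_finrank (vectorSpan ℝ C) (ℝ ∙ (s' - s))
      rw [h2] at hDC
      rw [top_le_iff.1 hDC, finrank_top, finrank_euclideanSpace_fin,
        finrank_span_singleton hv] at h4
      exact h4
    have h4 := Submodule.finrank_mono hCv
    obtain ⟨z, hz⟩ := hDne
    exact ⟨hs, hs', hne, ⟨_, hz⟩, by rw [← hC]; omega⟩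

/-- A point lies in a cell if and only if no point of the configuration is strictly closer. -/
lemma measurableSet_mem_voronoi :
    MeasurableSet {p : Space d × Space d × Config (Space d) | p.1 ∈ voronoi p.2.1 p.2.2} := by
  have hB : MeasurableSet {q : (Space d × Space d × Config (Space d)) × Space d |
      ‖q.1.1 - q.2‖ < ‖q.1.1 - q.1.2.1‖} :=
    measurableSet_lt (by fun_prop) (by fun_prop)
  have h : Measurable fun p : Space d × Space d × Config (Space d) => ∑' t : p.2.2,
      {t | ‖p.1 - t‖ < ‖p.1 - p.2.1‖}.indicator (1 : Space d → ℝ≥0∞) t :=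
    (measurable_snd.comp measurable_snd).tsum_config
      (f := fun p t => {t | ‖p.1 - t‖ < ‖p.1 - p.2.1‖}.indicator (1 : Space d → ℝ≥0∞) t)
      ((measurable_const (a := (1 : ℝ≥0∞))).indicator hB)
  convert h (measurableSet_singleton 0) using 1
  ext p
  simp only [mem_ofPred_eq, mem_voronoi_iff, mem_preimage, mem_singleton_iff,
    ENNReal.tsum_eq_zero, indicator_apply_eq_zero, Pi.one_apply, one_ne_zero, imp_false, not_lt,
    Subtype.forall]

lemma measurableSet_isNeighbor :
    MeasurableSet {p : Space d × Space d × Config (Space d) | IsNeighbor p.2.2 p.1 p.2.1} := by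
  have hproj : Measurable fun q : (Space d × Space d × Config (Space d)) × Space d =>
      bisectorProj q.1.1 q.1.2.1 q.2 := by
    have : Continuous fun q : (Space d × Space d) × Space d => midpoint ℝ q.1.1 q.1.2 := by
      simp only [midpoint_eq_smul_add]
      fun_prop
    have h2 : Measurable fun q : (Space d × Space d × Config (Space d)) × Space d =>
        midpoint ℝ q.1.1 q.1.2.1 :=
      this.measurable.comp (f := fun q : (Space d × Space d × Config (Space d)) × Space d =>
        ((q.1.1, q.1.2.1), q.2)) (by fun_prop)
    unfold bisectorProj
    fun_prop
  have hvor : MeasurableSet {q : (Space d × Space d × Config (Space d)) × Space d |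
      bisectorProj q.1.1 q.1.2.1 q.2 ∈ voronoi q.1.1 q.1.2.2 ∩ voronoi q.1.2.1 q.1.2.2} :=
    (measurableSet_mem_voronoi.preimage (hproj.prodMk
      (f := fun q : (Space d × Space d × Config (Space d)) × Space d => _)
      (g := fun q => (q.1.1, q.1.2.2)) (by fun_prop))).inter
    (measurableSet_mem_voronoi.preimage (hproj.prodMk
      (f := fun q : (Space d × Space d × Config (Space d)) × Space d => _)
      (g := fun q => (q.1.2.1, q.1.2.2)) (by fun_prop)))
  have hvol := measurable_measure_prodMk_left (ν := (volume : Measure (Space d))) hvor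
  have h1 : MeasurableSet {p : Space d × Space d × Config (Space d) | p.1 ∈ p.2.2} :=
    Config.measurableSet_mem.preimage (by fun_prop :
      Measurable fun p : Space d × Space d × Config (Space d) => (p.1, p.2.2))
  have h2 : MeasurableSet {p : Space d × Space d × Config (Space d) | p.2.1 ∈ p.2.2} :=
    Config.measurableSet_mem.preimage measurable_snd
  have h3 : MeasurableSet {p : Space d × Space d × Config (Space d) | p.1 = p.2.1} :=
    measurableSet_eq_fun measurable_fst (by fun_prop)
  convert ((h1.inter h2).inter h3.compl).inter (hvol measurableSet_Ioi) using 1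
  ext p
  by_cases hp : p.1 ∈ p.2.2 ∧ p.2.1 ∈ p.2.2 ∧ p.1 ≠ p.2.1
  · simp only [mem_ofPred_eq, mem_inter_iff, mem_compl_iff, mem_preimage, hp.1, hp.2.1,
      isNeighbor_iff_volume_pos hp.1 hp.2.1 hp.2.2, true_and, mem_Ioi]
    exact ⟨fun h => ⟨hp.2.2, h⟩, fun h => h.2⟩
  · refine iff_of_false (fun h => hp ⟨h.1, h.2.1, h.2.2.1⟩) fun h => hp ⟨h.1.1.1, h.1.1.2, h.1.2⟩

/-- The conductance as an extended nonnegative number. -/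
def edge (S : Config (Space d)) (s s' : Space d) : ℝ≥0∞ := ENNReal.ofReal (conductance S s s')

open Classical in
lemma edge_eq (S : Config (Space d)) (s s' : Space d) :
    edge S s s' = if IsNeighbor S s s' then 1 else 0 := by
  unfold edge conductance
  split_ifs <;> simp

lemma edge_comm (S : Config (Space d)) (s s' : Space d) : edge S s s' = edge S s' s := by
  classical
  rw [edge_eq, edge_eq]
  exact if_congr ⟨IsNeighbor.symm, IsNeighbor.symm⟩ rfl rfl

lemma edge_self (S : Config (Space d)) (s : Space d) : edge S s s = 0 := by
  classical
  rw [edge_eq, if_neg fun h => h.2.2.1 rfl]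

lemma edge_ne_zero {S : Config (Space d)} {s s' : Space d} :
    edge S s s' ≠ 0 ↔ IsNeighbor S s s' := by
  classical
  rw [edge_eq]
  split_ifs with h <;> simp [h]

lemma edge_shift (x : Space d) (S : Config (Space d)) (s s' : Space d) :
    edge (S.shift x) (s - x) (s' - x) = edge S s s' := by
  classical
  rw [edge_eq, edge_eq]
  exact if_congr (isNeighbor_shift x S s s') rfl rfl

lemma measurable_edge :
    Measurable fun p : Space d × Space d × Config (Space d) => edge p.2.2 p.1 p.2.1 := by
  classical
  simp only [edge_eq]
  exact Measurable.ite measurableSet_isNeighbor measurable_const measurable_const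

/-- A sum weighted by conductances runs over the points of the configuration only. -/
lemma tsum_edge_mul (S : Config (Space d)) (s : Space d) (g : Space d → ℝ≥0∞) :
    ∑' z, edge S s z * g z = ∑' z : S, edge S s z * g z := by
  refine (tsum_subtype_eq_of_support_subset (s := (S : Set (Space d))) fun z hz => ?_).symm
  exact (edge_ne_zero.1 (left_ne_zero_of_mul hz)).2.1

end Neighbors

/-! ### The two-walker chain on a weighted graph -/

section Chain

variable {V : Type*} (a : V → V → ℝ≥0∞)

/-- The total weight of the edges at `s`. -/
def deg (s : V) : ℝ≥0∞ := ∑' z, a s z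

/-- The average of `g` over the neighbors of `s`; it is `0` at isolated points and at points of
infinite degree. -/
def avg (g : V → ℝ≥0∞) (s : V) : ℝ≥0∞ := (deg a s)⁻¹ * ∑' z, a s z * g z

/-- Averaging in the first variable. -/
def avgLeft (F : V → V → ℝ≥0∞) (s s' : V) : ℝ≥0∞ := avg a (fun z => F z s') s

/-- Averaging in the second variable. -/
def avgRight (F : V → V → ℝ≥0∞) (s s' : V) : ℝ≥0∞ := avg a (fun z => F s z) s'

open Classical in
/-- One step of the uniformized chain of two walkers that share the clocks of the sites: at distinct
sites a walker chosen at random moves; at a common site both move, independently, or both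
stay. -/
def pairStep (F : V → V → ℝ≥0∞) (s s' : V) : ℝ≥0∞ :=
  if s = s' then 2⁻¹ * (avgLeft a (avgRight a F) s s + F s s)
  else 2⁻¹ * (avgLeft a F s s' + avgRight a F s s')

/-- One step of the lazy walk, the marginal of the chain of two walkers. -/
def lazyStep (g : V → ℝ≥0∞) (s : V) : ℝ≥0∞ := 2⁻¹ * (avg a g s + g s)

variable {a}

lemma avg_mono {g h : V → ℝ≥0∞} (hgh : g ≤ h) : avg a g ≤ avg a h := fun s => by
  unfold avg
  gcongr with z
  exact hgh z

lemma avg_add (g h : V → ℝ≥0∞) (s : V) : avg a (fun z => g z + h z) s = avg a g s + avg a h s := by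
  simp only [avg, mul_add, ENNReal.tsum_add]

lemma avg_const_mul (c : ℝ≥0∞) (g : V → ℝ≥0∞) (s : V) :
    avg a (fun z => c * g z) s = c * avg a g s := by
  simp only [avg, mul_left_comm _ c, ENNReal.tsum_mul_left]

lemma avg_tsum {ι : Type*} (g : ι → V → ℝ≥0∞) (s : V) :
    avg a (fun z => ∑' i, g i z) s = ∑' i, avg a (g i) s := by
  simp only [avg, ← ENNReal.tsum_mul_left]
  exact ENNReal.tsum_comm

lemma avg_sum {ι : Type*} (t : Finset ι) (g : ι → V → ℝ≥0∞) (s : V) :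
    avg a (fun z => ∑ i ∈ t, g i z) s = ∑ i ∈ t, avg a (g i) s := by
  simp only [avg, Finset.mul_sum]
  rw [Summable.tsum_finsetSum fun _ _ => ENNReal.summable, Finset.mul_sum]

lemma avg_const_le (c : ℝ≥0∞) (s : V) : avg a (fun _ => c) s ≤ c := by
  rw [avg, ENNReal.tsum_mul_right, ← mul_assoc, ← deg]
  exact mul_le_of_le_one_left' (ENNReal.inv_mul_le_one _)

lemma avg_const {s : V} (h0 : deg a s ≠ 0) (htop : deg a s ≠ ∞) (c : ℝ≥0∞) :
    avg a (fun _ => c) s = c := by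
  rw [avg, ENNReal.tsum_mul_right, ← mul_assoc, ← deg, ENNReal.inv_mul_cancel h0 htop, one_mul]

lemma deg_mul_avg {s : V} (htop : deg a s ≠ ∞) (g : V → ℝ≥0∞) :
    deg a s * avg a g s = ∑' z, a s z * g z := by
  rcases eq_or_ne (deg a s) 0 with h0 | h0
  · rw [h0, zero_mul]
    have : ∀ z, a s z = 0 := ENNReal.tsum_eq_zero.1 h0
    simp [this]
  · rw [avg, ← mul_assoc, ENNReal.mul_inv_cancel h0 htop, one_mul]

lemma deg_mul_avg_le (s : V) (g : V → ℝ≥0∞) : deg a s * avg a g s ≤ ∑' z, a s z * g z := by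
  rw [avg, ← mul_assoc]
  exact mul_le_of_le_one_left' (ENNReal.mul_inv_le_one _)

lemma avgLeft_avgRight (F : V → V → ℝ≥0∞) :
    avgLeft a (avgRight a F) = avgRight a (avgLeft a F) := by
  funext s s'
  simp only [avgLeft, avgRight, avg, ← ENNReal.tsum_mul_left]
  rw [ENNReal.tsum_comm]
  exact tsum_congr fun z => tsum_congr fun w => by ring

lemma pairStep_self (F : V → V → ℝ≥0∞) (s : V) :
    pairStep a F s s = 2⁻¹ * (avgLeft a (avgRight a F) s s + F s s) := if_pos rfl

lemma pairStep_of_ne (F : V → V → ℝ≥0∞) {s s' : V} (h : s ≠ s') :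
    pairStep a F s s' = 2⁻¹ * (avgLeft a F s s' + avgRight a F s s') := if_neg h

lemma avgLeft_mono {F G : V → V → ℝ≥0∞} (h : F ≤ G) : avgLeft a F ≤ avgLeft a G :=
  fun s s' => avg_mono (fun z => h z s') s

lemma avgRight_mono {F G : V → V → ℝ≥0∞} (h : F ≤ G) : avgRight a F ≤ avgRight a G :=
  fun s s' => avg_mono (fun z => h s z) s'

lemma pairStep_mono : Monotone (pairStep a) := fun F G h s s' => by
  rcases eq_or_ne s s' with rfl | hs
  · rw [pairStep_self, pairStep_self]
    gcongr
    · exact avgLeft_mono (avgRight_mono h) s s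
    · exact h s s
  · rw [pairStep_of_ne _ hs, pairStep_of_ne _ hs]
    gcongr
    · exact avgLeft_mono h s s'
    · exact avgRight_mono h s s'

lemma pairStep_tsum {ι : Type*} (F : ι → V → V → ℝ≥0∞) (s s' : V) :
    pairStep a (fun z z' => ∑' i, F i z z') s s' = ∑' i, pairStep a (F i) s s' := by
  rcases eq_or_ne s s' with rfl | hs
  · simp only [pairStep_self, avgLeft, avgRight, avg_tsum, ENNReal.tsum_mul_left, ENNReal.tsum_add]
  · simp only [pairStep_of_ne _ hs, avgLeft, avgRight, avg_tsum, ENNReal.tsum_mul_left,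
      ENNReal.tsum_add]

lemma pairStep_const_mul (c : ℝ≥0∞) (F : V → V → ℝ≥0∞) (s s' : V) :
    pairStep a (fun z z' => c * F z z') s s' = c * pairStep a F s s' := by
  rcases eq_or_ne s s' with rfl | hs
  · simp only [pairStep_self, avgLeft, avgRight, avg_const_mul]
    ring
  · simp only [pairStep_of_ne _ hs, avgLeft, avgRight, avg_const_mul]
    ring

lemma pairStep_iterate_tsum {ι : Type*} (c : ι → ℝ≥0∞) (F : ι → V → V → ℝ≥0∞) (k : ℕ) (s s' : V) :
    (pairStep a)^[k] (fun z z' => ∑' i, c i * F i z z') s s'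
      = ∑' i, c i * (pairStep a)^[k] (F i) s s' := by
  induction k generalizing s s' with
  | zero => rfl
  | succ k ih =>
    rw [Function.iterate_succ_apply', funext₂ ih, pairStep_tsum]
    simp only [pairStep_const_mul, Function.iterate_succ_apply']

lemma pairStep_symm {F : V → V → ℝ≥0∞} (hF : ∀ s s', F s s' = F s' s) (s s' : V) :
    pairStep a F s s' = pairStep a F s' s := by
  rcases eq_or_ne s s' with rfl | hs
  · rfl
  · have h (s s' : V) : avgLeft a F s s' = avgRight a F s' s := by
      simp only [avgLeft, avgRight, hF s']
    rw [pairStep_of_ne _ hs, pairStep_of_ne _ hs.symm, h s s', ← h s' s, add_comm]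

lemma pairStep_iterate_symm {F : V → V → ℝ≥0∞} (hF : ∀ s s', F s s' = F s' s) (k : ℕ) (s s' : V) :
    (pairStep a)^[k] F s s' = (pairStep a)^[k] F s' s := by
  induction k generalizing s s' with
  | zero => exact hF s s'
  | succ k ih =>
    rw [Function.iterate_succ_apply']
    exact pairStep_symm ih s s'

lemma lazyStep_mono : Monotone (lazyStep a) := fun g h hgh s => by
  unfold lazyStep
  gcongr
  · exact avg_mono hgh s
  · exact hgh s

lemma half_add_self (c : ℝ≥0∞) : 2⁻¹ * (c + c) = c := by
  rw [← two_mul, ← mul_assoc, ENNReal.inv_mul_cancel two_ne_zero ENNReal.ofNat_ne_top, one_mul]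

/-- A sum of functions of the single walkers is mapped below the sum of their lazy steps. -/
lemma pairStep_add_le (g g' : V → ℝ≥0∞) (c : ℝ≥0∞) (s s' : V) :
    pairStep a (fun z z' => g z + c + g' z') s s' ≤ lazyStep a g s + c + lazyStep a g' s' := by
  -- moving one of the walkers, or both or none, has the same mean effect on such a sum
  have hr : 2⁻¹ * ((avg a g s + c + g' s') + (g s + c + avg a g' s'))
      = lazyStep a g s + c + lazyStep a g' s' := by
    conv_rhs => rw [← half_add_self c]
    unfold lazyStep
    ring
  have hR (s s' : V) : avgRight a (fun z z' => g z + c + g' z') s s' ≤ g s + c + avg a g' s' := by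
    unfold avgRight
    rw [avg_add]
    gcongr
    exact avg_const_le _ _
  have hL (s s' : V) : avgLeft a (fun z z' => g z + c + g' z') s s' ≤ avg a g s + c + g' s' := by
    unfold avgLeft
    simp only [add_assoc]
    rw [avg_add]
    gcongr
    exact avg_const_le _ _
  rcases eq_or_ne s s' with rfl | hs
  · rw [pairStep_self]
    have h1 : avgLeft a (avgRight a fun z z' => g z + c + g' z') s s
        ≤ avg a g s + c + avg a g' s := by
      refine (avgLeft_mono (fun z z' => hR z z') s s).trans ?_
      unfold avgLeft
      simp only [add_assoc]
      rw [avg_add]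
      gcongr
      exact avg_const_le _ _
    refine (mul_le_mul_right (add_le_add_left h1 _) _).trans (le_of_eq ?_)
    rw [← hr]
    ring
  · rw [pairStep_of_ne _ hs, ← hr]
    gcongr
    · exact hL s s'
    · exact hR s s'

lemma pairStep_iterate_add_le (g g' : V → ℝ≥0∞) (c : ℝ≥0∞) (k : ℕ) (s s' : V) :
    (pairStep a)^[k] (fun z z' => g z + c + g' z') s s'
      ≤ (lazyStep a)^[k] g s + c + (lazyStep a)^[k] g' s' := by
  induction k generalizing g g' with
  | zero => rfl
  | succ k ih =>
    simp only [Function.iterate_succ_apply]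
    exact (pairStep_mono.iterate k (fun z z' => pairStep_add_le g g' c z z') s s').trans (ih _ _)

/-- The mean of `F (s, ·)` over the position after `k` steps of the lazy walk started at `s`. -/
def lazyMoment (a : V → V → ℝ≥0∞) (F : V → V → ℝ≥0∞) (k : ℕ) (s : V) : ℝ≥0∞ :=
  (lazyStep a)^[k] (F s) s

/-- A function `F` satisfying a relaxed triangle inequality is controlled, along the two-walker
chain, by the moments of the single walkers. -/
lemma pairStep_iterate_le_lazyMoment {F : V → V → ℝ≥0∞} {C : ℝ≥0∞}
    (hF : ∀ x y s s', F x y ≤ C * (F s x + F s s' + F s' y)) (k : ℕ) (s s' : V) :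
    (pairStep a)^[k] F s s' ≤ C * (lazyMoment a F k s + F s s' + lazyMoment a F k s') := by
  have h1 : F ≤ fun x y => ∑' _ : Unit, C * (F s x + F s s' + F s' y) := fun x y => by
    simpa using hF x y s s'
  refine (pairStep_mono.iterate k h1 s s').trans ?_
  rw [pairStep_iterate_tsum (fun _ => C) fun _ x y => F s x + F s s' + F s' y]
  simp only [tsum_fintype, Finset.univ_unique, Finset.sum_const, Finset.card_singleton, one_smul]
  gcongr
  exact pairStep_iterate_add_le (F s) (F s') (F s s') k s s'

lemma lazyStep_iterate_add_const_mul_le (c : ℝ≥0∞) (b : ℝ≥0∞) (g : V → ℝ≥0∞) (k : ℕ) (s : V) :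
    (lazyStep a)^[k] (fun z => c + b * g z) s ≤ c + b * (lazyStep a)^[k] g s := by
  induction k generalizing g with
  | zero => rfl
  | succ k ih =>
    simp only [Function.iterate_succ_apply]
    refine (lazyStep_mono.iterate k (fun z => ?_) s).trans (ih _)
    unfold lazyStep
    rw [avg_add, avg_const_mul]
    calc 2⁻¹ * (avg a (fun _ => c) z + b * avg a g z + (c + b * g z))
        ≤ 2⁻¹ * (c + b * avg a g z + (c + b * g z)) := by
          gcongr
          exact avg_const_le c z
      _ = 2⁻¹ * (c + c) + b * (2⁻¹ * (avg a g z + g z)) := by ring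
      _ = c + b * (2⁻¹ * (avg a g z + g z)) := by rw [half_add_self]

/-- By the relaxed triangle inequality, the value at the end of a walk of `k + 1` steps is compared
with that of the walk of `k` steps that starts at the point reached by the first step. -/
lemma lazyMoment_succ_le {F : V → V → ℝ≥0∞} (h0 : ∀ s, F s s = 0)
    (hF : ∀ s x z, F s x ≤ 2 * (F s z + F z x)) (k : ℕ) (s : V) :
    lazyMoment a F (k + 1) s
      ≤ avg a (F s) s + avg a (lazyMoment a F k) s + lazyMoment a F k s := by
  have h1 (z : V) : (lazyStep a)^[k] (F s) z ≤ 2 * F s z + 2 * lazyMoment a F k z := by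
    refine (lazyStep_mono.iterate k (fun x => ?_) z).trans
      (lazyStep_iterate_add_const_mul_le (2 * F s z) 2 (F z) k z)
    exact (hF s x z).trans (le_of_eq (mul_add _ _ _))
  rw [lazyMoment, Function.iterate_succ_apply']
  refine (lazyStep_mono h1 s).trans (le_of_eq ?_)
  unfold lazyStep
  beta_reduce
  rw [avg_add, avg_const_mul, avg_const_mul, h0, mul_zero, zero_add, ← mul_add, ← mul_add,
    ← mul_assoc, ENNReal.inv_mul_cancel two_ne_zero ENNReal.ofNat_ne_top, one_mul]

lemma avg_congr {g h : V → ℝ≥0∞} {s : V} (hgh : ∀ z, a s z ≠ 0 → g z = h z) :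
    avg a g s = avg a h s := by
  unfold avg
  congr 1
  refine tsum_congr fun z => ?_
  rcases eq_or_ne (a s z) 0 with h0 | h0
  · rw [h0, zero_mul, zero_mul]
  · rw [hgh z h0]

/-- The two-walker chain conserves mass away from isolated points. -/
lemma pairStep_iterate_one (hsymm : ∀ s z, a s z = a z s) (htop : ∀ s, deg a s ≠ ∞) (k : ℕ)
    {s s' : V} (hs : deg a s ≠ 0) (hs' : deg a s' ≠ 0) :
    (pairStep a)^[k] (fun _ _ => 1) s s' = 1 := by
  have hnb {s z : V} (h : a s z ≠ 0) : deg a z ≠ 0 := fun h0 =>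
    h (hsymm s z ▸ ENNReal.tsum_eq_zero.1 h0 s)
  induction k generalizing s s' with
  | zero => rfl
  | succ k ih =>
    have hR {s s' : V} (hs : deg a s ≠ 0) (hs' : deg a s' ≠ 0) :
        avgRight a ((pairStep a)^[k] fun _ _ => 1) s s' = 1 := by
      refine (avg_congr fun z hz => ih hs (hnb hz)).trans (avg_const hs' (htop s') 1)
    have hL {s s' : V} (hs : deg a s ≠ 0) (hs' : deg a s' ≠ 0) :
        avgLeft a ((pairStep a)^[k] fun _ _ => 1) s s' = 1 := by
      refine (avg_congr fun z hz => ih (hnb hz) hs').trans (avg_const hs (htop s) 1)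
    rw [Function.iterate_succ_apply']
    rcases eq_or_ne s s' with rfl | hne
    · have h2 : avgLeft a (avgRight a ((pairStep a)^[k] fun _ _ => 1)) s s = 1 :=
        (avg_congr fun z hz => hR (hnb hz) hs).trans (avg_const hs (htop s) 1)
      rw [pairStep_self, h2, ih hs hs, half_add_self]
    · rw [pairStep_of_ne _ hne, hL hs hs', hR hs hs', half_add_self]

end Chain

/-! ### Relabelling the vertices -/

section Relabel

variable {V W : Type*} {a : V → V → ℝ≥0∞} {e : W → V}

/-- The weights seen through a labelling `e` of the vertices. -/
def pullWeight (a : V → V → ℝ≥0∞) (e : W → V) (i j : W) : ℝ≥0∞ := a (e i) (e j)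

lemma tsum_weight_relabel (he : Function.Injective e)
    (hr : ∀ i z, a (e i) z ≠ 0 → z ∈ range e) (g : V → ℝ≥0∞) (i : W) :
    ∑' z, a (e i) z * g z = ∑' j, pullWeight a e i j * g (e j) := by
  refine (he.tsum_eq fun z hz => ?_).symm
  exact hr i z (left_ne_zero_of_mul hz)

lemma deg_relabel (he : Function.Injective e) (hr : ∀ i z, a (e i) z ≠ 0 → z ∈ range e) (i : W) :
    deg a (e i) = deg (pullWeight a e) i := by
  simpa [deg] using tsum_weight_relabel he hr (fun _ => 1) i

lemma avg_relabel (he : Function.Injective e) (hr : ∀ i z, a (e i) z ≠ 0 → z ∈ range e)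
    (g : V → ℝ≥0∞) (i : W) :
    avg a g (e i) = avg (pullWeight a e) (fun j => g (e j)) i := by
  rw [avg, avg, deg_relabel he hr, tsum_weight_relabel he hr]

lemma pairStep_relabel (he : Function.Injective e) (hr : ∀ i z, a (e i) z ≠ 0 → z ∈ range e)
    (F : V → V → ℝ≥0∞) (i j : W) :
    pairStep a F (e i) (e j) = pairStep (pullWeight a e) (fun i j => F (e i) (e j)) i j := by
  rcases eq_or_ne i j with rfl | hij
  · simp only [pairStep_self, avgLeft, avgRight, avg_relabel he hr]
  · simp only [pairStep_of_ne _ hij, pairStep_of_ne _ (he.ne hij), avgLeft, avgRight,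
      avg_relabel he hr]

lemma pairStep_iterate_relabel (he : Function.Injective e)
    (hr : ∀ i z, a (e i) z ≠ 0 → z ∈ range e) (F : V → V → ℝ≥0∞) (k : ℕ) (i j : W) :
    (pairStep a)^[k] F (e i) (e j)
      = (pairStep (pullWeight a e))^[k] (fun i j => F (e i) (e j)) i j := by
  induction k generalizing i j with
  | zero => rfl
  | succ k ih =>
    rw [Function.iterate_succ_apply', Function.iterate_succ_apply', pairStep_relabel he hr,
      funext₂ ih]

end Relabel

/-! ### The Palm measure and mass transport -/

section Palm

variable {d : ℕ}

lemma measurableSet_unitCube : MeasurableSet (unitCube d) := by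
  have : unitCube d = ⋂ i, (fun x : Space d => x i) ⁻¹' Ico 0 1 := by
    ext x
    simp [unitCube]
  rw [this]
  exact MeasurableSet.iInter fun i => (by fun_prop : Measurable fun x : Space d => x i)
    measurableSet_Ico

/-- The points of the integer lattice. -/
def latticePoint (z : Fin d → ℤ) : Space d := WithLp.toLp 2 fun i => (z i : ℝ)

lemma tsum_unitCube_sub (x : Space d) :
    ∑' z : Fin d → ℤ, (unitCube d).indicator (1 : Space d → ℝ≥0∞) (x - latticePoint z) = 1 := by
  rw [tsum_eq_single fun i => ⌊x i⌋]
  · rw [indicator_of_mem, Pi.one_apply]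
    intro i
    simp only [latticePoint, PiLp.sub_apply]
    exact ⟨Int.fract_nonneg _, Int.fract_lt_one _⟩
  · intro z hz
    refine indicator_of_notMem (fun h => hz (funext fun i => ?_)) _
    have := h i
    simp only [latticePoint, PiLp.sub_apply] at this
    rw [eq_comm, Int.floor_eq_iff]
    exact ⟨by linarith [this.1], by linarith [this.2]⟩

lemma tsum_unitCube_add (x : Space d) :
    ∑' z : Fin d → ℤ, (unitCube d).indicator (1 : Space d → ℝ≥0∞) (x + latticePoint z) = 1 := by
  rw [← tsum_unitCube_sub x, ← (Equiv.neg (Fin d → ℤ)).tsum_eq]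
  refine tsum_congr fun z => ?_
  congr 1
  ext i
  simp [latticePoint, sub_eq_add_neg]

/-- The integrand defining the Palm measure, as a measure-valued function. -/
def palmAux (S : Config (Space d)) : Measure (Config (Space d)) :=
  Measure.sum fun s : {s : Space d // s ∈ S ∧ s ∈ unitCube d} => Measure.dirac (S.shift s.1)

lemma lintegral_palmAux (S : Config (Space d)) {f : Config (Space d) → ℝ≥0∞} (hf : Measurable f) :
    ∫⁻ S', f S' ∂palmAux S
      = ∑' s : S, (unitCube d).indicator (1 : Space d → ℝ≥0∞) s * f (S.shift s) := by
  rw [palmAux, lintegral_sum_measure]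
  simp only [lintegral_dirac' _ hf]
  refine (tsum_subtype {s : Space d | s ∈ S ∧ s ∈ unitCube d} fun s => f (S.shift s)).trans ?_
  have h := tsum_subtype (S : Set (Space d)) fun s =>
    (unitCube d).indicator (1 : Space d → ℝ≥0∞) s * f (S.shift s)
  refine Eq.trans (tsum_congr fun s => ?_) h.symm
  by_cases h1 : s ∈ S <;> by_cases h2 : s ∈ unitCube d <;> simp [h1, h2, indicator]

lemma measurable_palmAux : Measurable (palmAux : Config (Space d) → _) := by
  refine Measure.measurable_of_measurable_coe _ fun A hA => ?_
  have h (S : Config (Space d)) : palmAux S A = ∑' s : S,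
      (unitCube d).indicator (1 : Space d → ℝ≥0∞) s * A.indicator 1 (S.shift s) := by
    rw [← lintegral_indicator_one hA, lintegral_palmAux S (measurable_one.indicator hA)]
  simp only [h]
  refine measurable_id.tsum_config (f := fun S s =>
    (unitCube d).indicator (1 : Space d → ℝ≥0∞) s * A.indicator 1 (S.shift s)) ?_
  refine Measurable.mul ?_ ?_
  · exact (measurable_one.indicator measurableSet_unitCube).comp measurable_snd
  · exact (measurable_one.indicator hA).comp (Config.measurable_shift.comp measurable_swap)

/-- The Campbell formula for the Palm measure. -/
lemma lintegral_palm (P : Measure (Config (Space d))) {f : Config (Space d) → ℝ≥0∞}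
    (hf : Measurable f) :
    ∫⁻ S, f S ∂palm P = ∫⁻ S, ∑' s : S,
      (unitCube d).indicator (1 : Space d → ℝ≥0∞) s * f (S.shift s) ∂P := by
  have : palm P = P.bind palmAux := rfl
  rw [this, Measure.lintegral_bind measurable_palmAux.aemeasurable hf.aemeasurable]
  exact lintegral_congr fun S => lintegral_palmAux S hf

lemma ae_palm_zero_mem (P : Measure (Config (Space d))) : ∀ᵐ S ∂palm P, (0 : Space d) ∈ S := by
  have hm : MeasurableSet {S : Config (Space d) | (0 : Space d) ∈ S} :=
    Config.measurableSet_mem.preimage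
      (measurable_prodMk_left : Measurable (Prod.mk (0 : Space d)))
  change palm P {S : Config (Space d) | (0 : Space d) ∈ S}ᶜ = 0
  rw [← lintegral_indicator_one hm.compl, lintegral_palm P (measurable_one.indicator hm.compl)]
  refine (lintegral_congr fun S => ?_).trans lintegral_zero
  refine ENNReal.tsum_eq_zero.2 fun s => ?_
  have : (0 : Space d) ∈ S.shift (s : Space d) := by
    rw [Config.mem_shift, zero_add]
    exact s.2
  simp [this]

/-- A nonnegative field indexed by pairs of points which is jointly measurable and covariant under
translations. -/
structure IsField (F : Space d → Space d → Config (Space d) → ℝ≥0∞) : Prop where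
  measurable : Measurable fun p : Space d × Space d × Config (Space d) => F p.1 p.2.1 p.2.2
  covariant : ∀ (x : Space d) (S : Config (Space d)) (s s' : Space d),
    F (s - x) (s' - x) (S.shift x) = F s s' S

lemma IsField.measurable_comp {F : Space d → Space d → Config (Space d) → ℝ≥0∞} (hF : IsField F)
    {α : Type*} [MeasurableSpace α] {f g : α → Space d} {h : α → Config (Space d)}
    (hf : Measurable f) (hg : Measurable g) (hh : Measurable h) :
    Measurable fun x => F (f x) (g x) (h x) :=
  hF.measurable.comp (hf.prodMk (hg.prodMk hh))

lemma IsField.swap {F : Space d → Space d → Config (Space d) → ℝ≥0∞} (hF : IsField F) :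
    IsField fun s s' S => F s' s S :=
  ⟨hF.measurable_comp (by fun_prop) (by fun_prop) (by fun_prop),
    fun x S s s' => hF.covariant x S s' s⟩

lemma IsField.measurable_tsum {F : Space d → Space d → Config (Space d) → ℝ≥0∞} (hF : IsField F) :
    Measurable fun S : Config (Space d) => ∑' s : S, F 0 s S :=
  measurable_id.tsum_config (f := fun S s => F 0 s S)
    (hF.measurable_comp measurable_const measurable_snd measurable_fst)

lemma lintegral_palm_tsum (P : Measure (Config (Space d)))
    {F : Space d → Space d → Config (Space d) → ℝ≥0∞} (hF : IsField F) :
    ∫⁻ S, ∑' s : S, F 0 s S ∂palm P = ∫⁻ S, ∑' s : S, ∑' t : S,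
      (unitCube d).indicator (1 : Space d → ℝ≥0∞) s * F s t S ∂P := by
  rw [lintegral_palm P hF.measurable_tsum]
  refine lintegral_congr fun S => tsum_congr fun s => ?_
  rw [ENNReal.tsum_mul_left]
  congr 1
  rw [Config.tsum_shift (s : Space d) S fun t => F 0 t (S.shift s)]
  refine tsum_congr fun t => ?_
  have := hF.covariant s S s t
  rwa [sub_self] at this

/-- The mass transport principle: split the target according to the lattice cube that contains it,
and translate this cube back to the unit cube. -/
theorem mass_transport {P : Measure (Config (Space d))} (hP : Assumptions P)
    {F : Space d → Space d → Config (Space d) → ℝ≥0∞} (hF : IsField F) :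
    ∫⁻ S, ∑' s : S, F 0 s S ∂palm P = ∫⁻ S, ∑' s : S, F s 0 S ∂palm P := by
  have hC := (measurable_one (α := ℝ≥0∞)).indicator (measurableSet_unitCube (d := d))
  set C : Space d → ℝ≥0∞ := (unitCube d).indicator 1 with hCdef
  let Φ (x y : Space d) (S : Config (Space d)) : ℝ≥0∞ :=
    ∑' s : S, ∑' t : S, C (s - x) * C (t - y) * F s t S
  have hΦ (x y : Space d) : Measurable (Φ x y) := by
    refine measurable_id.tsum_config
      (f := fun S s => ∑' t : S, C (s - x) * C (t - y) * F s t S) ?_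
    refine Measurable.tsum_config (g := fun p : Config (Space d) × Space d => p.1) measurable_fst
      (f := fun p t => C (p.2 - x) * C (t - y) * F p.2 t p.1) ?_
    refine Measurable.mul (Measurable.mul ?_ ?_) ?_
    · exact hC.comp (by fun_prop)
    · exact hC.comp (by fun_prop)
    · exact hF.measurable_comp (by fun_prop) (by fun_prop) (by fun_prop)
  have hshift (z x y : Space d) (S : Config (Space d)) :
      Φ x y (S.shift z) = Φ (x + z) (y + z) S := by
    simp only [Φ]
    rw [Config.tsum_shift z S fun s => ∑' t : S.shift z, C (s - x) * C (t - y) * F s t (S.shift z)]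
    refine tsum_congr fun s => ?_
    rw [Config.tsum_shift z S fun t => C (s - z - x) * C (t - y) * F (s - z) t (S.shift z)]
    refine tsum_congr fun t => ?_
    rw [hF.covariant, sub_sub, sub_sub, add_comm z, add_comm z]
  have hstat (z : Space d) : ∫⁻ S, Φ 0 z S ∂P = ∫⁻ S, Φ (-z) 0 S ∂P := by
    conv_rhs => rw [← hP.stationary z]
    rw [lintegral_map (hΦ _ _) (Config.measurable_shift_right z)]
    refine lintegral_congr fun S => ?_
    rw [hshift, neg_add_cancel, zero_add]
  have h1 (S : Config (Space d)) :
      ∑' s : S, ∑' t : S, C s * F s t S = ∑' z, Φ 0 (latticePoint z) S := by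
    simp only [Φ, sub_zero]
    rw [ENNReal.tsum_comm (α := Fin d → ℤ) (β := S)]
    refine tsum_congr fun s => ?_
    rw [ENNReal.tsum_comm (α := Fin d → ℤ) (β := S)]
    refine tsum_congr fun t => ?_
    rw [ENNReal.tsum_mul_right, ENNReal.tsum_mul_left, tsum_unitCube_sub, mul_one]
  have h2 (S : Config (Space d)) :
      ∑' s : S, ∑' t : S, C s * F t s S = ∑' z, Φ (-latticePoint z) 0 S := by
    simp only [Φ, sub_zero, sub_neg_eq_add]
    rw [ENNReal.tsum_comm (α := S) (β := S), ENNReal.tsum_comm (α := Fin d → ℤ) (β := S)]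
    refine tsum_congr fun s => ?_
    rw [ENNReal.tsum_comm (α := Fin d → ℤ) (β := S)]
    refine tsum_congr fun t => ?_
    rw [ENNReal.tsum_mul_right, ENNReal.tsum_mul_right, tsum_unitCube_add, one_mul]
  rw [lintegral_palm_tsum P hF, lintegral_palm_tsum P hF.swap]
  simp only [← hCdef, h1, h2]
  rw [lintegral_tsum fun z => (hΦ _ _).aemeasurable, lintegral_tsum fun z => (hΦ _ _).aemeasurable]
  exact tsum_congr fun z => hstat _

/-- A translation invariant property of a point that holds almost surely at the origin holds almost
surely at all points. -/
lemma ae_forall_mem_of_ae_zero {P : Measure (Config (Space d))} (hP : Assumptions P)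
    {G : Space d → Config (Space d) → ℝ≥0∞}
    (hG : IsField fun s (_ : Space d) S => G s S) (h : ∀ᵐ S ∂palm P, G 0 S = 0) :
    ∀ᵐ S ∂palm P, ∀ s ∈ S, G s S = 0 := by
  have h1 : ∫⁻ S, ∑' s : S, G s S ∂palm P = 0 := by
    rw [← mass_transport hP hG]
    refine (lintegral_congr_ae ?_).trans lintegral_zero
    filter_upwards [h] with S hS
    simp [hS]
  rw [lintegral_eq_zero_iff hG.swap.measurable_tsum] at h1
  filter_upwards [h1] with S hS s hs
  exact ENNReal.tsum_eq_zero.1 hS ⟨s, hs⟩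

end Palm

/-! ### Covariant fields and their energies -/

section Fields

variable {d : ℕ}

lemma isField_edge : IsField fun s s' (S : Config (Space d)) => edge S s s' :=
  ⟨measurable_edge, fun x S s s' => edge_shift x S s s'⟩

lemma IsField.mul {F G : Space d → Space d → Config (Space d) → ℝ≥0∞} (hF : IsField F)
    (hG : IsField G) : IsField fun s s' S => F s s' S * G s s' S :=
  ⟨hF.measurable.mul hG.measurable, fun x S s s' => by rw [hF.covariant, hG.covariant]⟩

lemma IsField.diag {F : Space d → Space d → Config (Space d) → ℝ≥0∞} (hF : IsField F) :
    IsField fun s _ S => F s s S :=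
  ⟨hF.measurable_comp (by fun_prop) (by fun_prop) (by fun_prop),
    fun x S s _ => hF.covariant x S s s⟩

lemma IsField.tsum_edge {F : Space d → Space d → Config (Space d) → ℝ≥0∞} (hF : IsField F) :
    IsField fun s s' S => ∑' z, edge S s z * F z s' S := by
  refine ⟨?_, fun x S s s' => ?_⟩
  · simp only [tsum_edge_mul]
    refine Measurable.tsum_config (g := fun p : Space d × Space d × Config (Space d) => p.2.2)
      (by fun_prop) (f := fun p z => edge p.2.2 p.1 z * F z p.2.1 p.2.2) ?_
    exact (isField_edge.measurable_comp (by fun_prop) (by fun_prop) (by fun_prop)).mul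
      (hF.measurable_comp (by fun_prop) (by fun_prop) (by fun_prop))
  · rw [← (Equiv.subRight x).tsum_eq]
    refine tsum_congr fun z => ?_
    rw [Equiv.subRight_apply, edge_shift, hF.covariant]

lemma isField_const (c : ℝ≥0∞) : IsField fun (_ _ : Space d) (_ : Config (Space d)) => c :=
  ⟨measurable_const, fun _ _ _ _ => rfl⟩

lemma isField_deg : IsField fun s (_ : Space d) (S : Config (Space d)) => deg (edge S) s := by
  simpa [deg] using (isField_const (d := d) 1).tsum_edge

lemma IsField.avgLeft {F : Space d → Space d → Config (Space d) → ℝ≥0∞} (hF : IsField F) :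
    IsField fun s s' S => avgLeft (edge S) (fun x y => F x y S) s s' := by
  have h := hF.tsum_edge
  refine ⟨isField_deg.measurable.inv.mul h.measurable, fun x S s s' => ?_⟩
  have h1 := isField_deg.covariant x S s s'
  have h2 := h.covariant x S s s'
  simp only [Harness.avgLeft, avg]
  exact congrArg₂ (fun u v => u⁻¹ * v) h1 h2

lemma IsField.avgRight {F : Space d → Space d → Config (Space d) → ℝ≥0∞} (hF : IsField F) :
    IsField fun s s' S => avgRight (edge S) (fun x y => F x y S) s s' :=
  hF.swap.avgLeft.swap

lemma IsField.pairStep {F : Space d → Space d → Config (Space d) → ℝ≥0∞} (hF : IsField F) :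
    IsField fun s s' S => pairStep (edge S) (fun x y => F x y S) s s' := by
  classical
  have hm : MeasurableSet {p : Space d × Space d × Config (Space d) | p.1 = p.2.1} :=
    measurableSet_eq_fun measurable_fst (by fun_prop)
  have h1 := hF.avgRight.avgLeft.diag
  have h2 := hF.diag
  have h3 := hF.avgLeft
  have h4 := hF.avgRight
  refine ⟨?_, fun x S s s' => ?_⟩
  · unfold Harness.pairStep
    exact Measurable.ite hm (measurable_const.mul (h1.measurable.add h2.measurable))
      (measurable_const.mul (h3.measurable.add h4.measurable))
  · have h1' := h1.covariant x S s s'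
    have h2' := h2.covariant x S s s'
    have h3' := h3.covariant x S s s'
    have h4' := h4.covariant x S s s'
    rcases eq_or_ne s s' with rfl | hs
    · rw [pairStep_self, pairStep_self]
      exact congrArg₂ (fun u v => 2⁻¹ * (u + v)) h1' h2'
    · rw [pairStep_of_ne _ hs, pairStep_of_ne _ (fun h => hs (sub_left_inj.1 h))]
      exact congrArg₂ (fun u v => 2⁻¹ * (u + v)) h3' h4'

lemma IsField.pairStep_iterate {F : Space d → Space d → Config (Space d) → ℝ≥0∞} (hF : IsField F)
    (k : ℕ) : IsField fun s s' S => (Harness.pairStep (edge S))^[k] (fun x y => F x y S) s s' := by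
  induction k with
  | zero => exact hF
  | succ k ih =>
    simp only [Function.iterate_succ_apply']
    exact ih.pairStep

lemma IsField.lazyMoment {F : Space d → Space d → Config (Space d) → ℝ≥0∞} (hF : IsField F)
    (k : ℕ) : IsField fun s (_ : Space d) S => lazyMoment (edge S) (fun x y => F x y S) k s := by
  have h : IsField fun s s' S => (lazyStep (edge S))^[k] (fun y => F s' y S) s := by
    induction k with
    | zero => exact hF.swap
    | succ k ih =>
      simp only [Function.iterate_succ_apply']
      have h1 := ih.avgLeft
      refine ⟨measurable_const.mul (h1.measurable.add ih.measurable), fun x S s s' => ?_⟩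
      exact congrArg₂ (fun u v => 2⁻¹ * (u + v)) (h1.covariant x S s s') (ih.covariant x S s s')
  exact h.diag

/-- The mean of `∑ a(0, s) F(0, s)` under the Palm measure. -/
def edgeMass (P : Measure (Config (Space d))) (F : Space d → Space d → Config (Space d) → ℝ≥0∞) :
    ℝ≥0∞ :=
  ∫⁻ S, ∑' z, edge S 0 z * F 0 z S ∂palm P

/-- The mean of `a(0) F(0, 0)` under the Palm measure. -/
def diagMass (P : Measure (Config (Space d))) (F : Space d → Space d → Config (Space d) → ℝ≥0∞) :
    ℝ≥0∞ :=
  ∫⁻ S, deg (edge S) 0 * F 0 0 S ∂palm P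

/-- The mean of `a(0)⁻¹ ∑ a(0, s) a(0, s') F(s, s')` under the Palm measure. -/
def cornerMass (P : Measure (Config (Space d)))
    (F : Space d → Space d → Config (Space d) → ℝ≥0∞) : ℝ≥0∞ :=
  ∫⁻ S, deg (edge S) 0 * avgLeft (edge S) (avgRight (edge S) fun x y => F x y S) 0 0 ∂palm P

/-- Mass transport for the field `a F`. -/
lemma edgeMass_swap {P : Measure (Config (Space d))} (hP : Assumptions P)
    {F : Space d → Space d → Config (Space d) → ℝ≥0∞} (hF : IsField F) :
    edgeMass P (fun s s' S => F s' s S) = edgeMass P F := by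
  have h := mass_transport hP (isField_edge.mul hF)
  simp only [edgeMass, tsum_edge_mul]
  rw [h]
  simp only [edge_comm]

/-- The mean of `∑ a(0, s) F(s, s)`. -/
lemma edgeMass_diag {P : Measure (Config (Space d))} (hP : Assumptions P)
    {F : Space d → Space d → Config (Space d) → ℝ≥0∞} (hF : IsField F) :
    edgeMass P (fun _ s' S => F s' s' S) = diagMass P F := by
  rw [edgeMass_swap hP hF.diag, edgeMass, diagMass]
  simp only [ENNReal.tsum_mul_right, deg]

lemma measurable_edgeSum {F : Space d → Space d → Config (Space d) → ℝ≥0∞} (hF : IsField F) :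
    Measurable fun S : Config (Space d) => ∑' z, edge S 0 z * F 0 z S := by
  simp only [tsum_edge_mul]
  exact (isField_edge.mul hF).measurable_tsum

lemma edgeMass_add {P : Measure (Config (Space d))}
    {F G : Space d → Space d → Config (Space d) → ℝ≥0∞} (hF : IsField F) :
    edgeMass P (fun s s' S => F s s' S + G s s' S) = edgeMass P F + edgeMass P G := by
  simp only [edgeMass, mul_add, ENNReal.tsum_add]
  exact lintegral_add_left (measurable_edgeSum hF) _

lemma edgeMass_const_mul {P : Measure (Config (Space d))} {c : ℝ≥0∞} (hc : c ≠ ∞)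
    (F : Space d → Space d → Config (Space d) → ℝ≥0∞) :
    edgeMass P (fun s s' S => c * F s s' S) = c * edgeMass P F := by
  simp only [edgeMass, mul_left_comm _ c, ENNReal.tsum_mul_left]
  exact lintegral_const_mul' _ _ hc

lemma measurable_deg_mul {F : Space d → Space d → Config (Space d) → ℝ≥0∞} (hF : IsField F) :
    Measurable fun S : Config (Space d) => deg (edge S) 0 * F 0 0 S :=
  (isField_deg.mul hF).measurable_comp (f := fun _ => 0) (g := fun _ => 0) measurable_const
    measurable_const measurable_id

lemma diagMass_pairStep {P : Measure (Config (Space d))}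
    {F : Space d → Space d → Config (Space d) → ℝ≥0∞} (hF : IsField F) :
    diagMass P (fun s s' S => pairStep (edge S) (fun x y => F x y S) s s')
      = 2⁻¹ * (cornerMass P F + diagMass P F) := by
  unfold diagMass cornerMass
  rw [← lintegral_add_right _ (measurable_deg_mul hF),
    ← lintegral_const_mul' _ _ (ENNReal.inv_ne_top.2 two_ne_zero)]
  refine lintegral_congr fun S => ?_
  beta_reduce
  rw [pairStep_self]
  ring

/-- For a symmetric field, mass transport identifies the motion of either walker off the diagonal
with the corner term. -/
lemma edgeMass_pairStep {P : Measure (Config (Space d))} (hP : Assumptions P)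
    (hdeg : ∀ᵐ S ∂palm P, deg (edge S) (0 : Space d) ≠ ∞)
    {F : Space d → Space d → Config (Space d) → ℝ≥0∞} (hF : IsField F)
    (hsymm : ∀ s s' S, F s s' S = F s' s S) :
    edgeMass P (fun s s' S => pairStep (edge S) (fun x y => F x y S) s s') = cornerMass P F := by
  have h1 : edgeMass P (fun s s' S => avgLeft (edge S) (fun x y => F x y S) s s')
      = cornerMass P F := by
    refine lintegral_congr_ae ?_
    filter_upwards [hdeg] with S hS
    rw [avgLeft_avgRight, avgRight, deg_mul_avg hS]
  have h2 : edgeMass P (fun s s' S => avgRight (edge S) (fun x y => F x y S) s s')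
      = cornerMass P F := by
    rw [← h1, ← edgeMass_swap hP hF.avgLeft]
    congr 1
    funext s s' S
    simp only [avgLeft, avgRight, hsymm s]
  have h3 : edgeMass P (fun s s' S => pairStep (edge S) (fun x y => F x y S) s s')
      = edgeMass P (fun s s' S => 2⁻¹ * (avgLeft (edge S) (fun x y => F x y S) s s'
        + avgRight (edge S) (fun x y => F x y S) s s')) := by
    refine lintegral_congr fun S => tsum_congr fun z => ?_
    rcases eq_or_ne 0 z with rfl | hz
    · rw [edge_self, zero_mul, zero_mul]
    · beta_reduce
      rw [pairStep_of_ne _ hz]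
  rw [h3, edgeMass_const_mul (ENNReal.inv_ne_top.2 two_ne_zero), edgeMass_add hF.avgLeft, h1, h2,
    half_add_self]

/-- The moments of the lazy walk grow at most exponentially, by stationarity of the environment seen
from the walker. -/
lemma diagMass_lazyMoment_le {P : Measure (Config (Space d))} (hP : Assumptions P)
    {F : Space d → Space d → Config (Space d) → ℝ≥0∞} (hF : IsField F)
    (h0 : ∀ s S, F s s S = 0) (htri : ∀ s x z S, F s x S ≤ 2 * (F s z S + F z x S)) (k : ℕ) :
    diagMass P (fun s _ S => lazyMoment (edge S) (fun x y => F x y S) k s)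
      ≤ (2 ^ k - 1 : ℕ) * edgeMass P F := by
  induction k with
  | zero =>
    simp [diagMass, lazyMoment, h0]
  | succ k ih =>
    have hM := hF.lazyMoment k
    have h1 : diagMass P (fun s _ S => lazyMoment (edge S) (fun x y => F x y S) (k + 1) s)
        ≤ ∫⁻ S, ((∑' z, edge S 0 z * F 0 z S)
          + (∑' z, edge S 0 z * lazyMoment (edge S) (fun x y => F x y S) k z))
          + deg (edge S) 0 * lazyMoment (edge S) (fun x y => F x y S) k 0 ∂palm P := by
      refine lintegral_mono fun S => ?_
      refine (mul_le_mul_right (lazyMoment_succ_le (h0 · S) (htri · · · S) k 0) _).trans ?_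
      rw [mul_add, mul_add]
      gcongr
      · exact deg_mul_avg_le _ _
      · exact deg_mul_avg_le _ _
    refine h1.trans ?_
    rw [lintegral_add_right _ (measurable_deg_mul hM), lintegral_add_left (measurable_edgeSum hF)]
    -- the environment seen from a neighbor of the origin has the degree-biased Palm law
    have h2 : ∫⁻ S, (∑' z, edge S 0 z * lazyMoment (edge S) (fun x y => F x y S) k z) ∂palm P
        = diagMass P (fun s _ S => lazyMoment (edge S) (fun x y => F x y S) k s) :=
      edgeMass_diag hP hM
    rw [h2]
    calc edgeMass P F + _ + _
        ≤ edgeMass P F + (2 ^ k - 1 : ℕ) * edgeMass P F + (2 ^ k - 1 : ℕ) * edgeMass P F := by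
          gcongr
          exact ih
      _ = ((1 + (2 ^ k - 1) + (2 ^ k - 1) : ℕ) : ℝ≥0∞) * edgeMass P F := by
          push_cast
          ring
      _ = (2 ^ (k + 1) - 1 : ℕ) * edgeMass P F := by
          have : 1 ≤ 2 ^ k := Nat.one_le_two_pow
          congr 2
          rw [pow_succ]
          omega

lemma diagMass_pairStep_iterate_le {P : Measure (Config (Space d))} (hP : Assumptions P)
    {F : Space d → Space d → Config (Space d) → ℝ≥0∞} (hF : IsField F)
    (h0 : ∀ s S, F s s S = 0) (htri : ∀ s x z S, F s x S ≤ 2 * (F s z S + F z x S))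
    (htri' : ∀ x y s s' S, F x y S ≤ 3 * (F s x S + F s s' S + F s' y S)) (k : ℕ) :
    diagMass P (fun s s' S => (pairStep (edge S))^[k] (fun x y => F x y S) s s')
      ≤ 6 * 2 ^ k * edgeMass P F := by
  have h1 : diagMass P (fun s s' S => (pairStep (edge S))^[k] (fun x y => F x y S) s s')
      ≤ ∫⁻ S, 6 * (deg (edge S) 0 * lazyMoment (edge S) (fun x y => F x y S) k 0) ∂palm P := by
    refine lintegral_mono fun S => ?_
    refine (mul_le_mul_right (pairStep_iterate_le_lazyMoment (htri' · · · · S) k 0 0) _).trans ?_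
    rw [h0, add_zero, ← two_mul, ← mul_assoc 3, mul_left_comm]
    norm_num
  refine h1.trans ?_
  rw [lintegral_const_mul' _ _ (by norm_num), mul_assoc]
  gcongr
  refine (diagMass_lazyMoment_le hP hF h0 htri k).trans ?_
  gcongr
  exact_mod_cast Nat.sub_le _ _

lemma edgeMass_pairStep_iterate_le {P : Measure (Config (Space d))} (hP : Assumptions P)
    {F : Space d → Space d → Config (Space d) → ℝ≥0∞} (hF : IsField F)
    (h0 : ∀ s S, F s s S = 0) (htri : ∀ s x z S, F s x S ≤ 2 * (F s z S + F z x S))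
    (htri' : ∀ x y s s' S, F x y S ≤ 3 * (F s x S + F s s' S + F s' y S)) (k : ℕ) :
    edgeMass P (fun s s' S => (pairStep (edge S))^[k] (fun x y => F x y S) s s')
      ≤ 9 * 2 ^ k * edgeMass P F := by
  have hM := hF.lazyMoment k
  have h1 : edgeMass P (fun s s' S => (pairStep (edge S))^[k] (fun x y => F x y S) s s')
      ≤ edgeMass P (fun s s' S => 3 * ((lazyMoment (edge S) (fun x y => F x y S) k s + F s s' S)
        + lazyMoment (edge S) (fun x y => F x y S) k s')) := by
    refine lintegral_mono fun S => ENNReal.tsum_le_tsum fun z => ?_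
    gcongr
    exact pairStep_iterate_le_lazyMoment (htri' · · · · S) k 0 z
  refine h1.trans ?_
  have hMF : IsField fun s s' S => lazyMoment (edge S) (fun x y => F x y S) k s + F s s' S :=
    ⟨hM.measurable.add hF.measurable, fun x S s s' => by rw [hF.covariant, hM.covariant x S s s']⟩
  rw [edgeMass_const_mul (by norm_num), edgeMass_add hMF, edgeMass_add hM, edgeMass_diag hP hM]
  have h2 : edgeMass P (fun s _ S => lazyMoment (edge S) (fun x y => F x y S) k s)
      = diagMass P (fun s _ S => lazyMoment (edge S) (fun x y => F x y S) k s) := by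
    rw [← edgeMass_diag hP hM, edgeMass_swap hP hM]
  rw [h2]
  have h3 := diagMass_lazyMoment_le hP hF h0 htri k
  have h4 : ((2 ^ k - 1 : ℕ) : ℝ≥0∞) * edgeMass P F ≤ 2 ^ k * edgeMass P F := by
    gcongr
    exact_mod_cast Nat.sub_le _ _
  have h5 : edgeMass P F ≤ 2 ^ k * edgeMass P F :=
    le_mul_of_one_le_left' (one_le_pow₀ one_le_two)
  calc 3 * (diagMass P _ + edgeMass P F + diagMass P _)
      ≤ 3 * (2 ^ k * edgeMass P F + 2 ^ k * edgeMass P F + 2 ^ k * edgeMass P F) := by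
        gcongr
        · exact h3.trans h4
        · exact h3.trans h4
    _ = 9 * 2 ^ k * edgeMass P F := by ring

end Fields

/-! ### The squared height differences of a surface -/

section Heights

variable {d : ℕ}

/-- Being joined by a path of neighbors. -/
def Joined (S : Config (Space d)) (s s' : Space d) : Prop :=
  Relation.ReflTransGen (IsNeighbor S) s s'

lemma Joined.refl (S : Config (Space d)) (s : Space d) : Joined S s s := Relation.ReflTransGen.refl

lemma Joined.trans {S : Config (Space d)} {s s' s'' : Space d} (h : Joined S s s')
    (h' : Joined S s' s'') : Joined S s s'' :=
  Relation.ReflTransGen.trans h h'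

lemma IsNeighbor.joined {S : Config (Space d)} {s s' : Space d} (h : IsNeighbor S s s') :
    Joined S s s' :=
  Relation.ReflTransGen.single h

lemma Joined.symm {S : Config (Space d)} {s s' : Space d} (h : Joined S s s') : Joined S s' s := by
  induction h with
  | refl => exact Joined.refl S s
  | tail _ hbc ih => exact hbc.symm.joined.trans ih

open Classical in
/-- The number of paths of `n` edges from `s` to `s'`; through it, being joined is seen to be
measurable. -/
def pathCount : ℕ → Space d → Space d → Config (Space d) → ℝ≥0∞
  | 0, s, s', _ => if s = s' then 1 else 0
  | n + 1, s, s', S => ∑' z, edge S s z * pathCount n z s' S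

lemma isField_pathCount (n : ℕ) : IsField (pathCount (d := d) n) := by
  induction n with
  | zero =>
    classical
    refine ⟨?_, fun x S s s' => ?_⟩
    · exact Measurable.ite (measurableSet_eq_fun measurable_fst (by fun_prop)) measurable_const
        measurable_const
    · simp [pathCount]
  | succ n ih => exact ih.tsum_edge

lemma joined_iff_exists_pathCount {S : Config (Space d)} {s s' : Space d} :
    Joined S s s' ↔ ∃ n, pathCount n s s' S ≠ 0 := by
  constructor
  · intro h
    induction h using Relation.ReflTransGen.head_induction_on with
    | refl => exact ⟨0, by simp [pathCount]⟩
    | head hab _ ih =>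
      obtain ⟨n, hn⟩ := ih
      exact ⟨n + 1, fun h0 => mul_ne_zero (edge_ne_zero.2 hab) hn (ENNReal.tsum_eq_zero.1 h0 _)⟩
  · rintro ⟨n, hn⟩
    induction n generalizing s with
    | zero =>
      simp only [pathCount, ne_eq, ite_eq_right_iff, one_ne_zero, imp_false, not_not] at hn
      exact hn ▸ Relation.ReflTransGen.refl
    | succ n ih =>
      obtain ⟨z, hz⟩ : ∃ z, edge S s z * pathCount n z s' S ≠ 0 := by
        by_contra! h
        exact hn (ENNReal.tsum_eq_zero.2 h)
      exact Relation.ReflTransGen.head (edge_ne_zero.1 (left_ne_zero_of_mul hz))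
        (ih (right_ne_zero_of_mul hz))

open Classical in
/-- The height of a surface at the points of a configuration, and `0` elsewhere. -/
def height (γ : Surface d) (S : Config (Space d)) (s : Space d) : ℝ := if s ∈ S then γ s S else 0

lemma measurable_height {γ : Surface d} (hγ : γ.IsMeasurable) :
    Measurable fun p : Space d × Config (Space d) => height γ p.2 p.1 := by
  classical
  refine Measurable.dite (s := {p : Space d × Config (Space d) | p.1 ∈ p.2})
    (f := fun p => γ p.1.1 p.1.2) (g := fun _ => 0) hγ measurable_const Config.measurableSet_mem

open Classical in
/-- The squared height difference of two points, set to `∞` if they are not joined by a path: as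
only the gradient of the surface is covariant, only height differences along paths are. -/
def heightGap (γ : Surface d) (s s' : Space d) (S : Config (Space d)) : ℝ≥0∞ :=
  if Joined S s s' then ENNReal.ofReal ((height γ S s' - height γ S s) ^ 2) else ∞

lemma heightGap_self (γ : Surface d) (s : Space d) (S : Config (Space d)) :
    heightGap γ s s S = 0 := by
  rw [heightGap, if_pos (Joined.refl S s)]
  simp

lemma heightGap_comm (γ : Surface d) (s s' : Space d) (S : Config (Space d)) :
    heightGap γ s s' S = heightGap γ s' s S := by
  classical
  unfold heightGap
  exact if_congr ⟨Joined.symm, Joined.symm⟩ (by rw [← neg_sub, neg_sq]) rfl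

lemma heightGap_le_two_mul (γ : Surface d) (s x z : Space d) (S : Config (Space d)) :
    heightGap γ s x S ≤ 2 * (heightGap γ s z S + heightGap γ z x S) := by
  unfold heightGap
  by_cases h1 : Joined S s z
  · by_cases h2 : Joined S z x
    · rw [if_pos h1, if_pos h2, if_pos (h1.trans h2), ← ENNReal.ofReal_add (by positivity)
        (by positivity), ← ENNReal.ofReal_ofNat 2, ← ENNReal.ofReal_mul (by norm_num)]
      refine ENNReal.ofReal_le_ofReal ?_
      nlinarith [sq_nonneg ((height γ S z - height γ S s) - (height γ S x - height γ S z))]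
    · rw [if_neg h2]
      simp
  · rw [if_neg h1]
    simp

lemma heightGap_le_three_mul (γ : Surface d) (x y s s' : Space d) (S : Config (Space d)) :
    heightGap γ x y S
      ≤ 3 * (heightGap γ s x S + heightGap γ s s' S + heightGap γ s' y S) := by
  unfold heightGap
  by_cases h1 : Joined S s x
  · by_cases h2 : Joined S s s'
    · by_cases h3 : Joined S s' y
      · rw [if_pos h1, if_pos h2, if_pos h3, if_pos (h1.symm.trans (h2.trans h3)),
          ← ENNReal.ofReal_add (by positivity) (by positivity),
          ← ENNReal.ofReal_add (by positivity) (by positivity),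
          ← ENNReal.ofReal_ofNat 3, ← ENNReal.ofReal_mul (by norm_num)]
        refine ENNReal.ofReal_le_ofReal ?_
        have h4 : height γ S y - height γ S x = (height γ S y - height γ S s')
          + (height γ S s' - height γ S s) - (height γ S x - height γ S s) := by ring
        rw [h4]
        generalize height γ S x - height γ S s = u
        generalize height γ S s' - height γ S s = v
        generalize height γ S y - height γ S s' = w
        nlinarith [sq_nonneg (u + v), sq_nonneg (u + w), sq_nonneg (v - w)]
      · rw [if_neg h3]
        simp
    · rw [if_neg h2]
      simp
  · rw [if_neg h1]
    simp

lemma conductance_of_isNeighbor {S : Config (Space d)} {s s' : Space d} (h : IsNeighbor S s s') :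
    conductance S s s' = 1 := if_pos h

/-- Covariance is only assumed for translations of a point of the configuration to the origin.
Translation by an arbitrary vector differs from translation to a point of the configuration by
another translation to a point of the configuration. -/
lemma height_sub_shift {γ : Surface d} (hγ : γ.HasCovariantGrad) (x : Space d)
    {S : Config (Space d)} {s s' : Space d} (h : IsNeighbor S s s') :
    height γ (S.shift x) (s' - x) - height γ (S.shift x) (s - x)
      = height γ S s' - height γ S s := by
  have hs := h.1
  have hs' := h.2.1
  have hx : s - x ∈ S.shift x := Config.sub_mem_shift.2 hs
  have hx' : s' - x ∈ S.shift x := Config.sub_mem_shift.2 hs'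
  have h1 := hγ S s hs s hs s' hs'
  have h2 := hγ (S.shift x) (s - x) hx (s - x) hx (s' - x) hx'
  rw [Config.shift_shift, add_sub_cancel, sub_sub_sub_cancel_right, sub_sub_sub_cancel_right,
    h1] at h2
  simp only [grad, conductance_of_isNeighbor h,
    conductance_of_isNeighbor ((isNeighbor_shift x S s s').2 h), one_mul] at h2
  simp only [height, if_pos hs, if_pos hs', if_pos hx, if_pos hx']
  exact h2.symm

lemma isField_heightGap {γ : Surface d} (hm : γ.IsMeasurable) (hγ : γ.HasCovariantGrad) :
    IsField (heightGap γ) := by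
  refine ⟨?_, fun x S s s' => ?_⟩
  · have hJ : MeasurableSet
        {p : Space d × Space d × Config (Space d) | Joined p.2.2 p.1 p.2.1} := by
      simp only [joined_iff_exists_pathCount, ofPred_exists]
      exact MeasurableSet.iUnion fun n =>
        (isField_pathCount n).measurable (measurableSet_singleton 0).compl
    have hh := measurable_height hm
    refine Measurable.ite hJ (ENNReal.measurable_ofReal.comp (Measurable.pow_const
      (Measurable.sub ?_ ?_) 2)) measurable_const
    · exact hh.comp (f := fun p : Space d × Space d × Config (Space d) => (p.2.1, p.2.2))
        (by fun_prop)
    · exact hh.comp (f := fun p : Space d × Space d × Config (Space d) => (p.1, p.2.2))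
        (by fun_prop)
  · have hJ : Joined (S.shift x) (s - x) (s' - x) ↔ Joined S s s' := by
      simp only [joined_iff_exists_pathCount, (isField_pathCount _).covariant]
    unfold heightGap
    by_cases h : Joined S s s'
    · rw [if_pos h, if_pos (hJ.2 h)]
      congr 2
      clear hJ
      induction h with
      | refl => simp
      | tail _ hbc ih => linarith [height_sub_shift hγ x hbc]
    · rw [if_neg h, if_neg (fun h' => h (hJ.1 h'))]

end Heights

/-! ### Integrability of the degree -/

section Degrees

variable {d : ℕ}

open Classical in
lemma deg_edge_eq_encard (S : Config (Space d)) (s : Space d) :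
    deg (edge S) s = ({s' | IsNeighbor S s s'}.encard : ℝ≥0∞) := by
  rw [← ENNReal.tsum_set_one, deg, tsum_subtype {s' | IsNeighbor S s s'} fun _ => (1 : ℝ≥0∞)]
  refine tsum_congr fun z => ?_
  rw [edge_eq]
  by_cases h : IsNeighbor S s z <;> simp [h, indicator]

lemma deg_edge_of_finite {S : Config (Space d)} {s : Space d}
    (h : {s' | IsNeighbor S s s'}.Finite) : deg (edge S) s = degree S s := by
  rw [deg_edge_eq_encard, degree, ← h.cast_ncard_eq]
  simp

lemma finite_of_deg_edge {S : Config (Space d)} {s : Space d} (h : deg (edge S) s ≠ ∞) :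
    {s' | IsNeighbor S s s'}.Finite := by
  rw [deg_edge_eq_encard] at h
  exact Set.encard_ne_top_iff.1 fun h' => h (by simp [h'])

lemma Assumptions.ae_deg_ne_top {P : Measure (Config (Space d))} (hP : Assumptions P) :
    ∀ᵐ S ∂palm P, deg (edge S) (0 : Space d) ≠ ∞ := by
  filter_upwards [hP.finite_neighbors] with S hS
  rw [deg_edge_of_finite hS]
  exact ENNReal.natCast_ne_top _

lemma Assumptions.ae_forall_deg_ne_top {P : Measure (Config (Space d))} (hP : Assumptions P) :
    ∀ᵐ S ∂palm P, ∀ s ∈ S, deg (edge S) (s : Space d) ≠ ∞ := by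
  have h : IsField fun s (_ : Space d) (S : Config (Space d)) =>
      ({∞} : Set ℝ≥0∞).indicator 1 (deg (edge S) s) :=
    ⟨(measurable_one.indicator (measurableSet_singleton _)).comp isField_deg.measurable,
      fun x S s s' => congrArg _ (isField_deg.covariant x S s s')⟩
  filter_upwards [ae_forall_mem_of_ae_zero hP h (by
    filter_upwards [hP.ae_deg_ne_top] with S hS
    simp [hS])] with S hS s hs htop
  simpa [htop] using hS s hs

lemma Assumptions.lintegral_deg_lt_top {P : Measure (Config (Space d))} (hP : Assumptions P) :
    ∫⁻ S, deg (edge S) (0 : Space d) ∂palm P < ∞ := by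
  obtain ⟨β, hβ, hfin⟩ := hP.exp_moment
  have h1 : ∫⁻ S, deg (edge S) (0 : Space d) ∂palm P
      ≤ ∫⁻ S, ENNReal.ofReal β⁻¹ * ENNReal.ofReal (Real.exp (β * degree S (0 : Space d)))
        ∂palm P := by
    refine lintegral_mono_ae ?_
    filter_upwards [hP.finite_neighbors] with S hS
    rw [deg_edge_of_finite hS, ← ENNReal.ofReal_mul (by positivity), ← ENNReal.ofReal_natCast]
    refine ENNReal.ofReal_le_ofReal ?_
    rw [inv_mul_eq_div, le_div_iff₀ hβ, mul_comm]
    linarith [Real.add_one_le_exp (β * degree S (0 : Space d))]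
  refine h1.trans_lt ?_
  rw [lintegral_const_mul' _ _ ENNReal.ofReal_ne_top]
  exact ENNReal.mul_lt_top ENNReal.ofReal_lt_top hfin

/-- A gradient with a finite moment of order at least two has finite energy, as the mean number of
neighbors is finite. -/
lemma edgeMass_heightGap_lt_top {P : Measure (Config (Space d))} (hP : Assumptions P)
    {γ : Surface d} {r : ℝ} (hr : 2 ≤ r)
    (hγ : campbell (palm P) id
      (fun s s' S => ENNReal.ofReal (|grad S (fun v => γ v S) s s'| ^ r)) < ∞) :
    edgeMass P (heightGap γ) < ∞ := by
  have hfin : ∫⁻ S, ∑' s : S, ENNReal.ofReal (conductance S 0 s)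
      * ENNReal.ofReal (|grad S (fun v => γ v S) 0 s| ^ r) ∂palm P ≠ ∞ := by
    intro h
    refine hγ.ne ?_
    simp only [campbell, id, h]
    exact ENNReal.mul_top (ENNReal.inv_ne_zero.2 ENNReal.ofNat_ne_top)
  have hle : edgeMass P (heightGap γ) ≤ ∫⁻ S, (deg (edge S) (0 : Space d)
      + ∑' s : S, ENNReal.ofReal (conductance S 0 s)
        * ENNReal.ofReal (|grad S (fun v => γ v S) 0 s| ^ r)) ∂palm P := by
    refine lintegral_mono fun S => ?_
    have h1 : deg (edge S) (0 : Space d) = ∑' s : S, edge S 0 s := by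
      simpa [deg] using tsum_edge_mul S 0 1
    rw [tsum_edge_mul, h1, ← ENNReal.tsum_add]
    refine ENNReal.tsum_le_tsum fun s => ?_
    rw [← edge]
    by_cases h : IsNeighbor S 0 (s : Space d)
    · have hc := conductance_of_isNeighbor h
      rw [edge, hc, ENNReal.ofReal_one, one_mul, one_mul, heightGap,
        if_pos h.joined, ← ENNReal.ofReal_one,
        ← ENNReal.ofReal_add zero_le_one (by positivity)]
      refine ENNReal.ofReal_le_ofReal ?_
      rw [grad, hc, one_mul, height, height, if_pos h.1, if_pos h.2.1, ← sq_abs]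
      set u := |γ s S - γ 0 S|
      have hu : 0 ≤ u := abs_nonneg _
      rcases le_total u 1 with h1 | h1
      · have : 0 ≤ u ^ r := by positivity
        nlinarith
      · have := Real.rpow_le_rpow_of_exponent_le h1 hr
        rw [Real.rpow_two] at this
        linarith
    · rw [not_ne_iff.1 (mt edge_ne_zero.1 h)]
      simp
  refine hle.trans_lt ?_
  have hdeg : Measurable fun S : Config (Space d) => deg (edge S) (0 : Space d) :=
    isField_deg.measurable_comp (f := fun _ => 0) (g := fun _ => 0)
      measurable_const measurable_const measurable_id
  rw [lintegral_add_left hdeg]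
  exact ENNReal.add_lt_top.2 ⟨hP.lintegral_deg_lt_top, hfin.lt_top⟩

end Degrees

/-! ### The backward walk for given clocks -/

section Walk

variable {V : Type*} {a : V → V → ℝ≥0∞} {C : V → Set ℝ}

open Classical in
/-- The probability that the backward walk which is at `i` at time `u` makes exactly `k` jumps down
to time `0` and ends at `j`, on a weighted graph and in extended nonnegative numbers. -/
def walkProb (a : V → V → ℝ≥0∞) (C : V → Set ℝ) (j : V) : ℕ → V → ℝ → ℝ≥0∞
  | 0, i, u => if i = j ∧ C i ∩ Ioc 0 u = ∅ then 1 else 0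
  | k + 1, i, u =>
      if (C i ∩ Ioc 0 u).Nonempty then
        avg a (fun v => walkProb a C j k v (sSup (C i ∩ Ioc 0 u))) i
      else 0

/-- The transition probability of the backward walk from time `t` to time `0`. -/
def walkKernel (a : V → V → ℝ≥0∞) (C : V → Set ℝ) (t : ℝ) (i j : V) : ℝ≥0∞ :=
  ∑' k, walkProb a C j k i t

open Classical in
lemma walkProb_zero_of_empty {i j : V} {u : ℝ} (h : C i ∩ Ioc 0 u = ∅) :
    walkProb a C j 0 i u = if i = j then 1 else 0 := by
  simp [walkProb, h]

lemma walkProb_zero_of_nonempty {i j : V} {u : ℝ} (h : (C i ∩ Ioc 0 u).Nonempty) :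
    walkProb a C j 0 i u = 0 := by
  simp [walkProb, h.ne_empty]

lemma walkProb_succ_of_empty {k : ℕ} {i j : V} {u : ℝ} (h : C i ∩ Ioc 0 u = ∅) :
    walkProb a C j (k + 1) i u = 0 := by
  simp [walkProb, h]

lemma walkProb_succ_of_nonempty {k : ℕ} {i j : V} {u : ℝ} (h : (C i ∩ Ioc 0 u).Nonempty) :
    walkProb a C j (k + 1) i u
      = avg a (fun v => walkProb a C j k v (sSup (C i ∩ Ioc 0 u))) i := by
  simp [walkProb, h]

lemma tsum_walkKernel_le_one (t : ℝ) (i : V) : ∑' j, walkKernel a C t i j ≤ 1 := by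
  classical
  unfold walkKernel
  rw [ENNReal.tsum_comm]
  refine ENNReal.tsum_le_of_sum_range_le fun n => ?_
  induction n generalizing i t with
  | zero => simp
  | succ n ih =>
    rw [Finset.sum_range_succ']
    rcases (C i ∩ Ioc 0 t).eq_empty_or_nonempty with h | h
    · simp only [walkProb_succ_of_empty h, walkProb_zero_of_empty h, tsum_zero,
        Finset.sum_const_zero, zero_add]
      rw [tsum_eq_single i (fun j hj => if_neg hj.symm), if_pos rfl]
    · simp only [walkProb_succ_of_nonempty h, walkProb_zero_of_nonempty h, tsum_zero, add_zero,
        ← avg_tsum]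
      rw [← avg_sum]
      refine (avg_mono (fun v => ?_) i).trans (avg_const_le 1 i)
      exact ih _ v

lemma walkKernel_le_one (t : ℝ) (i j : V) : walkKernel a C t i j ≤ 1 :=
  (ENNReal.le_tsum j).trans (tsum_walkKernel_le_one t i)

lemma walkProb_le_one (k : ℕ) (t : ℝ) (i j : V) : walkProb a C j k i t ≤ 1 :=
  (ENNReal.le_tsum (f := fun k => walkProb a C j k i t) k).trans (walkKernel_le_one t i j)

/-- The walk depends only on the clocks up to the starting time. -/
lemma walkProb_congr_of_le {C' : V → Set ℝ} {t : ℝ}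
    (h : ∀ i, C i ∩ Ioc 0 t = C' i ∩ Ioc 0 t) (j : V) (k : ℕ) (i : V) {u : ℝ} (hu : u ≤ t) :
    walkProb a C j k i u = walkProb a C' j k i u := by
  have h' (i : V) {u : ℝ} (hu : u ≤ t) : C i ∩ Ioc 0 u = C' i ∩ Ioc 0 u := by
    rw [← inter_eq_right.2 (Ioc_subset_Ioc_right hu : Ioc 0 u ⊆ Ioc 0 t), ← inter_assoc, h i,
      inter_assoc]
  induction k generalizing i u with
  | zero =>
    simp only [walkProb]
    rw [h' i hu]
  | succ k ih =>
    rcases (C i ∩ Ioc 0 u).eq_empty_or_nonempty with h0 | h0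
    · rw [walkProb_succ_of_empty h0, walkProb_succ_of_empty (h' i hu ▸ h0)]
    · rw [walkProb_succ_of_nonempty h0, walkProb_succ_of_nonempty (h' i hu ▸ h0), h' i hu]
      congr 1
      funext v
      refine ih v ((csSup_le (h' i hu ▸ h0) fun x hx => hx.2.2).trans hu)

lemma walkKernel_congr {C' : V → Set ℝ} {t : ℝ} (h : ∀ i, C i ∩ Ioc 0 t = C' i ∩ Ioc 0 t)
    (i j : V) : walkKernel a C t i j = walkKernel a C' t i j :=
  tsum_congr fun k => walkProb_congr_of_le h j k i le_rfl

lemma inter_Ioc_zero_of_empty {s : Set ℝ} {t t' : ℝ} (ht : 0 ≤ t) (htt : t ≤ t')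
    (h : s ∩ Ioc t t' = ∅) : s ∩ Ioc 0 t' = s ∩ Ioc 0 t := by
  rw [← Ioc_union_Ioc_eq_Ioc ht htt, inter_union_distrib_left, h, union_empty]

lemma walkProb_eq_of_empty {t t' : ℝ} (ht : 0 ≤ t) (htt : t ≤ t') {i : V}
    (h : C i ∩ Ioc t t' = ∅) (j : V) (k : ℕ) : walkProb a C j k i t' = walkProb a C j k i t := by
  cases k <;> simp only [walkProb] <;> rw [inter_Ioc_zero_of_empty ht htt h]

/-- Without an epoch at the starting point nothing happens. -/
lemma walkKernel_eq_of_empty {t t' : ℝ} (ht : 0 ≤ t) (htt : t ≤ t') {i : V}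
    (h : C i ∩ Ioc t t' = ∅) (j : V) : walkKernel a C t' i j = walkKernel a C t i j :=
  tsum_congr fun k => walkProb_eq_of_empty ht htt h j k

/-- A single epoch at the starting point, and none at its neighbors, makes the walk average. -/
lemma walkKernel_eq_avg {t t' τ : ℝ} (ht : 0 ≤ t) {i : V} (h : C i ∩ Ioc t t' = {τ})
    (hnb : ∀ v, a i v ≠ 0 → C v ∩ Ioc t t' = ∅) (j : V) :
    walkKernel a C t' i j = avg a (fun v => walkKernel a C t v j) i := by
  have hτ : τ ∈ C i ∩ Ioc t t' := h ▸ mem_singleton τ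
  have htt : t ≤ t' := hτ.2.1.le.trans hτ.2.2
  have hτ' : τ ∈ C i ∩ Ioc 0 t' := ⟨hτ.1, ht.trans_lt hτ.2.1, hτ.2.2⟩
  have hsup : sSup (C i ∩ Ioc 0 t') = τ := by
    refine le_antisymm (csSup_le ⟨τ, hτ'⟩ fun x hx => ?_)
      (le_csSup ⟨t', fun x hx => hx.2.2⟩ hτ')
    by_contra! hlt
    have : x ∈ C i ∩ Ioc t t' := ⟨hx.1, hτ.2.1.trans hlt, hx.2.2⟩
    rw [h] at this
    exact hlt.ne' this
  unfold walkKernel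
  rw [tsum_eq_zero_add' ENNReal.summable, walkProb_zero_of_nonempty ⟨τ, hτ'⟩, zero_add, avg_tsum]
  refine tsum_congr fun k => ?_
  rw [walkProb_succ_of_nonempty ⟨τ, hτ'⟩, hsup]
  refine avg_congr fun v hv => walkProb_eq_of_empty ht hτ.2.1.le ?_ j k
  exact subset_empty_iff.1 ((inter_subset_inter_right _ (Ioc_subset_Ioc_right hτ.2.2)).trans
    (hnb v hv).subset)

lemma walkProb_relabel {W : Type*} {e : W → V} (he : Function.Injective e)
    (hr : ∀ i z, a (e i) z ≠ 0 → z ∈ range e) (j : W) (k : ℕ) (i : W) (u : ℝ) :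
    walkProb a C (e j) k (e i) u = walkProb (pullWeight a e) (fun i => C (e i)) j k i u := by
  induction k generalizing i u with
  | zero =>
    simp only [walkProb]
    rw [he.eq_iff]
  | succ k ih => simp only [walkProb, avg_relabel he hr, ih]

lemma walkKernel_relabel {W : Type*} {e : W → V} (he : Function.Injective e)
    (hr : ∀ i z, a (e i) z ≠ 0 → z ∈ range e) (t : ℝ) (i j : W) :
    walkKernel a C t (e i) (e j) = walkKernel (pullWeight a e) (fun i => C (e i)) t i j :=
  tsum_congr fun k => walkProb_relabel he hr j k i t

end Walk

section WalkMeasurability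

variable {α : Type*} [MeasurableSpace α]

lemma measurableSet_nonempty_inter_Ioc {D : α → Set ℝ} {c : ℝ}
    (hD : ∀ q, MeasurableSet {x | (D x ∩ Ioc c q).Nonempty})
    (hfin : ∀ x q, (D x ∩ Ioc c q).Finite) :
    MeasurableSet {p : α × ℝ | (D p.1 ∩ Ioc c p.2).Nonempty} := by
  have : {p : α × ℝ | (D p.1 ∩ Ioc c p.2).Nonempty}
      = ⋂ q : ℚ, {p : α × ℝ | (q : ℝ) ≤ p.2} ∪ {p : α × ℝ | (D p.1 ∩ Ioc c q).Nonempty} := by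
    ext ⟨x, u⟩
    simp only [mem_ofPred_eq, mem_iInter, mem_union]
    constructor
    · intro h q
      rcases le_or_gt (q : ℝ) u with hq | hq
      · exact Or.inl hq
      · exact Or.inr (h.mono (inter_subset_inter_right _ (Ioc_subset_Ioc_right hq.le)))
    · intro h
      by_contra hemp
      -- the points in `(c, u + 1]` are finitely many and lie beyond `u`
      have hlt : ∀ y ∈ D x ∩ Ioc c (u + 1), u < y := fun y hy => by
        by_contra! hle
        exact hemp ⟨y, hy.1, hy.2.1, hle⟩
      obtain ⟨m, hm1, hm2⟩ : ∃ m, u < m ∧ ∀ y ∈ D x ∩ Ioc c (u + 1), m ≤ y := by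
        rcases (D x ∩ Ioc c (u + 1)).eq_empty_or_nonempty with h0 | h0
        · exact ⟨u + 1, by linarith, by simp [h0]⟩
        · obtain ⟨m, hm, hmin⟩ := exists_min_image _ id (hfin x (u + 1)) h0
          exact ⟨m, hlt m hm, hmin⟩
      obtain ⟨q, hq1, hq2⟩ := exists_rat_btwn (lt_min hm1 (lt_add_one u))
      obtain ⟨y, hy⟩ := (h q).resolve_left (not_le.2 hq1)
      have := hm2 y ⟨hy.1, hy.2.1, hy.2.2.trans (hq2.le.trans (min_le_right _ _))⟩
      have := hq2.trans_le (min_le_left _ _)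
      linarith [hy.2.2]
  rw [this]
  refine MeasurableSet.iInter fun q => (measurableSet_le measurable_const measurable_snd).union ?_
  exact measurable_fst (hD q)

lemma measurable_last_epoch {D : α → Set ℝ}
    (hD : ∀ c q, 0 ≤ c → MeasurableSet {x | (D x ∩ Ioc c q).Nonempty})
    (hfin : ∀ x c q, (D x ∩ Ioc c q).Finite) :
    Measurable fun p : α × ℝ => sSup (D p.1 ∩ Ioc 0 p.2) := by
  refine measurable_of_Ioi fun c => ?_
  rcases lt_or_ge c 0 with hc | hc
  · convert MeasurableSet.univ
    ext p
    simp only [mem_preimage, mem_Ioi, mem_univ, iff_true]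
    refine hc.trans_le (Real.sSup_nonneg fun x hx => hx.2.1.le)
  · convert measurableSet_nonempty_inter_Ioc (hD c · hc) (fun x q => hfin x c q) using 1
    ext p
    simp only [mem_preimage, mem_Ioi, mem_ofPred_eq]
    constructor
    · intro h
      have hne : (D p.1 ∩ Ioc 0 p.2).Nonempty := by
        by_contra h0
        rw [not_nonempty_iff_eq_empty.1 h0, Real.sSup_empty] at h
        exact h.not_ge hc
      obtain ⟨y, hy, hcy⟩ := exists_lt_of_lt_csSup hne h
      exact ⟨y, hy.1, hcy, hy.2.2⟩
    · rintro ⟨y, hy, hcy, hyu⟩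
      exact hcy.trans_le (le_csSup ⟨p.2, fun x hx => hx.2.2⟩ ⟨hy, hc.trans_lt hcy, hyu⟩)

variable {V : Type*} [Countable V]

lemma Measurable.avg {a : α → V → V → ℝ≥0∞} (ha : ∀ i j, Measurable fun x => a x i j)
    {g : α → V → ℝ≥0∞} (hg : ∀ j, Measurable fun x => g x j) (i : V) :
    Measurable fun x => avg (a x) (g x) i := by
  refine Measurable.mul (Measurable.inv (Measurable.tsum fun j => ha i j)) ?_
  exact Measurable.tsum fun j => (ha i j).mul (hg j)

lemma measurable_walkProb {a : α → V → V → ℝ≥0∞} (ha : ∀ i j, Measurable fun x => a x i j)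
    {C : α → V → Set ℝ} (hC : ∀ i c q, 0 ≤ c → MeasurableSet {x | (C x i ∩ Ioc c q).Nonempty})
    (hfin : ∀ x i c q, (C x i ∩ Ioc c q).Finite) (j : V) (k : ℕ) (i : V) :
    Measurable fun p : α × ℝ => walkProb (a p.1) (C p.1) j k i p.2 := by
  classical
  have hne (i : V) : MeasurableSet {p : α × ℝ | (C p.1 i ∩ Ioc 0 p.2).Nonempty} :=
    measurableSet_nonempty_inter_Ioc (hC i 0 · le_rfl) fun x q => hfin x i 0 q
  induction k generalizing i with
  | zero =>
    refine Measurable.ite ?_ measurable_const measurable_const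
    convert (MeasurableSet.const (i = j)).inter (hne i).compl using 1
    ext p
    simp [not_nonempty_iff_eq_empty]
  | succ k ih =>
    refine Measurable.ite (hne i) (Measurable.avg (fun i j => (ha i j).comp measurable_fst)
      (fun v => ?_) i) measurable_const
    exact (ih v).comp (measurable_fst.prodMk
      (measurable_last_epoch (hC i) fun x => hfin x i))

lemma measurable_walkKernel {a : α → V → V → ℝ≥0∞} (ha : ∀ i j, Measurable fun x => a x i j)
    {C : α → V → Set ℝ} (hC : ∀ i c q, 0 ≤ c → MeasurableSet {x | (C x i ∩ Ioc c q).Nonempty})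
    (hfin : ∀ x i c q, (C x i ∩ Ioc c q).Finite) (t : ℝ) (i j : V) :
    Measurable fun x => walkKernel (a x) (C x) t i j :=
  Measurable.tsum fun k => (measurable_walkProb ha hC hfin j k i).comp measurable_prodMk_right

end WalkMeasurability

section JumpProb

variable {d : ℕ}

lemma toReal_avg_edge {S : Config (Space d)} {s : Space d} (hs : deg (edge S) s ≠ ∞)
    {g : Space d → ℝ≥0∞} (hg : ∀ z, g z ≠ ∞) :
    (avg (edge S) g s).toReal
      = ∑' v : S, conductance S s v / degree S s * (g v).toReal := by
  have hc (z : Space d) : 0 ≤ conductance S s z := by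
    unfold conductance
    split_ifs <;> norm_num
  rw [avg, tsum_edge_mul, ENNReal.toReal_mul, ENNReal.toReal_inv,
    deg_edge_of_finite (finite_of_deg_edge hs), ENNReal.toReal_natCast,
    ENNReal.tsum_toReal_eq fun z : S =>
      ENNReal.mul_ne_top (show edge S s z ≠ ∞ from ENNReal.ofReal_ne_top) (hg z), ← tsum_mul_left]
  refine tsum_congr fun v => ?_
  rw [ENNReal.toReal_mul, edge, ENNReal.toReal_ofReal (hc _)]
  ring

lemma jumpProb_eq_toReal {S : Config (Space d)} (hS : ∀ s ∈ S, deg (edge S) s ≠ ∞)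
    (𝒯 : Space d → Set ℝ) (s' : Space d) (k : ℕ) {s : Space d} (hs : s ∈ S) (u : ℝ) :
    jumpProb S 𝒯 s' k s u = (walkProb (edge S) 𝒯 s' k s u).toReal := by
  induction k generalizing s u with
  | zero =>
    unfold jumpProb walkProb
    split_ifs <;> simp
  | succ k ih =>
    unfold jumpProb walkProb
    split_ifs
    · rw [toReal_avg_edge (hS s hs) fun z =>
        ((walkProb_le_one k _ z s').trans_lt ENNReal.one_lt_top).ne]
      exact tsum_congr fun v => by rw [ih v.2]
    · simp

lemma transProb_eq_toReal {S : Config (Space d)} (hS : ∀ s ∈ S, deg (edge S) s ≠ ∞)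
    (𝒯 : Space d → Set ℝ) (t : ℝ) {s : Space d} (hs : s ∈ S) (s' : Space d) :
    transProb S 𝒯 t s s' = (walkKernel (edge S) 𝒯 t s s').toReal := by
  unfold transProb walkKernel
  rw [ENNReal.tsum_toReal_eq fun k => ((walkProb_le_one k t s s').trans_lt ENNReal.one_lt_top).ne]
  exact tsum_congr fun k => jumpProb_eq_toReal hS 𝒯 s' k hs t

end JumpProb

/-! ### Poisson clocks and their past -/

section Independence

variable {Ω : Type*}

/-- If `m` is independent of `m'` inside a σ-algebra `A` that is independent of `R`, then `m ⊔ R` is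
independent of `m'`. -/
lemma indep_sup_of_indep {mΩ : MeasurableSpace Ω} {Pr : Measure Ω} [IsProbabilityMeasure Pr]
    {m m' A R : MeasurableSpace Ω} (hA : A ≤ mΩ) (hR : R ≤ mΩ) (hm : m ≤ A) (hm' : m' ≤ A)
    (h : Indep m m' Pr) (hAR : Indep A R Pr) : Indep (m ⊔ R) m' Pr := by
  let p : Set (Set Ω) := {s | ∃ u v, MeasurableSet[m] u ∧ MeasurableSet[R] v ∧ s = u ∩ v}
  have hp : IsPiSystem p := by
    rintro _ ⟨u, v, hu, hv, rfl⟩ _ ⟨u', v', hu', hv', rfl⟩ -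
    exact ⟨u ∩ u', v ∩ v', hu.inter hu', hv.inter hv', inter_inter_inter_comm u v u' v'⟩
  have hgen : m ⊔ R = MeasurableSpace.generateFrom p := by
    refine le_antisymm (sup_le (fun u hu => ?_) fun v hv => ?_)
      (MeasurableSpace.generateFrom_le ?_)
    · exact MeasurableSpace.measurableSet_generateFrom
        ⟨u, univ, hu, MeasurableSet.univ, (inter_univ u).symm⟩
    · exact MeasurableSpace.measurableSet_generateFrom
        ⟨univ, v, MeasurableSet.univ, hv, (univ_inter v).symm⟩
    · rintro _ ⟨u, v, hu, hv, rfl⟩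
      exact ((le_sup_left : m ≤ m ⊔ R) _ hu).inter ((le_sup_right : R ≤ m ⊔ R) _ hv)
  refine IndepSets.indep (sup_le (hm.trans hA) hR) (hm'.trans hA) hp
    (@MeasurableSpace.isPiSystem_measurableSet Ω m') hgen
    (@MeasurableSpace.generateFrom_measurableSet Ω m').symm ?_
  refine (IndepSets_iff _ _ _).2 ?_
  rintro _ w ⟨u, v, hu, hv, rfl⟩ hw
  have h1 := (Indep_iff _ _ _).1 h u w hu hw
  have h2 := (Indep_iff _ _ _).1 hAR u v (hm u hu) hv
  have h3 := (Indep_iff _ _ _).1 hAR (u ∩ w) v ((hm u hu).inter (hm' w hw)) hv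
  rw [inter_right_comm, h3, h1, h2]
  ring

end Independence

section Past

lemma Config.count_Ioc_add (S : Config ℝ) {r s t : ℝ} (hrs : r ≤ s) (hst : s ≤ t) :
    Config.count (Ioc r t) S = Config.count (Ioc r s) S + Config.count (Ioc s t) S := by
  have h1 : ((S : Set ℝ) ∩ Ioc r s).Finite := S.locallyFinite _ (Metric.isBounded_Ioc _ _)
  have h2 : ((S : Set ℝ) ∩ Ioc s t).Finite := S.locallyFinite _ (Metric.isBounded_Ioc _ _)
  unfold Config.count
  rw [← Ioc_union_Ioc_eq_Ioc hrs hst, inter_union_distrib_left, ncard_union_eq ?_ h1 h2]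
  refine Disjoint.mono inter_subset_right inter_subset_right ?_
  exact Set.disjoint_left.2 fun x hx hx' => hx.2.not_gt hx'.1

lemma Config.count_eq_zero_iff (S : Config ℝ) (s t : ℝ) :
    Config.count (Ioc s t) S = 0 ↔ (S : Set ℝ) ∩ Ioc s t = ∅ :=
  ncard_eq_zero (S.locallyFinite _ (Metric.isBounded_Ioc _ _))

variable {Ω : Type*}

/-- The σ-algebra of the clocks up to time `t`. -/
@[reducible]
def past (T : ℕ → Ω → Config ℝ) (t : ℝ) : MeasurableSpace Ω :=
  ⨆ n, MeasurableSpace.comap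
    (fun ω (c : Icc 0 t) => Config.count (Ioc 0 (c : ℝ)) (T n ω)) MeasurableSpace.pi

lemma measurable_past_count (T : ℕ → Ω → Config ℝ) {t c : ℝ} (hc : c ∈ Icc 0 t) (n : ℕ) :
    Measurable[past T t] fun ω => Config.count (Ioc 0 c) (T n ω) := by
  have h1 := comap_measurable (m := MeasurableSpace.pi)
    fun ω (c : Icc 0 t) => Config.count (Ioc 0 (c : ℝ)) (T n ω)
  have h2 := (measurable_pi_apply (⟨c, hc⟩ : Icc 0 t)).comp h1
  exact h2.mono (le_iSup (fun n => MeasurableSpace.comap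
    (fun ω (c : Icc 0 t) => Config.count (Ioc 0 (c : ℝ)) (T n ω)) MeasurableSpace.pi) n) le_rfl

lemma measurable_past_walkKernel (T : ℕ → Ω → Config ℝ) (a : ℕ → ℕ → ℝ≥0∞) {t : ℝ} (i j : ℕ) :
    Measurable[past T t] fun ω => walkKernel a (fun n => (T n ω : Set ℝ)) t i j := by
  have h (ω : Ω) : walkKernel a (fun n => (T n ω : Set ℝ)) t i j
      = walkKernel a (fun n => (T n ω : Set ℝ) ∩ Ioc 0 t) t i j :=
    walkKernel_congr (fun n => by rw [inter_assoc, inter_self]) i j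
  simp only [h]
  refine @measurable_walkKernel Ω (past T t) ℕ _ (fun _ => a) (fun _ _ => measurable_const)
    (fun ω n => (T n ω : Set ℝ) ∩ Ioc 0 t) (fun n c q hc => ?_) (fun ω n c q => ?_) t i j
  · rcases le_or_gt c (min q t) with hcq | hcq
    · have hm := hcq.trans (min_le_right _ _)
      have hset : {ω | ((T n ω : Set ℝ) ∩ Ioc 0 t ∩ Ioc c q).Nonempty}
          = {ω | Config.count (Ioc 0 c) (T n ω) = Config.count (Ioc 0 (min q t)) (T n ω)}ᶜ := by
        ext ω
        have hI : Ioc 0 t ∩ Ioc c q = Ioc c (min q t) := by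
          rw [Ioc_inter_Ioc, max_eq_right hc, min_comm]
        rw [mem_ofPred_eq, inter_assoc, hI, mem_compl_iff, mem_ofPred_eq,
          Config.count_Ioc_add _ hc hcq, nonempty_iff_ne_empty, Ne, ← Config.count_eq_zero_iff]
        omega
      rw [hset]
      refine MeasurableSet.compl ?_
      exact @measurableSet_eq_fun Ω ℕ (past T t) _ _ _ _
        (measurable_past_count T ⟨hc, hm⟩ n)
        (measurable_past_count T ⟨hc.trans hcq, min_le_right _ _⟩ n)
    · have hset : {ω | ((T n ω : Set ℝ) ∩ Ioc 0 t ∩ Ioc c q).Nonempty} = ∅ := by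
        refine eq_empty_of_forall_notMem fun ω ⟨x, ⟨_, h2⟩, h3⟩ => ?_
        exact (hcq.trans h3.1).not_ge (le_min h3.2 h2.2)
      rw [hset]
      exact @MeasurableSet.empty _ (past T t)
  · rw [inter_right_comm]
    have h1 : ((T n ω : Set ℝ) ∩ Ioc c q).Finite :=
      (T n ω).locallyFinite _ (Metric.isBounded_Ioc _ _)
    exact h1.subset inter_subset_left

end Past

section Poisson

variable {Ω : Type*} [MeasurableSpace Ω] {Pr : Measure Ω}

lemma IsPoissonProcess.measurable_count_comp {T : Ω → Config ℝ} (hT : IsPoissonProcess Pr T)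
    (s t : ℝ) : Measurable fun ω => Config.count (Ioc s t) (T ω) :=
  (Config.measurable_count (Metric.isBounded_Ioc _ _) measurableSet_Ioc).comp hT.measurable

lemma past_le {T : ℕ → Ω → Config ℝ} (hT : ∀ n, IsPoissonProcess Pr (T n)) (t : ℝ) :
    past T t ≤ ‹MeasurableSpace Ω› :=
  iSup_le fun n => Measurable.comap_le
    (measurable_pi_iff.2 fun c => (hT n).measurable_count_comp 0 c)

lemma IsPoissonProcess.real_count_eq {T : Ω → Config ℝ} (hT : IsPoissonProcess Pr T) (t : ℝ)
    {h : ℝ} (hh : 0 ≤ h)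
    (n : ℕ) : Pr.real {ω | Config.count (Ioc t (t + h)) (T ω) = n}
      = Real.exp (-h) * h ^ n / n.factorial := by
  have h1 := hT.law (Ioc t (t + h)) (Metric.isBounded_Ioc _ _) measurableSet_Ioc
  have h2 : (volume (Ioc t (t + h))).toNNReal = h.toNNReal := by
    rw [Real.volume_Ioc, add_sub_cancel_left]
    rfl
  rw [h2] at h1
  have h3 : (Pr.map fun ω => Config.count (Ioc t (t + h)) (T ω)).real {n}
      = Pr.real {ω | Config.count (Ioc t (t + h)) (T ω) = n} :=
    map_measureReal_apply (hT.measurable_count_comp t (t + h)) (measurableSet_singleton n)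
  rw [← h3, h1, poissonMeasure_real_singleton, Real.coe_toNNReal h hh]

variable [IsProbabilityMeasure Pr]

/-- The number of points up to finitely many past times is independent of the number of points in a
later interval. -/
lemma IsPoissonProcess.indepFun_finset {T : Ω → Config ℝ} (hT : IsPoissonProcess Pr T)
    {t t' : ℝ} (J : Finset (Icc 0 t)) :
    IndepFun (fun ω (c : J) => Config.count (Ioc 0 (c : ℝ)) (T ω))
      (fun ω => Config.count (Ioc t t') (T ω)) Pr := by
  classical
  rcases J.eq_empty_or_nonempty with rfl | hJ
  · have : (fun ω (c : (∅ : Finset (Icc 0 t))) => Config.count (Ioc 0 (c : ℝ)) (T ω))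
        = fun _ c => 0 := by
      funext ω c
      exact absurd c.2 (Finset.notMem_empty _)
    rw [this]
    exact indepFun_const_left _ _
  have ht : 0 ≤ t := by
    obtain ⟨c, -⟩ := hJ
    exact c.2.1.trans c.2.2
  -- the times in increasing order, preceded by `0` and followed by `t`
  let m := J.card
  let c : Fin m ↪o Icc 0 t := J.orderEmbOfFin rfl
  obtain ⟨f, hf0, hfs⟩ : ∃ f : ℕ → ℝ, f 0 = 0 ∧
      ∀ n, f (n + 1) = if h : n < m then (c ⟨n, h⟩ : ℝ) else t :=
    ⟨fun n => Nat.casesOn n 0 fun n => if h : n < m then (c ⟨n, h⟩ : ℝ) else t, rfl, fun _ => rfl⟩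
  have hft (n : ℕ) : f n ≤ t := by
    cases n with
    | zero => exact hf0.trans_le ht
    | succ n =>
      rw [hfs]
      split_ifs with h
      · exact (c ⟨n, h⟩).2.2
      · exact le_rfl
  have hf : Monotone f := by
    refine monotone_nat_of_le_succ fun n => ?_
    cases n with
    | zero =>
      rw [hf0, hfs]
      split_ifs with h
      · exact (c ⟨0, h⟩).2.1
      · exact ht
    | succ n =>
      by_cases h : n + 1 < m
      · rw [hfs, hfs, dif_pos h, dif_pos (Nat.lt_of_succ_lt h)]
        exact c.monotone (Fin.mk_le_mk.2 n.le_succ)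
      · rw [hfs (n + 1), dif_neg h]
        exact hft _
  let B : Fin (m + 1) → Set ℝ := fun i => if (i : ℕ) < m then Ioc (f i) (f (i + 1)) else Ioc t t'
  have hBb (i : Fin (m + 1)) : Bornology.IsBounded (B i) := by
    simp only [B]
    split_ifs <;> exact (Metric.isBounded_Ioc _ _)
  have hBm (i : Fin (m + 1)) : MeasurableSet (B i) := by
    simp only [B]
    split_ifs <;> exact measurableSet_Ioc
  have hlt {i j : Fin (m + 1)} (hij : i < j) : Disjoint (B i) (B j) := by
    have hi : (i : ℕ) < m := by
      have := j.2
      have : (i : ℕ) < j := hij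
      omega
    refine Set.disjoint_left.2 fun x hx hx' => ?_
    simp only [B, if_pos hi] at hx
    by_cases hj : (j : ℕ) < m
    · simp only [B, if_pos hj] at hx'
      exact (hx.2.trans (hf (show (i : ℕ) + 1 ≤ j from hij))).not_gt hx'.1
    · simp only [B, if_neg hj] at hx'
      exact (hx.2.trans (hft _)).not_gt hx'.1
  have hind := hT.indep (m + 1) B hBb hBm fun i j hij =>
    hij.lt_or_gt.elim hlt fun h => (hlt h).symm
  -- the numbers of points up to the given times are partial sums of independent increments
  have hsum (n : ℕ) (S : Config ℝ) : Config.count (Ioc 0 (f n)) S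
      = ∑ i ∈ Finset.range n, Config.count (Ioc (f i) (f (i + 1))) S := by
    induction n with
    | zero => simp [hf0, Config.count]
    | succ n ih =>
      rw [Finset.sum_range_succ, ← ih]
      exact Config.count_Ioc_add S (hf0 ▸ hf (Nat.zero_le n)) (hf n.le_succ)
  have hind2 := hind.indepFun_finset (Finset.univ.filter fun i : Fin (m + 1) => (i : ℕ) < m)
    {Fin.last m} (by simp [Finset.disjoint_singleton_right])
    fun i => (Config.measurable_count (hBb i) (hBm i)).comp hT.measurable
  have hidx (x : J) : ∃ n : Fin m, c n = x := by
    have : (x : Icc 0 t) ∈ Set.range c := by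
      rw [Finset.range_orderEmbOfFin]
      exact x.2
    exact this
  choose idx hidx using hidx
  let g : ({i // i ∈ Finset.univ.filter fun i : Fin (m + 1) => (i : ℕ) < m} → ℕ) → J → ℕ :=
    fun v x => ∑ i, if (i.1 : ℕ) ≤ idx x then v i else 0
  have hg : Measurable g := measurable_pi_iff.2 fun x => Finset.measurable_sum _ fun i _ => by
    split_ifs
    · exact measurable_pi_apply i
    · exact measurable_const
  convert hind2.comp hg (measurable_pi_apply ⟨Fin.last m, Finset.mem_singleton_self _⟩) using 1
  · funext ω x
    have h1 : (x : ℝ) = f (idx x + 1) := by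
      rw [hfs, dif_pos (idx x).2, Fin.eta, hidx]
    simp only [Function.comp_apply, g]
    rw [h1, hsum]
    have h2 : ∀ i : {i // i ∈ Finset.univ.filter fun i : Fin (m + 1) => (i : ℕ) < m},
        (if (i.1 : ℕ) ≤ idx x then Config.count (B i) (T ω) else 0)
        = (fun i : ℕ => if i ≤ idx x then Config.count (Ioc (f i) (f (i + 1))) (T ω) else 0)
          (i.1 : ℕ) := by
      rintro ⟨i, hi⟩
      simp only [Finset.mem_filter, Finset.mem_univ, true_and] at hi
      simp only [B, if_pos hi]
    rw [Finset.sum_congr rfl fun i _ => h2 i, Finset.sum_coe_sort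
      (Finset.univ.filter fun i : Fin (m + 1) => (i : ℕ) < m)
      fun i => if (i : ℕ) ≤ idx x then Config.count (Ioc (f i) (f (i + 1))) (T ω) else 0,
      Finset.sum_filter, Fin.sum_univ_eq_sum_range
      fun i => if i < m then if i ≤ idx x then Config.count (Ioc (f i) (f (i + 1))) (T ω) else 0
        else 0]
    rw [← Finset.sum_filter, ← Finset.sum_filter]
    refine Finset.sum_congr ?_ fun _ _ => rfl
    ext i
    have := (idx x).2
    simp only [Finset.mem_range, Finset.mem_filter]
    omega
  · funext ω
    simp [B]

/-- The past is independent of the number of points of a clock in a later interval. -/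
lemma indep_past {T : ℕ → Ω → Config ℝ} (hT : ∀ n, IsPoissonProcess Pr (T n))
    (hTindep : iIndepFun T Pr) (t t' : ℝ) (i : ℕ) :
    Indep (past T t)
      (MeasurableSpace.comap (fun ω => Config.count (Ioc t t') (T i ω)) inferInstance) Pr := by
  have h1 : IndepFun (fun ω (c : Icc 0 t) => Config.count (Ioc 0 (c : ℝ)) (T i ω))
      (fun ω => Config.count (Ioc t t') (T i ω)) Pr :=
    IndepFun.process_indepFun (fun c => (hT i).measurable_count_comp 0 c)
      ((hT i).measurable_count_comp t t') fun J => (hT i).indepFun_finset J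
  let A (n : ℕ) : MeasurableSpace Ω := MeasurableSpace.comap (T n) inferInstance
  have hA (n : ℕ) : A n ≤ ‹MeasurableSpace Ω› := (hT n).measurable.comap_le
  have hcount (n : ℕ) (s s' : ℝ) : Measurable[A n] fun ω => Config.count (Ioc s s') (T n ω) :=
    (Config.measurable_count (Metric.isBounded_Ioc _ _) measurableSet_Ioc).comp
      (comap_measurable (T n))
  have hcount' (n : ℕ) : MeasurableSpace.comap
      (fun ω (c : Icc 0 t) => Config.count (Ioc 0 (c : ℝ)) (T n ω)) MeasurableSpace.pi ≤ A n :=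
    Measurable.comap_le (@measurable_pi_iff _ _ _ (A n) _ _ |>.2 fun c => hcount n 0 c)
  have h2 : Indep (⨆ n ∈ ({i} : Set ℕ), A n) (⨆ n ∈ ({i}ᶜ : Set ℕ), A n) Pr :=
    indep_iSup_of_disjoint hA hTindep.iIndep disjoint_compl_right
  rw [iSup_singleton] at h2
  refine indep_of_indep_of_le_left (indep_sup_of_indep (hA i) (iSup₂_le fun n _ => hA n)
    (hcount' i) (hcount i t t').comap_le h1 h2) ?_
  refine iSup_le fun n => ?_
  rcases eq_or_ne n i with rfl | hn
  · exact le_sup_left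
  · exact ((hcount' n).trans (le_iSup₂ (f := fun n (_ : n ∈ ({i}ᶜ : Set ℕ)) => A n) n hn)).trans
      le_sup_right

section Probabilities

variable {T : Ω → Config ℝ}

lemma IsPoissonProcess.real_count_ne_zero (hT : IsPoissonProcess Pr T) (t : ℝ) {h : ℝ}
    (hh : 0 ≤ h) :
    Pr.real {ω | Config.count (Ioc t (t + h)) (T ω) ≠ 0} = 1 - Real.exp (-h) := by
  have h1 := hT.real_count_eq t hh 0
  have h2 : MeasurableSet {ω | Config.count (Ioc t (t + h)) (T ω) = 0} :=
    hT.measurable_count_comp t (t + h) (measurableSet_singleton 0)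
  have h3 : {ω | Config.count (Ioc t (t + h)) (T ω) ≠ 0}
      = {ω | Config.count (Ioc t (t + h)) (T ω) = 0}ᶜ := rfl
  rw [h3, probReal_compl_eq_one_sub h2, h1]
  simp

lemma IsPoissonProcess.real_two_le_count (hT : IsPoissonProcess Pr T) (t : ℝ) {h : ℝ}
    (hh : 0 ≤ h) :
    Pr.real {ω | 2 ≤ Config.count (Ioc t (t + h)) (T ω)} ≤ h ^ 2 := by
  have h0 := hT.real_count_eq t hh 0
  have h1 := hT.real_count_eq t hh 1
  have hm (n : ℕ) : MeasurableSet {ω | Config.count (Ioc t (t + h)) (T ω) = n} :=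
    hT.measurable_count_comp t (t + h) (measurableSet_singleton n)
  have h3 : {ω | 2 ≤ Config.count (Ioc t (t + h)) (T ω)}
      = ({ω | Config.count (Ioc t (t + h)) (T ω) = 0}
        ∪ {ω | Config.count (Ioc t (t + h)) (T ω) = 1})ᶜ := by
    ext ω
    simp only [mem_ofPred_eq, mem_compl_iff, mem_union]
    omega
  have hd : Disjoint {ω | Config.count (Ioc t (t + h)) (T ω) = 0}
      {ω | Config.count (Ioc t (t + h)) (T ω) = 1} :=
    Set.disjoint_left.2 fun ω (hω : _ = 0) (hω' : _ = 1) => by omega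
  rw [h3, probReal_compl_eq_one_sub ((hm 0).union (hm 1)), measureReal_union hd (hm 1)]
  have h4 := Real.add_one_le_exp (-h)
  simp only [Nat.cast_one, pow_zero, pow_one, Nat.factorial_zero,
    Nat.factorial_one, div_one, mul_one] at h0 h1
  rw [h0, h1]
  nlinarith

end Probabilities

end Poisson

/-! ### Two backward walks during a short time -/

section RealChain

/-- The weights of the locally finite graph in which `nb i` is the set of neighbors of `i`. -/
def nbWeight (nb : ℕ → Finset ℕ) (i j : ℕ) : ℝ≥0∞ := if j ∈ nb i then 1 else 0

/-- The average of a real function over the neighbors (`0` at isolated points). -/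
def rAvg (nb : ℕ → Finset ℕ) (g : ℕ → ℝ) (i : ℕ) : ℝ := ((nb i).card : ℝ)⁻¹ * ∑ v ∈ nb i, g v

/-- The step of the two-walker chain on real functions. -/
def rPair (nb : ℕ → Finset ℕ) (F : ℕ → ℕ → ℝ) (i j : ℕ) : ℝ :=
  if i = j then 2⁻¹ * (rAvg nb (fun u => rAvg nb (fun v => F u v) i) i + F i i)
  else 2⁻¹ * (rAvg nb (fun u => F u j) i + rAvg nb (fun v => F i v) j)

variable {nb : ℕ → Finset ℕ}

lemma tsum_nbWeight_mul (g : ℕ → ℝ≥0∞) (i : ℕ) :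
    ∑' j, nbWeight nb i j * g j = ∑ j ∈ nb i, g j := by
  rw [tsum_eq_sum (s := nb i) fun j hj => by simp [nbWeight, hj]]
  exact Finset.sum_congr rfl fun j hj => by simp [nbWeight, hj]

lemma deg_nbWeight (i : ℕ) : deg (nbWeight nb) i = (nb i).card := by
  have := tsum_nbWeight_mul (nb := nb) (fun _ => 1) i
  simpa [deg] using this

lemma toReal_avg {g : ℕ → ℝ≥0∞} (hg : ∀ j, g j ≠ ∞) (i : ℕ) :
    (avg (nbWeight nb) g i).toReal = rAvg nb (fun j => (g j).toReal) i := by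
  rw [avg, tsum_nbWeight_mul, deg_nbWeight, ENNReal.toReal_mul, ENNReal.toReal_inv,
    ENNReal.toReal_natCast, ENNReal.toReal_sum fun j _ => hg j, rAvg]

lemma avg_ne_top {g : ℕ → ℝ≥0∞} (hg : ∀ j, g j ≠ ∞) (i : ℕ) : avg (nbWeight nb) g i ≠ ∞ := by
  rw [avg, tsum_nbWeight_mul, deg_nbWeight]
  rcases (nb i).eq_empty_or_nonempty with h | h
  · simp [h]
  · refine ENNReal.mul_ne_top ?_ (ENNReal.sum_ne_top.2 fun j _ => hg j)
    simpa using h.ne_empty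

lemma pairStep_ne_top {F : ℕ → ℕ → ℝ≥0∞} (hF : ∀ i j, F i j ≠ ∞) (i j : ℕ) :
    pairStep (nbWeight nb) F i j ≠ ∞ := by
  rcases eq_or_ne i j with rfl | h
  · rw [pairStep_self]
    exact ENNReal.mul_ne_top (by simp) (ENNReal.add_ne_top.2
      ⟨avg_ne_top (fun u => avg_ne_top (fun v => hF u v) i) i, hF i i⟩)
  · rw [pairStep_of_ne _ h]
    exact ENNReal.mul_ne_top (by simp) (ENNReal.add_ne_top.2
      ⟨avg_ne_top (fun u => hF u j) i, avg_ne_top (fun v => hF i v) j⟩)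

lemma toReal_pairStep {F : ℕ → ℕ → ℝ≥0∞} (hF : ∀ i j, F i j ≠ ∞) (i j : ℕ) :
    (pairStep (nbWeight nb) F i j).toReal = rPair nb (fun i j => (F i j).toReal) i j := by
  rcases eq_or_ne i j with rfl | h
  · have h1 (u : ℕ) : avgRight (nbWeight nb) F u i ≠ ∞ := avg_ne_top (fun v => hF u v) i
    have h2 : avgLeft (nbWeight nb) (avgRight (nbWeight nb) F) i i ≠ ∞ := avg_ne_top h1 i
    have h3 (u : ℕ) : (avgRight (nbWeight nb) F u i).toReal
      = rAvg nb (fun v => (F u v).toReal) i := toReal_avg (fun v => hF u v) i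
    rw [pairStep_self, ENNReal.toReal_mul, ENNReal.toReal_add h2 (hF i i), avgLeft,
      toReal_avg h1, rPair, if_pos rfl]
    simp only [h3, ENNReal.toReal_inv, ENNReal.toReal_ofNat]
  · rw [pairStep_of_ne _ h, ENNReal.toReal_mul, avgLeft, avgRight, ENNReal.toReal_add
      (avg_ne_top (fun u => hF u j) i) (avg_ne_top (fun v => hF i v) j),
      toReal_avg fun u => hF u j, toReal_avg fun v => hF i v, rPair, if_neg h]
    simp only [ENNReal.toReal_inv, ENNReal.toReal_ofNat]

lemma pairStep_iterate_ne_top {F : ℕ → ℕ → ℝ≥0∞} (hF : ∀ i j, F i j ≠ ∞) (k : ℕ) (i j : ℕ) :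
    (pairStep (nbWeight nb))^[k] F i j ≠ ∞ := by
  induction k generalizing i j with
  | zero => exact hF i j
  | succ k ih =>
    rw [Function.iterate_succ_apply']
    exact pairStep_ne_top ih i j

lemma toReal_pairStep_iterate {F : ℕ → ℕ → ℝ≥0∞} (hF : ∀ i j, F i j ≠ ∞) (k : ℕ) (i j : ℕ) :
    ((pairStep (nbWeight nb))^[k] F i j).toReal
      = (rPair nb)^[k] (fun i j => (F i j).toReal) i j := by
  induction k generalizing i j with
  | zero => rfl
  | succ k ih =>
    rw [Function.iterate_succ_apply', Function.iterate_succ_apply',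
      toReal_pairStep (pairStep_iterate_ne_top hF k), funext₂ ih]

lemma abs_rAvg_le {g : ℕ → ℝ} {M : ℝ} (hM : 0 ≤ M) (hg : ∀ j, |g j| ≤ M) (i : ℕ) :
    |rAvg nb g i| ≤ M := by
  unfold rAvg
  rcases (nb i).eq_empty_or_nonempty with h | h
  · simpa [h]
  · have hc : (0 : ℝ) < (nb i).card := by exact_mod_cast h.card_pos
    rw [abs_mul, abs_inv, abs_of_pos hc, inv_mul_le_iff₀ hc]
    calc |∑ v ∈ nb i, g v| ≤ ∑ v ∈ nb i, |g v| := Finset.abs_sum_le_sum_abs _ _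
      _ ≤ ∑ _v ∈ nb i, M := Finset.sum_le_sum fun j _ => hg j
      _ = (nb i).card * M := by simp

lemma abs_rPair_le {F : ℕ → ℕ → ℝ} {M : ℝ} (hM : 0 ≤ M) (hF : ∀ i j, |F i j| ≤ M) (i j : ℕ) :
    |rPair nb F i j| ≤ M := by
  have key {x y : ℝ} (hx : |x| ≤ M) (hy : |y| ≤ M) : |2⁻¹ * (x + y)| ≤ M := by
    rw [abs_le] at *
    constructor <;> linarith [hx.1, hx.2, hy.1, hy.2]
  unfold rPair
  split_ifs with h
  · exact key (abs_rAvg_le hM (fun u => abs_rAvg_le hM (fun v => hF u v) i) i) (hF i i)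
  · exact key (abs_rAvg_le hM (fun u => hF u j) i) (abs_rAvg_le hM (fun v => hF i v) j)

lemma rAvg_sub (f g : ℕ → ℝ) (i : ℕ) :
    rAvg nb (fun v => f v - g v) i = rAvg nb f i - rAvg nb g i := by
  simp only [rAvg, Finset.sum_sub_distrib, mul_sub]

lemma rAvg_const_mul (c : ℝ) (g : ℕ → ℝ) (i : ℕ) :
    rAvg nb (fun v => c * g v) i = c * rAvg nb g i := by
  simp only [rAvg, ← Finset.mul_sum]
  ring

lemma rAvg_sum {ι : Type*} (s : Finset ι) (g : ι → ℕ → ℝ) (i : ℕ) :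
    rAvg nb (fun v => ∑ k ∈ s, g k v) i = ∑ k ∈ s, rAvg nb (g k) i := by
  simp only [rAvg]
  rw [Finset.sum_comm, Finset.mul_sum]

lemma rPair_sub (F G : ℕ → ℕ → ℝ) (i j : ℕ) :
    rPair nb (fun i j => F i j - G i j) i j = rPair nb F i j - rPair nb G i j := by
  unfold rPair
  split_ifs <;> simp only [rAvg_sub] <;> ring

lemma rPair_const_mul (c : ℝ) (F : ℕ → ℕ → ℝ) (i j : ℕ) :
    rPair nb (fun i j => c * F i j) i j = c * rPair nb F i j := by
  unfold rPair
  split_ifs <;> simp only [rAvg_const_mul] <;> ring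

lemma rPair_sum {ι : Type*} (s : Finset ι) (F : ι → ℕ → ℕ → ℝ) (i j : ℕ) :
    rPair nb (fun i j => ∑ k ∈ s, F k i j) i j = ∑ k ∈ s, rPair nb (F k) i j := by
  unfold rPair
  split_ifs <;> simp only [rAvg_sum, ← Finset.sum_add_distrib, Finset.mul_sum]

end RealChain

section OneStep

variable {Ω : Type*} {T : ℕ → Ω → Config ℝ} {nb : ℕ → Finset ℕ}

/-- The transition probability of the backward walk, as a real number. -/
def walkReal (nb : ℕ → Finset ℕ) (T : ℕ → Ω → Config ℝ) (t : ℝ) (i x : ℕ) (ω : Ω) : ℝ :=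
  (walkKernel (nbWeight nb) (fun n => (T n ω : Set ℝ)) t i x).toReal

lemma walkReal_nonneg (t : ℝ) (i x : ℕ) (ω : Ω) : 0 ≤ walkReal nb T t i x ω :=
  ENNReal.toReal_nonneg

lemma walkReal_le_one (t : ℝ) (i x : ℕ) (ω : Ω) : walkReal nb T t i x ω ≤ 1 :=
  ENNReal.toReal_le_of_le_ofReal zero_le_one (by simpa using walkKernel_le_one t i x)

lemma abs_walkReal_le (t : ℝ) (i x : ℕ) (ω : Ω) : |walkReal nb T t i x ω| ≤ 1 := by
  rw [abs_of_nonneg (walkReal_nonneg t i x ω)]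
  exact walkReal_le_one t i x ω

lemma measurable_walkReal (t : ℝ) (i x : ℕ) : Measurable[past T t] (walkReal nb T t i x) :=
  ENNReal.measurable_toReal.comp (measurable_past_walkKernel T _ i x)

/-- The clock `n` rings in `(t, t + h]`. -/
def ringing (T : ℕ → Ω → Config ℝ) (t h : ℝ) (n : ℕ) : Set Ω :=
  {ω | Config.count (Ioc t (t + h)) (T n ω) ≠ 0}

/-- The event that during `(t, t + h]` the clock of `i` rings twice, or rings together with that of
a neighbor. -/
def clash (nb : ℕ → Finset ℕ) (T : ℕ → Ω → Config ℝ) (t h : ℝ) (i : ℕ) : Set Ω :=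
  {ω | 2 ≤ Config.count (Ioc t (t + h)) (T i ω)} ∪ ⋃ v ∈ nb i, ringing T t h i ∩ ringing T t h v

lemma walkReal_of_notMem_ringing {t h : ℝ} (ht : 0 ≤ t) (hh : 0 ≤ h) {i : ℕ} {ω : Ω}
    (hω : ω ∉ ringing T t h i) (x : ℕ) :
    walkReal nb T (t + h) i x ω = walkReal nb T t i x ω := by
  have h0 : Config.count (Ioc t (t + h)) (T i ω) = 0 := not_not.1 hω
  unfold walkReal
  rw [walkKernel_eq_of_empty (C := fun n => (T n ω : Set ℝ)) ht (by linarith)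
    ((Config.count_eq_zero_iff _ _ _).1 h0)]

lemma walkReal_of_mem_ringing {t h : ℝ} (ht : 0 ≤ t) {i : ℕ} {ω : Ω}
    (hω : ω ∈ ringing T t h i) (hc : ω ∉ clash nb T t h i) (x : ℕ) :
    walkReal nb T (t + h) i x ω = rAvg nb (fun v => walkReal nb T t v x ω) i := by
  have h0 : Config.count (Ioc t (t + h)) (T i ω) ≠ 0 := hω
  have h2 : ¬ 2 ≤ Config.count (Ioc t (t + h)) (T i ω) := fun h' => hc (Or.inl h')
  have h1 : Config.count (Ioc t (t + h)) (T i ω) = 1 := by omega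
  obtain ⟨τ, hτ⟩ := ncard_eq_one.1 h1
  unfold walkReal
  rw [walkKernel_eq_avg (C := fun n => (T n ω : Set ℝ)) ht hτ ?_, toReal_avg fun v =>
    ((walkKernel_le_one t v x).trans_lt ENNReal.one_lt_top).ne]
  intro v hv
  have hv' : v ∈ nb i := by
    by_contra hv'
    exact hv (if_neg hv')
  by_contra hne
  exact hc (Or.inr (mem_iUnion₂.2
    ⟨v, hv', hω, fun h' => hne ((Config.count_eq_zero_iff _ _ _).1 h')⟩))

variable [MeasurableSpace Ω] {Pr : Measure Ω}

lemma measurableSet_ringing (hT : ∀ n, IsPoissonProcess Pr (T n)) (t h : ℝ) (n : ℕ) :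
    MeasurableSet (ringing T t h n) :=
  (hT n).measurable_count_comp t (t + h) (measurableSet_singleton 0).compl

variable [IsProbabilityMeasure Pr]

lemma real_ringing (hT : ∀ n, IsPoissonProcess Pr (T n)) (t : ℝ) {h : ℝ} (hh : 0 ≤ h) (n : ℕ) :
    Pr.real (ringing T t h n) = 1 - Real.exp (-h) :=
  (hT n).real_count_ne_zero t hh

lemma real_ringing_le (hT : ∀ n, IsPoissonProcess Pr (T n)) (t : ℝ) {h : ℝ} (hh : 0 ≤ h) (n : ℕ) :
    Pr.real (ringing T t h n) ≤ h := by
  rw [real_ringing hT t hh]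
  linarith [Real.add_one_le_exp (-h)]

lemma real_ringing_inter_le (hT : ∀ n, IsPoissonProcess Pr (T n)) (hTindep : iIndepFun T Pr)
    (t : ℝ) {h : ℝ} (hh : 0 ≤ h) {i j : ℕ} (hij : i ≠ j) :
    Pr.real (ringing T t h i ∩ ringing T t h j) ≤ h ^ 2 := by
  have hm : Measurable fun S : Config ℝ => Config.count (Ioc t (t + h)) S :=
    Config.measurable_count (Metric.isBounded_Ioc _ _) measurableSet_Ioc
  have h1 := (hTindep.indepFun hij).measure_inter_preimage_eq_mul _ _
    (hm (measurableSet_singleton 0).compl) (hm (measurableSet_singleton 0).compl)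
  have h2 : Pr.real (ringing T t h i ∩ ringing T t h j)
      = Pr.real (ringing T t h i) * Pr.real (ringing T t h j) := by
    rw [measureReal_def, measureReal_def, measureReal_def, ← ENNReal.toReal_mul]
    exact congrArg _ h1
  rw [h2, sq]
  exact mul_le_mul (real_ringing_le hT t hh i) (real_ringing_le hT t hh j) measureReal_nonneg hh

lemma real_clash_le (hT : ∀ n, IsPoissonProcess Pr (T n)) (hTindep : iIndepFun T Pr)
    (hnb : ∀ i, i ∉ nb i) (t : ℝ) {h : ℝ} (hh : 0 ≤ h) (i : ℕ) :
    Pr.real (clash nb T t h i) ≤ (1 + (nb i).card) * h ^ 2 := by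
  refine (measureReal_union_le _ _).trans ?_
  have h1 := (hT i).real_two_le_count t hh
  have h2 : Pr.real (⋃ v ∈ nb i, ringing T t h i ∩ ringing T t h v) ≤ (nb i).card * h ^ 2 := by
    refine (measureReal_biUnion_finset_le _ _).trans ?_
    refine (Finset.sum_le_sum fun v hv => real_ringing_inter_le hT hTindep t hh
      (ne_of_mem_of_not_mem hv (hnb i)).symm).trans ?_
    simp
  linarith

/-- Two functions bounded by `M` that agree off a small event have close integrals. -/
lemma abs_integral_sub_le {X Y : Ω → ℝ} {M : ℝ} (hX : Measurable X) (hY : Measurable Y)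
    (hX' : ∀ ω, |X ω| ≤ M) (hY' : ∀ ω, |Y ω| ≤ M) {B : Set Ω}
    (h : ∀ ω, ω ∉ B → X ω = Y ω) : |∫ ω, X ω ∂Pr - ∫ ω, Y ω ∂Pr| ≤ 2 * M * Pr.real B := by
  have hXi : Integrable X Pr := Integrable.of_bound hX.aestronglyMeasurable M (ae_of_all _ hX')
  have hYi : Integrable Y Pr := Integrable.of_bound hY.aestronglyMeasurable M (ae_of_all _ hY')
  have hD : MeasurableSet {ω | X ω ≠ Y ω} := (measurableSet_eq_fun hX hY).compl
  rw [← integral_sub hXi hYi]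
  have hM (ω : Ω) : 0 ≤ M := (abs_nonneg _).trans (hX' ω)
  calc |∫ ω, (X ω - Y ω) ∂Pr| ≤ ∫ ω, |X ω - Y ω| ∂Pr := abs_integral_le_integral_abs
    _ ≤ ∫ ω, {ω | X ω ≠ Y ω}.indicator (fun _ => 2 * M) ω ∂Pr := by
        refine integral_mono (hXi.sub hYi).abs ((integrable_const _).indicator hD) fun ω => ?_
        by_cases hω : X ω = Y ω
        · simp [hω]
        · rw [indicator_of_mem (show ω ∈ {ω | X ω ≠ Y ω} from hω)]
          refine (abs_sub _ _).trans ?_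
          linarith [hX' ω, hY' ω]
    _ = 2 * M * Pr.real {ω | X ω ≠ Y ω} := by
        rw [integral_indicator_const _ hD, smul_eq_mul, mul_comm]
    _ ≤ 2 * M * Pr.real B := by
        have hM' : 0 ≤ M := by
          obtain ⟨ω⟩ := nonempty_of_isProbabilityMeasure Pr
          exact hM ω
        have : Pr.real {ω | X ω ≠ Y ω} ≤ Pr.real B :=
          measureReal_mono fun ω hω => by_contra fun hB => hω (h ω hB)
        gcongr

/-- The next ring is independent of the past. -/
lemma integral_indicator_ringing_mul (hT : ∀ n, IsPoissonProcess Pr (T n))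
    (hTindep : iIndepFun T Pr) (t : ℝ) {h : ℝ} (hh : 0 ≤ h) (n : ℕ) {G : Ω → ℝ}
    (hG : Measurable[past T t] G) :
    ∫ ω, (ringing T t h n).indicator 1 ω * G ω ∂Pr = (1 - Real.exp (-h)) * ∫ ω, G ω ∂Pr := by
  have h1 := indep_past hT hTindep t (t + h) n
  have h3 : IndepFun G (fun ω => Config.count (Ioc t (t + h)) (T n ω)) Pr :=
    indep_of_indep_of_le_left h1 hG.comap_le
  have h2 : IndepFun ((ringing T t h n).indicator (1 : Ω → ℝ)) G Pr :=
    (h3.comp measurable_id (measurable_one.indicator (measurableSet_singleton 0).compl :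
      Measurable (({0}ᶜ : Set ℕ).indicator (1 : ℕ → ℝ)))).symm
  have hr := measurableSet_ringing hT t h n
  rw [h2.integral_fun_mul_eq_mul_integral
    (measurable_one.indicator hr).aestronglyMeasurable
    (hG.mono (past_le hT t) le_rfl).aestronglyMeasurable, integral_indicator_one hr,
    real_ringing hT t hh]

end OneStep

/-! ### Duality of two backward walks with the two-walker chain -/

section Duality

variable {Ω : Type*} {T : ℕ → Ω → Config ℝ} {nb : ℕ → Finset ℕ}

lemma rAvg_mul_const (g : ℕ → ℝ) (c : ℝ) (i : ℕ) :
    rAvg nb g i * c = rAvg nb (fun v => g v * c) i := by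
  simp only [rAvg, ← Finset.sum_mul]
  ring

lemma abs_walkReal_mul_le (t : ℝ) (i j x y : ℕ) (ω : Ω) :
    |walkReal nb T t i x ω * walkReal nb T t j y ω| ≤ 1 := by
  rw [abs_mul]
  exact mul_le_one₀ (abs_walkReal_le _ _ _ _) (abs_nonneg _) (abs_walkReal_le _ _ _ _)

lemma measurable_rAvg {m : MeasurableSpace Ω} {X : ℕ → Ω → ℝ} (hX : ∀ v, Measurable[m] (X v))
    (i : ℕ) : Measurable[m] fun ω => rAvg nb (fun v => X v ω) i :=
  Measurable.const_mul (Finset.measurable_sum _ fun v _ => hX v) _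

lemma abs_indicator_mul_le (A : Set Ω) {G : Ω → ℝ} {M : ℝ} (hM : ∀ ω, |G ω| ≤ M) (ω : Ω) :
    |A.indicator 1 ω * G ω| ≤ M := by
  by_cases hω : ω ∈ A
  · simpa [hω] using hM ω
  · simpa [hω] using (abs_nonneg _).trans (hM ω)

variable [MeasurableSpace Ω] {Pr : Measure Ω}

/-- The probability that two walks driven by the same clocks, started at `i` and `j` at time `t`,
are at `x` and `y` at time `0`. -/
def pairProb (Pr : Measure Ω) (nb : ℕ → Finset ℕ) (T : ℕ → Ω → Config ℝ) (x y : ℕ) (t : ℝ)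
    (i j : ℕ) : ℝ :=
  ∫ ω, walkReal nb T t i x ω * walkReal nb T t j y ω ∂Pr

lemma integral_rAvg {X : ℕ → Ω → ℝ} (hX : ∀ v, Integrable (X v) Pr) (i : ℕ) :
    ∫ ω, rAvg nb (fun v => X v ω) i ∂Pr = rAvg nb (fun v => ∫ ω, X v ω ∂Pr) i := by
  unfold rAvg
  rw [integral_const_mul, integral_finsetSum _ fun v _ => hX v]

variable [IsProbabilityMeasure Pr]

lemma integrable_walkReal_mul (hT : ∀ n, IsPoissonProcess Pr (T n)) (t : ℝ) (i j x y : ℕ) :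
    Integrable (fun ω => walkReal nb T t i x ω * walkReal nb T t j y ω) Pr :=
  Integrable.of_bound (((measurable_walkReal t i x).mono (past_le hT t) le_rfl).mul
    ((measurable_walkReal t j y).mono (past_le hT t) le_rfl)).aestronglyMeasurable 1
    (ae_of_all _ fun ω => (Real.norm_eq_abs _).trans_le (abs_walkReal_mul_le t i j x y ω))

lemma abs_pairProb_le (x y : ℕ) (t : ℝ) (i j : ℕ) : |pairProb Pr nb T x y t i j| ≤ 1 := by
  have := norm_integral_le_of_norm_le_const (μ := Pr)
    (ae_of_all _ fun ω =>
      (Real.norm_eq_abs _).trans_le (abs_walkReal_mul_le (nb := nb) (T := T) t i j x y ω))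
  simpa [pairProb] using this

/-- Adding an amount `G`, fixed by the past, if the next ring comes before time `t + h`. -/
lemma integral_add_indicator_ringing (hT : ∀ n, IsPoissonProcess Pr (T n))
    (hTindep : iIndepFun T Pr) (t : ℝ) {h : ℝ} (hh : 0 ≤ h) (n : ℕ) {X G : Ω → ℝ}
    (hX : Integrable X Pr) (hG : Measurable[past T t] G) {M : ℝ} (hM : ∀ ω, |G ω| ≤ M) :
    Integrable (fun ω => X ω + (ringing T t h n).indicator 1 ω * G ω) Pr ∧
      ∫ ω, (X ω + (ringing T t h n).indicator 1 ω * G ω) ∂Pr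
        = ∫ ω, X ω ∂Pr + (1 - Real.exp (-h)) * ∫ ω, G ω ∂Pr := by
  have hGi : Integrable G Pr := Integrable.of_bound
    (hG.mono (past_le hT t) le_rfl).aestronglyMeasurable M (ae_of_all _ hM)
  have h1 : Integrable (fun ω => (ringing T t h n).indicator 1 ω * G ω) Pr := by
    have h2 := hGi.indicator (measurableSet_ringing hT t h n)
    refine h2.congr (ae_of_all _ fun ω => ?_)
    by_cases hω : ω ∈ ringing T t h n <;> simp [hω]
  exact ⟨hX.add h1, by
    rw [integral_add hX h1, integral_indicator_ringing_mul hT hTindep t hh n hG]⟩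

/-- The forward equation up to second order in the time step: a clash has probability `O(h²)`, and
off it the walks perform the steps prescribed by the clocks. -/
lemma abs_pairProb_step_le (hT : ∀ n, IsPoissonProcess Pr (T n)) (hTindep : iIndepFun T Pr)
    (hnb : ∀ i, i ∉ nb i) (x y : ℕ) {t h : ℝ} (ht : 0 ≤ t) (hh : 0 ≤ h) (i j : ℕ) :
    |pairProb Pr nb T x y (t + h) i j - (pairProb Pr nb T x y t i j
      + (1 - Real.exp (-h)) * (2 * (rPair nb (pairProb Pr nb T x y t) i j
        - pairProb Pr nb T x y t i j)))| ≤ 10 * (3 + (nb i).card + (nb j).card) * h ^ 2 := by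
  -- the transition probabilities at time `t`, and their averages after a step
  let p (i : ℕ) (ω : Ω) : ℝ := walkReal nb T t i x ω
  let p' (j : ℕ) (ω : Ω) : ℝ := walkReal nb T t j y ω
  let R (i : ℕ) (ω : Ω) : ℝ := rAvg nb (fun v => p v ω) i
  let R' (j : ℕ) (ω : Ω) : ℝ := rAvg nb (fun v => p' v ω) j
  have hp (i : ℕ) : Measurable[past T t] (p i) := measurable_walkReal t i x
  have hp' (i : ℕ) : Measurable[past T t] (p' i) := measurable_walkReal t i y
  have hR (i : ℕ) : Measurable[past T t] (R i) := measurable_rAvg hp i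
  have hR' (i : ℕ) : Measurable[past T t] (R' i) := measurable_rAvg hp' i
  have bp (i : ℕ) (ω : Ω) : |p i ω| ≤ 1 := abs_walkReal_le t i x ω
  have bp' (i : ℕ) (ω : Ω) : |p' i ω| ≤ 1 := abs_walkReal_le t i y ω
  have bR (i : ℕ) (ω : Ω) : |R i ω| ≤ 1 := abs_rAvg_le zero_le_one (fun v => bp v ω) i
  have bR' (i : ℕ) (ω : Ω) : |R' i ω| ≤ 1 := abs_rAvg_le zero_le_one (fun v => bp' v ω) i
  have bmul {a b : ℝ} (ha : |a| ≤ 1) (hb : |b| ≤ 1) : |a * b| ≤ 1 := by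
    rw [abs_mul]
    exact mul_le_one₀ ha (abs_nonneg _) hb
  have bsub {a b : ℝ} (ha : |a| ≤ 1) (hb : |b| ≤ 1) : |a - b| ≤ 2 := by
    refine (abs_sub _ _).trans ?_
    linarith
  have hm {X : Ω → ℝ} (hX : Measurable[past T t] X) : Measurable X :=
    hX.mono (past_le hT t) le_rfl
  have hmul {X Y : Ω → ℝ} (hX : Measurable[past T t] X) (hY : Measurable[past T t] Y) :
      Measurable[past T t] fun ω => X ω * Y ω := hX.mul hY
  have hsub {X Y : Ω → ℝ} (hX : Measurable[past T t] X) (hY : Measurable[past T t] Y) :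
      Measurable[past T t] fun ω => X ω - Y ω := hX.sub hY
  have hint {X : Ω → ℝ} (hX : Measurable[past T t] X) (bX : ∀ ω, |X ω| ≤ 1) : Integrable X Pr :=
    Integrable.of_bound (hm hX).aestronglyMeasurable 1 (ae_of_all _ bX)
  have hind (n : ℕ) : Measurable ((ringing T t h n).indicator (1 : Ω → ℝ)) :=
    measurable_one.indicator (measurableSet_ringing hT t h n)
  have hXm : Measurable fun ω => walkReal nb T (t + h) i x ω * walkReal nb T (t + h) j y ω :=
    ((measurable_walkReal (t + h) i x).mono (past_le hT _) le_rfl).mul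
      ((measurable_walkReal (t + h) j y).mono (past_le hT _) le_rfl)
  have hXb (ω : Ω) : |walkReal nb T (t + h) i x ω * walkReal nb T (t + h) j y ω| ≤ 5 :=
    (abs_walkReal_mul_le _ _ _ _ _ ω).trans (by norm_num)
  have hLR (i j : ℕ) : ∫ ω, R i ω * p' j ω ∂Pr
      = rAvg nb (fun u => pairProb Pr nb T x y t u j) i := by
    simp only [R, rAvg_mul_const]
    exact integral_rAvg (fun v => integrable_walkReal_mul hT t v j x y) i
  have hc (i : ℕ) : (0 : ℝ) ≤ (nb i).card := Nat.cast_nonneg _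
  have hh2 : 0 ≤ h ^ 2 := sq_nonneg h
  rcases eq_or_ne i j with rfl | hij
  · -- both walks sit at the same site and move, independently, at its ring
    obtain ⟨hWi, hW⟩ := integral_add_indicator_ringing hT hTindep t hh i
      (hint (hmul (hp i) (hp' i)) fun ω => bmul (bp i ω) (bp' i ω))
      (hsub (hmul (hR i) (hR' i)) (hmul (hp i) (hp' i)))
      fun ω => bsub (bmul (bR i ω) (bR' i ω)) (bmul (bp i ω) (bp' i ω))
    have hRR : ∫ ω, (R i ω * R' i ω - p i ω * p' i ω) ∂Pr
        = 2 * (rPair nb (pairProb Pr nb T x y t) i i - pairProb Pr nb T x y t i i) := by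
      have h1 : ∫ ω, R i ω * R' i ω ∂Pr
          = rAvg nb (fun u => rAvg nb (fun v => pairProb Pr nb T x y t u v) i) i := by
        simp only [R, rAvg_mul_const]
        rw [integral_rAvg fun v => hint (hmul (hp v) (hR' i)) fun ω => bmul (bp v ω) (bR' i ω)]
        congr 1
        funext u
        simp only [R', mul_comm (p u _), rAvg_mul_const]
        rw [integral_rAvg fun v => hint (hmul (hp' v) (hp u)) fun ω => bmul (bp' v ω) (bp u ω)]
        congr 1
        funext v
        exact integral_congr_ae (ae_of_all _ fun ω => mul_comm _ _)
      rw [integral_sub (hint (hmul (hR i) (hR' i)) fun ω => bmul (bR i ω) (bR' i ω))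
        (hint (hmul (hp i) (hp' i)) fun ω => bmul (bp i ω) (bp' i ω)), h1, rPair, if_pos rfl]
      simp only [pairProb, p, p']
      ring
    have hclose := abs_integral_sub_le (Pr := Pr) (M := 5) (B := clash nb T t h i) hXm
      (Y := fun ω => p i ω * p' i ω + (ringing T t h i).indicator 1 ω
        * (R i ω * R' i ω - p i ω * p' i ω))
      ((hm (hmul (hp i) (hp' i))).add ((hind i).mul
        (hm (hsub (hmul (hR i) (hR' i)) (hmul (hp i) (hp' i)))))) hXb
      (fun ω => (abs_add_le _ _).trans (by
        have h1 := bmul (bp i ω) (bp' i ω)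
        have h2 := abs_indicator_mul_le (ringing T t h i)
          (fun ω => bsub (bmul (bR i ω) (bR' i ω)) (bmul (bp i ω) (bp' i ω))) ω
        linarith))
      (fun ω hω => by
        by_cases hr : ω ∈ ringing T t h i
        · rw [walkReal_of_mem_ringing ht hr hω, walkReal_of_mem_ringing ht hr hω,
            indicator_of_mem hr]
          simp only [R, R', p, p', Pi.one_apply]
          ring
        · rw [walkReal_of_notMem_ringing ht hh hr, walkReal_of_notMem_ringing ht hh hr,
            indicator_of_notMem hr]
          simp only [p, p']
          ring)
    have hcl := real_clash_le hT hTindep hnb t hh i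
    change |pairProb Pr nb T x y (t + h) i i - _| ≤ _ at hclose
    rw [hW, hRR] at hclose
    refine hclose.trans ?_
    nlinarith [hc i]
  · -- at distinct sites the walks move at the rings of their own clocks, one at a time
    obtain ⟨hWi, hW⟩ := integral_add_indicator_ringing hT hTindep t hh i
      (hint (hmul (hp i) (hp' j)) fun ω => bmul (bp i ω) (bp' j ω))
      (hmul (hsub (hR i) (hp i)) (hp' j)) (M := 2) fun ω => by
        rw [abs_mul]
        have h1 := bsub (bR i ω) (bp i ω)
        have h2 := bp' j ω
        nlinarith [abs_nonneg (R i ω - p i ω), abs_nonneg (p' j ω)]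
    obtain ⟨hWi', hW'⟩ := integral_add_indicator_ringing hT hTindep t hh j hWi
      (hmul (hp i) (hsub (hR' j) (hp' j))) (M := 2) fun ω => by
        rw [abs_mul]
        have h1 := bsub (bR' j ω) (bp' j ω)
        have h2 := bp i ω
        nlinarith [abs_nonneg (R' j ω - p' j ω), abs_nonneg (p i ω)]
    have hRR : ∫ ω, (R i ω - p i ω) * p' j ω ∂Pr + ∫ ω, p i ω * (R' j ω - p' j ω) ∂Pr
        = 2 * (rPair nb (pairProb Pr nb T x y t) i j - pairProb Pr nb T x y t i j) := by
      have h1 : ∫ ω, p i ω * R' j ω ∂Pr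
          = rAvg nb (fun v => pairProb Pr nb T x y t i v) j := by
        simp only [R', mul_comm (p i _), rAvg_mul_const]
        rw [integral_rAvg fun v => hint (hmul (hp' v) (hp i)) fun ω => bmul (bp' v ω) (bp i ω)]
        congr 1
        funext v
        exact integral_congr_ae (ae_of_all _ fun ω => mul_comm _ _)
      simp only [sub_mul, mul_sub]
      rw [integral_sub (hint (hmul (hR i) (hp' j)) fun ω => bmul (bR i ω) (bp' j ω))
        (hint (hmul (hp i) (hp' j)) fun ω => bmul (bp i ω) (bp' j ω)),
        integral_sub (hint (hmul (hp i) (hR' j)) fun ω => bmul (bp i ω) (bR' j ω))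
        (hint (hmul (hp i) (hp' j)) fun ω => bmul (bp i ω) (bp' j ω)), h1, hLR, rPair, if_neg hij]
      simp only [pairProb, p, p']
      ring
    have hclose := abs_integral_sub_le (Pr := Pr) (M := 5)
      (B := clash nb T t h i ∪ clash nb T t h j ∪ ringing T t h i ∩ ringing T t h j) hXm
      (Y := fun ω => p i ω * p' j ω + (ringing T t h i).indicator 1 ω * ((R i ω - p i ω) * p' j ω)
        + (ringing T t h j).indicator 1 ω * (p i ω * (R' j ω - p' j ω)))
      (((hm (hmul (hp i) (hp' j))).add ((hind i).mul (hm (hmul (hsub (hR i) (hp i)) (hp' j))))).add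
        ((hind j).mul (hm (hmul (hp i) (hsub (hR' j) (hp' j)))))) hXb
      (fun ω => (abs_add_le _ _).trans (by
        have h1 := bmul (bp i ω) (bp' j ω)
        have h2 := abs_indicator_mul_le (ringing T t h i) (M := 2)
          (G := fun ω => (R i ω - p i ω) * p' j ω) (fun ω => by
            rw [abs_mul]
            have h1 := bsub (bR i ω) (bp i ω)
            have h2 := bp' j ω
            nlinarith [abs_nonneg (R i ω - p i ω), abs_nonneg (p' j ω)]) ω
        have h3 := abs_indicator_mul_le (ringing T t h j) (M := 2)
          (G := fun ω => p i ω * (R' j ω - p' j ω)) (fun ω => by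
            rw [abs_mul]
            have h1 := bsub (bR' j ω) (bp' j ω)
            have h2 := bp i ω
            nlinarith [abs_nonneg (R' j ω - p' j ω), abs_nonneg (p i ω)]) ω
        have h4 := abs_add_le (p i ω * p' j ω)
          ((ringing T t h i).indicator 1 ω * ((R i ω - p i ω) * p' j ω))
        linarith))
      (fun ω hω => by
        simp only [mem_union, mem_inter_iff, not_or, not_and] at hω
        obtain ⟨⟨hω1, hω2⟩, hω3⟩ := hω
        by_cases hr : ω ∈ ringing T t h i
        · have hr' := hω3 hr
          rw [walkReal_of_mem_ringing ht hr hω1, walkReal_of_notMem_ringing ht hh hr',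
            indicator_of_mem hr, indicator_of_notMem hr']
          simp only [R, p, p', Pi.one_apply]
          ring
        · by_cases hr' : ω ∈ ringing T t h j
          · rw [walkReal_of_notMem_ringing ht hh hr, walkReal_of_mem_ringing ht hr' hω2,
              indicator_of_mem hr', indicator_of_notMem hr]
            simp only [R', p, p', Pi.one_apply]
            ring
          · rw [walkReal_of_notMem_ringing ht hh hr, walkReal_of_notMem_ringing ht hh hr',
              indicator_of_notMem hr, indicator_of_notMem hr']
            simp only [p, p']
            ring)
    have hcl := real_clash_le hT hTindep hnb t hh i
    have hcl' := real_clash_le hT hTindep hnb t hh j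
    have hrr := real_ringing_inter_le hT hTindep t hh hij
    have hun : Pr.real (clash nb T t h i ∪ clash nb T t h j ∪ ringing T t h i ∩ ringing T t h j)
        ≤ (3 + (nb i).card + (nb j).card) * h ^ 2 := by
      refine (measureReal_union_le _ _).trans ((add_le_add_left
        (measureReal_union_le _ _) _).trans ?_)
      linarith
    change |pairProb Pr nb T x y (t + h) i j - _| ≤ _ at hclose
    rw [hW', hW, add_assoc, ← mul_add, hRR] at hclose
    refine hclose.trans ?_
    linarith

end Duality

section Duality

lemma walkReal_zero {Ω : Type*} {T : ℕ → Ω → Config ℝ} {nb : ℕ → Finset ℕ} (i x : ℕ) (ω : Ω) :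
    walkReal nb T 0 i x ω = if i = x then 1 else 0 := by
  have h : (fun n => (T n ω : Set ℝ)) i ∩ Ioc 0 0 = ∅ := by simp
  unfold walkReal walkKernel
  rw [tsum_eq_single 0 fun k hk => ?_, walkProb_zero_of_empty (C := fun n => (T n ω : Set ℝ)) h]
  · split_ifs <;> simp
  · obtain ⟨k, rfl⟩ := Nat.exists_eq_succ_of_ne_zero hk
    exact walkProb_succ_of_empty (C := fun n => (T n ω : Set ℝ)) h

variable {Ω : Type*} [MeasurableSpace Ω] {Pr : Measure Ω} [IsProbabilityMeasure Pr]
  {T : ℕ → Ω → Config ℝ} {nb : ℕ → Finset ℕ}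

/-- The pair of walks at the same sites as the target pair. -/
def pairDelta (x y i j : ℕ) : ℝ≥0∞ := if i = x ∧ j = y then 1 else 0

lemma pairProb_zero (x y i j : ℕ) :
    pairProb Pr nb T x y 0 i j = (pairDelta x y i j).toReal := by
  simp only [pairProb, walkReal_zero, pairDelta]
  by_cases hi : i = x <;> by_cases hj : j = y <;> simp [hi, hj]

/-- The forward equation for two walks driven by the same clocks. -/
lemma hasDerivWithinAt_pairProb (hT : ∀ n, IsPoissonProcess Pr (T n)) (hTindep : iIndepFun T Pr)
    (hnb : ∀ i, i ∉ nb i) (x y : ℕ) {t : ℝ} (ht : 0 ≤ t) (i j : ℕ) :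
    HasDerivWithinAt (fun s => pairProb Pr nb T x y s i j)
      (2 * (rPair nb (pairProb Pr nb T x y t) i j - pairProb Pr nb T x y t i j)) (Ici t) t := by
  set D := 2 * (rPair nb (pairProb Pr nb T x y t) i j - pairProb Pr nb T x y t i j)
  let R (s : ℝ) : ℝ := pairProb Pr nb T x y s i j
    - (pairProb Pr nb T x y t i j + (1 - Real.exp (-(s - t))) * D)
  have hR : HasDerivWithinAt R 0 (Ici t) t := by
    have h1 : R =O[𝓝[Ici t] t] fun s => ‖s - t‖ ^ 2 := by
      refine Asymptotics.IsBigO.of_bound (10 * (3 + (nb i).card + (nb j).card))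
        (eventually_mem_nhdsWithin.mono fun s (hs : t ≤ s) => ?_)
      have h2 := abs_pairProb_step_le hT hTindep hnb x y ht (sub_nonneg.2 hs) i j
      rw [add_sub_cancel] at h2
      simpa [R] using h2
    simpa using (h1.hasFDerivWithinAt self_mem_Ici one_lt_two).hasDerivWithinAt
  have hE : HasDerivAt (fun s => pairProb Pr nb T x y t i j + (1 - Real.exp (-(s - t))) * D) D
      t := by
    have h1 : HasDerivAt (fun s : ℝ => -(s - t)) (-1) t :=
      ((hasDerivAt_id t).sub_const t).neg
    have h2 := ((h1.exp.const_sub 1).mul_const D).const_add (pairProb Pr nb T x y t i j)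
    simpa using h2
  have h3 := hR.add hE.hasDerivWithinAt
  rw [zero_add] at h3
  refine h3.congr (fun s _ => ?_) ?_ <;> simp [R]

/-- The forward equation gives right derivatives only; the continuity needed to integrate it follows
from the bound on the increments. -/
lemma continuousOn_pairProb (hT : ∀ n, IsPoissonProcess Pr (T n)) (hTindep : iIndepFun T Pr)
    (hnb : ∀ i, i ∉ nb i) (x y : ℕ) (b : ℝ) (i j : ℕ) :
    ContinuousOn (fun s => pairProb Pr nb T x y s i j) (Icc 0 b) := by
  rcases lt_or_ge b 0 with hb | hb
  · simp [Icc_eq_empty hb.not_ge]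
  let c : ℝ := 10 * (3 + (nb i).card + (nb j).card)
  have hc : 0 ≤ c := by positivity
  have key {s t : ℝ} (hs : 0 ≤ s) (hst : s ≤ t) (ht : t ≤ b) :
      |pairProb Pr nb T x y t i j - pairProb Pr nb T x y s i j| ≤ (4 + c * b) * (t - s) := by
    have h2 := abs_pairProb_step_le hT hTindep hnb x y hs (sub_nonneg.2 hst) i j
    rw [add_sub_cancel] at h2
    have hq : 1 - Real.exp (-(t - s)) ≤ t - s := by linarith [Real.add_one_le_exp (-(t - s))]
    have hq0 : 0 ≤ 1 - Real.exp (-(t - s)) := by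
      linarith [Real.exp_le_one_iff.2 (show -(t - s) ≤ 0 by linarith)]
    have hD : |2 * (rPair nb (pairProb Pr nb T x y s) i j - pairProb Pr nb T x y s i j)| ≤ 4 := by
      rw [abs_mul, abs_two]
      have := abs_sub (rPair nb (pairProb Pr nb T x y s) i j) (pairProb Pr nb T x y s i j)
      have h3 := abs_rPair_le (nb := nb) zero_le_one
        (abs_pairProb_le (Pr := Pr) (nb := nb) (T := T) x y s) i j
      have h4 := abs_pairProb_le (Pr := Pr) (nb := nb) (T := T) x y s i j
      linarith
    set D := 2 * (rPair nb (pairProb Pr nb T x y s) i j - pairProb Pr nb T x y s i j)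
    have h5 : |(1 - Real.exp (-(t - s))) * D| ≤ (t - s) * 4 := by
      rw [abs_mul, abs_of_nonneg hq0]
      exact mul_le_mul hq hD (abs_nonneg _) (by linarith)
    have h6 : c * (t - s) ^ 2 ≤ c * (b * (t - s)) := by
      rw [sq]
      gcongr
      linarith
    calc |pairProb Pr nb T x y t i j - pairProb Pr nb T x y s i j|
        = |(pairProb Pr nb T x y t i j - (pairProb Pr nb T x y s i j
            + (1 - Real.exp (-(t - s))) * D)) + (1 - Real.exp (-(t - s))) * D| := by
          congr 1
          ring
      _ ≤ c * (t - s) ^ 2 + (t - s) * 4 := (abs_add_le _ _).trans (add_le_add h2 h5)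
      _ ≤ (4 + c * b) * (t - s) := by linarith
  refine (LipschitzOnWith.of_dist_le_mul (K := (4 + c * b).toNNReal) ?_).continuousOn
  intro t ht s hs
  rw [Real.coe_toNNReal _ (by positivity), Real.dist_eq, Real.dist_eq]
  rcases le_total s t with h | h
  · rw [abs_of_nonneg (sub_nonneg.2 h)]
    exact key hs.1 h ht.2
  · rw [abs_sub_comm, abs_sub_comm t s, abs_of_nonneg (sub_nonneg.2 h)]
    exact key ht.1 h hs.2

/-- The Picard iterates of the forward equation, rescaled by `e^{2t}`, are the partial sums of an
exponential series. -/
lemma abs_pairProb_sub_sum_le (hT : ∀ n, IsPoissonProcess Pr (T n)) (hTindep : iIndepFun T Pr)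
    (hnb : ∀ i, i ∉ nb i) (x y : ℕ) {b : ℝ} (n : ℕ) {t : ℝ} (ht : t ∈ Icc 0 b) (i j : ℕ) :
    |Real.exp (2 * t) * pairProb Pr nb T x y t i j
      - ∑ k ∈ Finset.range n, (2 * t) ^ k / k.factorial
        * (rPair nb)^[k] (fun i j => (pairDelta x y i j).toReal) i j|
      ≤ Real.exp (2 * b) * ((2 * t) ^ n / n.factorial) := by
  induction n generalizing t i j with
  | zero =>
    have h1 := abs_pairProb_le (Pr := Pr) (nb := nb) (T := T) x y t i j
    have h2 : Real.exp (2 * t) ≤ Real.exp (2 * b) := Real.exp_le_exp.2 (by linarith [ht.2])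
    simp only [Finset.range_zero, Finset.sum_empty, sub_zero, pow_zero, Nat.factorial_zero,
      Nat.cast_one, div_one, mul_one, abs_mul, Real.abs_exp]
    nlinarith [Real.exp_pos (2 * t), abs_nonneg (pairProb Pr nb T x y t i j)]
  | succ n ih =>
    set δ : ℕ → ℕ → ℝ := fun i j => (pairDelta x y i j).toReal with hδ
    have hpow (k : ℕ) (s : ℝ) : HasDerivAt (fun s : ℝ => (2 * s) ^ (k + 1) / (k + 1).factorial)
        (2 * ((2 * s) ^ k / k.factorial)) s := by
      have h1 : HasDerivAt (fun s : ℝ => 2 * s) (2 * 1) s := (hasDerivAt_id s).const_mul 2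
      have h2 := (h1.pow (k + 1)).div_const ((k + 1).factorial : ℝ)
      refine h2.congr_deriv ?_
      rw [Nat.factorial_succ]
      push_cast
      field_simp
    have hd (s : ℝ) (hs : s ∈ Ico 0 b) : HasDerivWithinAt
        (fun s => Real.exp (2 * s) * pairProb Pr nb T x y s i j
          - ∑ k ∈ Finset.range (n + 1), (2 * s) ^ k / k.factorial * (rPair nb)^[k] δ i j)
        (2 * rPair nb (fun i j => Real.exp (2 * s) * pairProb Pr nb T x y s i j
          - ∑ k ∈ Finset.range n, (2 * s) ^ k / k.factorial * (rPair nb)^[k] δ i j) i j)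
        (Ici s) s := by
      have h1 : HasDerivAt (fun s : ℝ => 2 * s) (2 * 1) s := (hasDerivAt_id s).const_mul 2
      have h2 := h1.exp.hasDerivWithinAt.mul
        (hasDerivWithinAt_pairProb hT hTindep hnb x y hs.1 i j)
      have h3 : HasDerivAt (fun s : ℝ => ∑ k ∈ Finset.range (n + 1),
          (2 * s) ^ k / k.factorial * (rPair nb)^[k] δ i j)
          (∑ k ∈ Finset.range n, 2 * ((2 * s) ^ k / k.factorial) * (rPair nb)^[k + 1] δ i j) s := by
        simp only [Finset.sum_range_succ' _ n, pow_zero]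
        exact (HasDerivAt.fun_sum fun k _ =>
          (hpow k s).mul_const ((rPair nb)^[k + 1] δ i j)).add_const _
      refine (h2.sub h3.hasDerivWithinAt).congr_deriv ?_
      rw [rPair_sub, rPair_const_mul, rPair_sum]
      simp only [rPair_const_mul, Function.iterate_succ_apply', mul_sub, Finset.mul_sum]
      congr 1
      · ring
      · exact Finset.sum_congr rfl fun k _ => by ring
    have hcont : ContinuousOn
        (fun s => Real.exp (2 * s) * pairProb Pr nb T x y s i j
          - ∑ k ∈ Finset.range (n + 1), (2 * s) ^ k / k.factorial * (rPair nb)^[k] δ i j)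
        (Icc 0 b) := by
      refine ContinuousOn.sub (ContinuousOn.mul (by fun_prop)
        (continuousOn_pairProb hT hTindep hnb x y b i j)) ?_
      fun_prop
    refine image_norm_le_of_norm_deriv_right_le_deriv_boundary hcont hd
      (B := fun s => Real.exp (2 * b) * ((2 * s) ^ (n + 1) / (n + 1).factorial))
      (B' := fun s => Real.exp (2 * b) * (2 * ((2 * s) ^ n / n.factorial))) ?_
      (fun s => (hpow n s).const_mul _) (fun s hs => ?_) ht
    · rw [pairProb_zero, Finset.sum_range_succ']
      simp [hδ]
    · rw [Real.norm_eq_abs, abs_mul, abs_two, mul_left_comm]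
      have hs0 : 0 ≤ 2 * s := by linarith [hs.1]
      gcongr
      exact abs_rPair_le (by positivity) (fun i j => ih (Ico_subset_Icc_self hs) i j) i j

lemma tendsto_sum_pairProb (hT : ∀ n, IsPoissonProcess Pr (T n)) (hTindep : iIndepFun T Pr)
    (hnb : ∀ i, i ∉ nb i) (x y : ℕ) {t : ℝ} (ht : 0 ≤ t) (i j : ℕ) :
    Tendsto (fun n => ∑ k ∈ Finset.range n, Real.exp (-(2 * t)) * ((2 * t) ^ k / k.factorial)
      * (rPair nb)^[k] (fun i j => (pairDelta x y i j).toReal) i j) atTop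
      (𝓝 (pairProb Pr nb T x y t i j)) := by
  have h1 : Tendsto (fun n : ℕ => Real.exp (2 * t) * ((2 * t) ^ n / n.factorial)) atTop (𝓝 0) := by
    simpa using (FloorSemiring.tendsto_pow_div_factorial_atTop (2 * t)).const_mul (Real.exp (2 * t))
  have h2 := squeeze_zero_norm (fun n => (Real.norm_eq_abs _).trans_le
    (abs_pairProb_sub_sum_le hT hTindep hnb x y n (right_mem_Icc.2 ht) i j)) h1
  have h3 := ((tendsto_const_nhds (x := Real.exp (2 * t) * pairProb Pr nb T x y t i j)).sub
    h2).const_mul (Real.exp (-(2 * t)))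
  have hexp : Real.exp (-(2 * t)) * Real.exp (2 * t) = 1 := by
    rw [← Real.exp_add]
    simp
  simp only [sub_zero, sub_sub_cancel, ← mul_assoc, hexp, one_mul] at h3
  refine h3.congr fun n => ?_
  rw [Finset.mul_sum]
  exact Finset.sum_congr rfl fun k _ => by ring

/-- The weights of the Poisson distribution of mean `2t`: the number of steps of the uniformized
chain up to time `t`. -/
def stepWeight (t : ℝ) (k : ℕ) : ℝ≥0∞ :=
  ENNReal.ofReal (Real.exp (-(2 * t)) * ((2 * t) ^ k / k.factorial))

/-- **Duality.** The joint law of two walks driven by the same clocks, averaged over the clocks, is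
that of the two-walker chain after a Poisson number of steps. -/
theorem lintegral_walkKernel_mul (hT : ∀ n, IsPoissonProcess Pr (T n)) (hTindep : iIndepFun T Pr)
    (hnb : ∀ i, i ∉ nb i) {t : ℝ} (ht : 0 ≤ t) (x y i j : ℕ) :
    ∫⁻ ω, walkKernel (nbWeight nb) (fun n => (T n ω : Set ℝ)) t i x
        * walkKernel (nbWeight nb) (fun n => (T n ω : Set ℝ)) t j y ∂Pr
      = ∑' k, stepWeight t k * (pairStep (nbWeight nb))^[k] (pairDelta x y) i j := by
  have hδ (i j : ℕ) : pairDelta x y i j ≠ ∞ := by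
    unfold pairDelta
    split_ifs <;> simp
  have hle (i x : ℕ) (ω : Ω) :
      walkKernel (nbWeight nb) (fun n => (T n ω : Set ℝ)) t i x ≠ ∞ :=
    ((walkKernel_le_one t i x).trans_lt ENNReal.one_lt_top).ne
  have h1 : ∫⁻ ω, walkKernel (nbWeight nb) (fun n => (T n ω : Set ℝ)) t i x
        * walkKernel (nbWeight nb) (fun n => (T n ω : Set ℝ)) t j y ∂Pr
      = ENNReal.ofReal (pairProb Pr nb T x y t i j) := by
    unfold pairProb
    rw [ofReal_integral_eq_lintegral_ofReal (integrable_walkReal_mul hT t i j x y)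
      (ae_of_all _ fun ω => mul_nonneg (walkReal_nonneg _ _ _ _) (walkReal_nonneg _ _ _ _))]
    refine lintegral_congr fun ω => ?_
    unfold walkReal
    rw [← ENNReal.toReal_mul, ENNReal.ofReal_toReal (ENNReal.mul_ne_top (hle i x ω) (hle j y ω))]
  have hw (k : ℕ) : 0 ≤ Real.exp (-(2 * t)) * ((2 * t) ^ k / k.factorial) := by positivity
  have h2 (k : ℕ) : stepWeight t k * (pairStep (nbWeight nb))^[k] (pairDelta x y) i j
      = ENNReal.ofReal (Real.exp (-(2 * t)) * ((2 * t) ^ k / k.factorial)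
        * (rPair nb)^[k] (fun i j => (pairDelta x y i j).toReal) i j) := by
    rw [← toReal_pairStep_iterate hδ, ENNReal.ofReal_mul (hw k),
      ENNReal.ofReal_toReal (pairStep_iterate_ne_top hδ k i j), stepWeight]
  rw [h1]
  simp only [h2]
  refine tendsto_nhds_unique ?_ (ENNReal.tendsto_nat_tsum _)
  simp only [← fun n => ENNReal.ofReal_sum_of_nonneg (s := Finset.range n) fun k _ =>
    mul_nonneg (hw k) (by rw [← toReal_pairStep_iterate hδ]; exact ENNReal.toReal_nonneg :
      0 ≤ (rPair nb)^[k] (fun i j => (pairDelta x y i j).toReal) i j)]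
  exact ENNReal.tendsto_ofReal (tendsto_sum_pairProb hT hTindep hnb x y ht i j)

end Duality

/-! ### Differences of the means of two independent walks -/

section PairEnergy

variable {Γ : ℕ → ℕ → ℝ≥0∞} {g : ℕ → ℝ} {p q : ℕ → ℝ≥0∞}

lemma hasSum_of_eq {f f' : ℕ → ℝ} {c c' : ℝ} (h : HasSum f c) (hf : ∀ x, f' x = f x)
    (hc : c' = c) : HasSum f' c' := by
  rwa [hc, funext hf]

/-- The mean of `Γ` over two independent points with laws `p` and `q`. -/
def pairEnergy (Γ : ℕ → ℕ → ℝ≥0∞) (p q : ℕ → ℝ≥0∞) : ℝ≥0∞ := ∑' x, ∑' y, p x * q y * Γ x y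

/-- The mean of `g ^ n` under the weights `p`. -/
def powMean (g : ℕ → ℝ) (n : ℕ) (p : ℕ → ℝ≥0∞) : ℝ := ∑' x, (p x).toReal * g x ^ n

lemma ne_top_of_pairEnergy_ne_top (h : pairEnergy Γ p q ≠ ∞) {x y : ℕ} (hx : p x ≠ 0)
    (hy : q y ≠ 0) : Γ x y ≠ ∞ := by
  intro hΓ
  refine h (top_unique ?_)
  calc ∞ = p x * q y * Γ x y := by rw [hΓ, ENNReal.mul_top (mul_ne_zero hx hy)]
    _ ≤ ∑' y, p x * q y * Γ x y := ENNReal.le_tsum y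
    _ ≤ pairEnergy Γ p q := ENNReal.le_tsum (f := fun x => ∑' y, p x * q y * Γ x y) x

lemma hasSum_toReal_of_tsum_eq_one (hp : ∑' x, p x = 1) : HasSum (fun x => (p x).toReal) 1 := by
  have h : ∑' x, p x ≠ ∞ := hp ▸ ENNReal.one_ne_top
  have := (ENNReal.summable_toReal h).hasSum
  rwa [← ENNReal.tsum_toReal_eq (fun x => ENNReal.ne_top_of_tsum_ne_top h x), hp,
    ENNReal.toReal_one] at this

/-- If the differences of `g` at two independent points with law `p` are square integrable, so is
`g` itself. -/
lemma summable_of_pairEnergy_ne_top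
    (hΓ : ∀ x y, Γ x y ≠ ∞ → Γ x y = ENNReal.ofReal ((g y - g x) ^ 2))
    (hp : ∑' x, p x = 1) (h : pairEnergy Γ p p ≠ ∞) :
    Summable (fun x => (p x).toReal * g x) ∧ Summable (fun x => (p x).toReal * g x ^ 2) := by
  have hptop (x : ℕ) : p x ≠ ∞ := ENNReal.ne_top_of_tsum_ne_top (hp ▸ ENNReal.one_ne_top) x
  have hs := (hasSum_toReal_of_tsum_eq_one hp).summable
  -- the differences with an atom `z` of `p` are square integrable, by Tonelli
  obtain ⟨z, hz⟩ : ∃ z, p z ≠ 0 := by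
    by_contra! h0
    simp [h0] at hp
  have h1 : ∑' y, p z * p y * Γ z y ≠ ∞ :=
    ENNReal.ne_top_of_tsum_ne_top (f := fun x => ∑' y, p x * p y * Γ x y) h z
  simp only [mul_assoc, ENNReal.tsum_mul_left] at h1
  have h2 : ∑' y, p y * Γ z y ≠ ∞ := fun h' => h1 (by rw [h', ENNReal.mul_top hz])
  have h3 : Summable fun y => (p y).toReal * (g y - g z) ^ 2 := by
    refine (ENNReal.summable_toReal h2).congr fun y => ?_
    rcases eq_or_ne (p y) 0 with hy | hy
    · simp [hy]
    · rw [ENNReal.toReal_mul, hΓ z y (ne_top_of_pairEnergy_ne_top h hz hy),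
        ENNReal.toReal_ofReal (sq_nonneg _)]
  have h4 : Summable fun y => (p y).toReal * (g y - g z) := by
    refine Summable.of_norm_bounded (hs.add h3) fun y => ?_
    have h0 : 0 ≤ (p y).toReal := ENNReal.toReal_nonneg
    rw [Real.norm_eq_abs, abs_mul, abs_of_nonneg h0]
    nlinarith [sq_nonneg (|g y - g z| - 1), sq_abs (g y - g z)]
  have h5 : Summable fun y => (p y).toReal * g y :=
    (h4.add (hs.mul_right (g z))).congr fun y => by ring
  refine ⟨h5, ?_⟩
  exact ((h3.add (h5.mul_right (2 * g z))).sub (hs.mul_right (g z ^ 2))).congr fun y => by ring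

lemma pairEnergy_eq (hΓ : ∀ x y, Γ x y ≠ ∞ → Γ x y = ENNReal.ofReal ((g y - g x) ^ 2))
    (hp : ∑' x, p x = 1) (hq : ∑' x, q x = 1) (hpp : pairEnergy Γ p p ≠ ∞)
    (hqq : pairEnergy Γ q q ≠ ∞) (hpq : pairEnergy Γ p q ≠ ∞) :
    pairEnergy Γ p q = ENNReal.ofReal
      (powMean g 2 p + powMean g 2 q - 2 * (powMean g 1 p * powMean g 1 q)) := by
  have hptop (x : ℕ) : p x ≠ ∞ := ENNReal.ne_top_of_tsum_ne_top (hp ▸ ENNReal.one_ne_top) x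
  have hqtop (x : ℕ) : q x ≠ ∞ := ENNReal.ne_top_of_tsum_ne_top (hq ▸ ENNReal.one_ne_top) x
  obtain ⟨hp1, hp2⟩ := summable_of_pairEnergy_ne_top hΓ hp hpp
  obtain ⟨hq1, hq2⟩ := summable_of_pairEnergy_ne_top hΓ hq hqq
  have hp0 := hasSum_toReal_of_tsum_eq_one hp
  have hq0 := hasSum_toReal_of_tsum_eq_one hq
  have hP1 : HasSum (fun x => (p x).toReal * g x) (powMean g 1 p) := by
    simpa [powMean] using hp1.hasSum
  have hQ1 : HasSum (fun x => (q x).toReal * g x) (powMean g 1 q) := by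
    simpa [powMean] using hq1.hasSum
  have hP2 : HasSum (fun x => (p x).toReal * g x ^ 2) (powMean g 2 p) := hp2.hasSum
  have hQ2 : HasSum (fun x => (q x).toReal * g x ^ 2) (powMean g 2 q) := hq2.hasSum
  have hinner (x : ℕ) : HasSum (fun y => (p x).toReal * (q y).toReal * (g y - g x) ^ 2)
      ((p x).toReal * (powMean g 2 q - 2 * g x * powMean g 1 q + g x ^ 2 * 1)) := by
    exact hasSum_of_eq (((hQ2.sub (hQ1.mul_left (2 * g x))).add
      (hq0.mul_left (g x ^ 2))).mul_left (p x).toReal) (fun y => by ring) rfl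
  have houter : HasSum
      (fun x => (p x).toReal * (powMean g 2 q - 2 * g x * powMean g 1 q + g x ^ 2 * 1))
      (powMean g 2 p + powMean g 2 q - 2 * (powMean g 1 p * powMean g 1 q)) := by
    exact hasSum_of_eq ((hP2.add (hp0.mul_left (powMean g 2 q))).sub
      (hP1.mul_left (2 * powMean g 1 q))) (fun x => by ring) (by ring)
  have hnn (x y : ℕ) : 0 ≤ (p x).toReal * (q y).toReal * (g y - g x) ^ 2 := by positivity
  have hterm (x y : ℕ) : p x * q y * Γ x y
      = ENNReal.ofReal ((p x).toReal * (q y).toReal * (g y - g x) ^ 2) := by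
    rcases eq_or_ne (p x) 0 with hx | hx
    · simp [hx]
    rcases eq_or_ne (q y) 0 with hy | hy
    · simp [hy]
    rw [hΓ x y (ne_top_of_pairEnergy_ne_top hpq hx hy), ENNReal.ofReal_mul (by positivity),
      ← ENNReal.toReal_mul, ENNReal.ofReal_toReal (ENNReal.mul_ne_top (hptop x) (hqtop y))]
  have hnn' (x : ℕ) :
      0 ≤ (p x).toReal * (powMean g 2 q - 2 * g x * powMean g 1 q + g x ^ 2 * 1) :=
    (hinner x).nonneg fun y => hnn x y
  unfold pairEnergy
  simp only [hterm]
  rw [← houter.tsum_eq, ENNReal.ofReal_tsum_of_nonneg hnn' houter.summable]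
  refine tsum_congr fun x => ?_
  rw [← (hinner x).tsum_eq, ENNReal.ofReal_tsum_of_nonneg (hnn x) (hinner x).summable]

lemma powMean_sq_le (hΓ : ∀ x y, Γ x y ≠ ∞ → Γ x y = ENNReal.ofReal ((g y - g x) ^ 2))
    (hp : ∑' x, p x = 1) (hpp : pairEnergy Γ p p ≠ ∞) : powMean g 1 p ^ 2 ≤ powMean g 2 p := by
  obtain ⟨hp1, hp2⟩ := summable_of_pairEnergy_ne_top hΓ hp hpp
  have hP1 : HasSum (fun x => (p x).toReal * g x) (powMean g 1 p) := by
    simpa [powMean] using hp1.hasSum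
  have hP2 : HasSum (fun x => (p x).toReal * g x ^ 2) (powMean g 2 p) := hp2.hasSum
  have h : HasSum (fun x => (p x).toReal * (g x - powMean g 1 p) ^ 2)
      (powMean g 2 p - powMean g 1 p ^ 2) := by
    exact hasSum_of_eq ((hP2.sub (hP1.mul_left (2 * powMean g 1 p))).add
      ((hasSum_toReal_of_tsum_eq_one hp).mul_left (powMean g 1 p ^ 2))) (fun x => by ring) (by ring)
  linarith [h.nonneg fun x => by positivity]

/-- The mean squared difference of two independent samples splits into the squared difference of
the means and the two variances. -/
lemma ofReal_sq_add_pairEnergy (hΓ : ∀ x y, Γ x y ≠ ∞ → Γ x y = ENNReal.ofReal ((g y - g x) ^ 2))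
    (hp : ∑' x, p x = 1) (hq : ∑' x, q x = 1) (hpp : pairEnergy Γ p p ≠ ∞)
    (hqq : pairEnergy Γ q q ≠ ∞) (hpq : pairEnergy Γ p q ≠ ∞) :
    ENNReal.ofReal ((powMean g 1 q - powMean g 1 p) ^ 2)
      + (2⁻¹ * pairEnergy Γ p p + 2⁻¹ * pairEnergy Γ q q) = pairEnergy Γ p q := by
  have h1 := powMean_sq_le hΓ hp hpp
  have h2 := powMean_sq_le hΓ hq hqq
  have h2inv : (2 : ℝ≥0∞)⁻¹ = ENNReal.ofReal 2⁻¹ := by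
    rw [ENNReal.ofReal_inv_of_pos two_pos, ENNReal.ofReal_ofNat]
  rw [pairEnergy_eq hΓ hp hq hpp hqq hpq, pairEnergy_eq hΓ hp hp hpp hpp hpp,
    pairEnergy_eq hΓ hq hq hqq hqq hqq, h2inv, ← ENNReal.ofReal_mul (by norm_num),
    ← ENNReal.ofReal_mul (by norm_num), ← ENNReal.ofReal_add (by nlinarith) (by nlinarith),
    ← ENNReal.ofReal_add (by positivity) (by nlinarith)]
  congr 1
  ring

/-- The analogue of the variance decomposition for the average, over the members `j` of a finite
set, of the difference between the mean at `j` and the mean at a root `o`. -/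
lemma ofReal_sum_sq_add_pairEnergy {P : ℕ → ℕ → ℝ≥0∞} {o : ℕ} {N : Finset ℕ} (hN : N.Nonempty)
    (hΓ : ∀ x y, Γ x y ≠ ∞ → Γ x y = ENNReal.ofReal ((g y - g x) ^ 2))
    (hP : ∀ j ∈ insert o N, ∑' x, P j x = 1)
    (hfin : ∀ j ∈ insert o N, ∀ k ∈ insert o N, pairEnergy Γ (P j) (P k) ≠ ∞) :
    2 * ENNReal.ofReal ((N.card : ℝ)⁻¹ * (∑ j ∈ N, (powMean g 1 (P j) - powMean g 1 (P o))) ^ 2)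
      + ((N.card : ℝ≥0∞)⁻¹ * ∑ j ∈ N, ∑ k ∈ N, pairEnergy Γ (P j) (P k)
        + N.card * pairEnergy Γ (P o) (P o))
      = 2 * ∑ j ∈ N, pairEnergy Γ (P o) (P j) := by
  have ho : o ∈ insert o N := Finset.mem_insert_self _ _
  have hj {j : ℕ} (hj : j ∈ N) : j ∈ insert o N := Finset.mem_insert_of_mem hj
  have heq {j k : ℕ} (hj : j ∈ insert o N) (hk : k ∈ insert o N) :=
    pairEnergy_eq hΓ (hP j hj) (hP k hk) (hfin j hj j hj) (hfin k hk k hk) (hfin j hj k hk)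
  have hnn {j k : ℕ} (hj : j ∈ insert o N) (hk : k ∈ insert o N) :
      0 ≤ powMean g 2 (P j) + powMean g 2 (P k)
        - 2 * (powMean g 1 (P j) * powMean g 1 (P k)) := by
    nlinarith [powMean_sq_le hΓ (hP j hj) (hfin j hj j hj),
      powMean_sq_le hΓ (hP k hk) (hfin k hk k hk),
      sq_nonneg (powMean g 1 (P j) - powMean g 1 (P k))]
  have hc : (0 : ℝ) < N.card := by exact_mod_cast hN.card_pos
  have hcE : (N.card : ℝ≥0∞) = ENNReal.ofReal N.card := (ENNReal.ofReal_natCast _).symm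
  have h2E : (2 : ℝ≥0∞) = ENNReal.ofReal 2 := (ENNReal.ofReal_ofNat 2).symm
  have hD : 0 ≤ (N.card : ℝ)⁻¹ * (∑ j ∈ N, (powMean g 1 (P j) - powMean g 1 (P o))) ^ 2 := by
    positivity
  have hs1 : ∑ j ∈ N, ∑ k ∈ N, pairEnergy Γ (P j) (P k) = ENNReal.ofReal (∑ j ∈ N, ∑ k ∈ N,
      (powMean g 2 (P j) + powMean g 2 (P k) - 2 * (powMean g 1 (P j) * powMean g 1 (P k)))) := by
    rw [ENNReal.ofReal_sum_of_nonneg fun j hj' => Finset.sum_nonneg fun k hk' =>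
      hnn (hj hj') (hj hk')]
    refine Finset.sum_congr rfl fun j hj' => ?_
    rw [ENNReal.ofReal_sum_of_nonneg fun k hk' => hnn (hj hj') (hj hk')]
    exact Finset.sum_congr rfl fun k hk' => heq (hj hj') (hj hk')
  have hs2 : ∑ j ∈ N, pairEnergy Γ (P o) (P j) = ENNReal.ofReal (∑ j ∈ N,
      (powMean g 2 (P o) + powMean g 2 (P j) - 2 * (powMean g 1 (P o) * powMean g 1 (P j)))) := by
    rw [ENNReal.ofReal_sum_of_nonneg fun j hj' => hnn ho (hj hj')]
    exact Finset.sum_congr rfl fun j hj' => heq ho (hj hj')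
  have hn1 : 0 ≤ ∑ j ∈ N, ∑ k ∈ N,
      (powMean g 2 (P j) + powMean g 2 (P k) - 2 * (powMean g 1 (P j) * powMean g 1 (P k))) :=
    Finset.sum_nonneg fun j hj' => Finset.sum_nonneg fun k hk' => hnn (hj hj') (hj hk')
  have hn0 := hnn ho ho
  rw [hs1, hs2, heq ho ho, hcE, h2E, ← ENNReal.ofReal_inv_of_pos hc,
    ← ENNReal.ofReal_mul zero_le_two, ← ENNReal.ofReal_mul (inv_nonneg.2 hc.le),
    ← ENNReal.ofReal_mul hc.le, ← ENNReal.ofReal_mul zero_le_two,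
    ← ENNReal.ofReal_add (mul_nonneg (inv_nonneg.2 hc.le) hn1) (mul_nonneg hc.le hn0),
    ← ENNReal.ofReal_add (mul_nonneg zero_le_two hD)
      (add_nonneg (mul_nonneg (inv_nonneg.2 hc.le) hn1) (mul_nonneg hc.le hn0))]
  congr 1
  simp only [Finset.sum_sub_distrib, Finset.sum_add_distrib, Finset.sum_const, nsmul_eq_mul,
    ← Finset.mul_sum, ← Finset.sum_mul]
  field_simp
  ring

end PairEnergy

/-! ### Differences of the heights seen by the backward walks -/

section WalkMoments

variable {Ω : Type*} [MeasurableSpace Ω] {Pr : Measure Ω}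
  {T : ℕ → Ω → Config ℝ} {nb : ℕ → Finset ℕ} {Γ : ℕ → ℕ → ℝ≥0∞} {g : ℕ → ℝ}

/-- The law at time `0` of the walk started at `i` at time `t`. -/
def walkLaw (nb : ℕ → Finset ℕ) (T : ℕ → Ω → Config ℝ) (t : ℝ) (ω : Ω) (i x : ℕ) : ℝ≥0∞ :=
  walkKernel (nbWeight nb) (fun n => (T n ω : Set ℝ)) t i x

/-- The semigroup, at time `t`, of the two-walker chain in continuous time, with jumps at rate
two. -/
def pairSemigroup {V : Type*} (a : V → V → ℝ≥0∞) (t : ℝ) (F : V → V → ℝ≥0∞) (s s' : V) : ℝ≥0∞ :=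
  ∑' k, stepWeight t k * (pairStep a)^[k] F s s'

lemma tsum_stepWeight {t : ℝ} (ht : 0 ≤ t) : ∑' k, stepWeight t k = 1 := by
  have h0 (k : ℕ) : 0 ≤ Real.exp (-(2 * t)) * ((2 * t) ^ k / k.factorial) := by positivity
  have h1 : HasSum (fun k : ℕ => (2 * t) ^ k / k.factorial) (Real.exp (2 * t)) := by
    rw [Real.exp_eq_exp_ℝ]
    exact NormedSpace.expSeries_div_hasSum_exp (2 * t)
  have h2 := h1.mul_left (Real.exp (-(2 * t)))
  rw [← Real.exp_add, neg_add_cancel, Real.exp_zero] at h2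
  unfold stepWeight
  rw [← ENNReal.ofReal_tsum_of_nonneg h0 h2.summable, h2.tsum_eq, ENNReal.ofReal_one]

lemma measurable_walkLaw (hT : ∀ n, IsPoissonProcess Pr (T n)) (t : ℝ) (i x : ℕ) :
    Measurable fun ω => walkLaw nb T t ω i x :=
  (measurable_past_walkKernel T _ i x).mono (past_le hT t) le_rfl

lemma measurable_pairEnergy_walkLaw (hT : ∀ n, IsPoissonProcess Pr (T n)) (Γ : ℕ → ℕ → ℝ≥0∞)
    (t : ℝ) (i j : ℕ) :
    Measurable fun ω => pairEnergy Γ (walkLaw nb T t ω i) (walkLaw nb T t ω j) :=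
  Measurable.tsum fun x => Measurable.tsum fun y =>
    ((measurable_walkLaw hT t i x).mul (measurable_walkLaw hT t j y)).mul_const _

variable [IsProbabilityMeasure Pr]

/-- Duality, tested against a function of the two positions. -/
lemma lintegral_pairEnergy_walkLaw (hT : ∀ n, IsPoissonProcess Pr (T n)) (hTindep : iIndepFun T Pr)
    (hnb : ∀ i, i ∉ nb i) {t : ℝ} (ht : 0 ≤ t) (Γ : ℕ → ℕ → ℝ≥0∞) (i j : ℕ) :
    ∫⁻ ω, pairEnergy Γ (walkLaw nb T t ω i) (walkLaw nb T t ω j) ∂Pr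
      = pairSemigroup (nbWeight nb) t Γ i j := by
  have hm (x y : ℕ) : Measurable fun ω => walkLaw nb T t ω i x * walkLaw nb T t ω j y :=
    (measurable_walkLaw hT t i x).mul (measurable_walkLaw hT t j y)
  have hδ (i j : ℕ) : ∑' z : ℕ × ℕ, Γ z.1 z.2 * pairDelta z.1 z.2 i j = Γ i j := by
    rw [tsum_eq_single (i, j) fun z hz => ?_]
    · simp [pairDelta]
    · have : ¬ (i = z.1 ∧ j = z.2) := fun h => hz (Prod.ext h.1.symm h.2.symm)
      simp [pairDelta, this]
  have h1 (k : ℕ) : (pairStep (nbWeight nb))^[k] Γ i j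
      = ∑' z : ℕ × ℕ, Γ z.1 z.2 * (pairStep (nbWeight nb))^[k] (pairDelta z.1 z.2) i j := by
    rw [← pairStep_iterate_tsum, funext₂ hδ]
  unfold pairEnergy pairSemigroup
  rw [lintegral_tsum fun x => (Measurable.tsum fun y => (hm x y).mul_const _).aemeasurable]
  simp only [h1]
  calc ∑' x, ∫⁻ ω, ∑' y, walkLaw nb T t ω i x * walkLaw nb T t ω j y * Γ x y ∂Pr
      = ∑' x, ∑' y, (∑' k, stepWeight t k * (pairStep (nbWeight nb))^[k] (pairDelta x y) i j)
          * Γ x y := by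
        refine tsum_congr fun x => ?_
        rw [lintegral_tsum fun y => ((hm x y).mul_const _).aemeasurable]
        refine tsum_congr fun y => ?_
        rw [lintegral_mul_const _ (hm x y)]
        exact congrArg (· * Γ x y) (lintegral_walkKernel_mul hT hTindep hnb ht x y i j)
    _ = ∑' z : ℕ × ℕ, ∑' k, stepWeight t k
          * (Γ z.1 z.2 * (pairStep (nbWeight nb))^[k] (pairDelta z.1 z.2) i j) := by
        rw [ENNReal.tsum_prod']
        refine tsum_congr fun x => tsum_congr fun y => ?_
        rw [← ENNReal.tsum_mul_right]
        exact tsum_congr fun k => by ring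
    _ = _ := by
        rw [ENNReal.tsum_comm]
        simp only [ENNReal.tsum_mul_left]

/-- Away from isolated points the backward walk loses no mass: its total mass is at most one, and by
duality the square of the total mass has mean one. -/
lemma ae_tsum_walkLaw (hT : ∀ n, IsPoissonProcess Pr (T n)) (hTindep : iIndepFun T Pr)
    (hnb : ∀ i, i ∉ nb i) (hsymm : ∀ i j, j ∈ nb i ↔ i ∈ nb j) {t : ℝ} (ht : 0 ≤ t) {i : ℕ}
    (hi : (nb i).Nonempty) : ∀ᵐ ω ∂Pr, ∑' x, walkLaw nb T t ω i x = 1 := by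
  have hd : deg (nbWeight nb) i ≠ 0 := by
    rw [deg_nbWeight]
    exact_mod_cast hi.card_pos.ne'
  have h1 : ∫⁻ ω, (∑' x, walkLaw nb T t ω i x) * (∑' y, walkLaw nb T t ω i y) ∂Pr = 1 := by
    have h2 := lintegral_pairEnergy_walkLaw hT hTindep hnb ht (fun _ _ => 1) i i
    have h3 (k : ℕ) : (pairStep (nbWeight nb))^[k] (fun _ _ => 1) i i = 1 :=
      pairStep_iterate_one (a := nbWeight nb) (fun i j => if_congr (hsymm i j) rfl rfl)
        (fun i => by simp [deg_nbWeight]) k hd hd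
    simp only [pairSemigroup, h3, mul_one, tsum_stepWeight ht] at h2
    rw [← h2]
    simp only [pairEnergy, mul_one, ENNReal.tsum_mul_left, ENNReal.tsum_mul_right]
  have hm : Measurable fun ω => ∑' x, walkLaw nb T t ω i x :=
    Measurable.tsum fun x => measurable_walkLaw hT t i x
  have hle (ω : Ω) : ∑' x, walkLaw nb T t ω i x ≤ 1 := tsum_walkKernel_le_one t i
  have h4 : ∀ᵐ ω ∂Pr, (∑' x, walkLaw nb T t ω i x) * (∑' y, walkLaw nb T t ω i y) = 1 := by
    refine ae_eq_of_ae_le_of_lintegral_le (ae_of_all _ fun ω => mul_le_one' (hle ω) (hle ω))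
      (by simp [h1]) aemeasurable_const (by simp [h1])
  filter_upwards [h4] with ω hω
  refine le_antisymm (hle ω) ?_
  rw [← hω]
  exact mul_le_of_le_one_right' (hle ω)

lemma ae_pairEnergy_ne_top (hT : ∀ n, IsPoissonProcess Pr (T n)) (hTindep : iIndepFun T Pr)
    (hnb : ∀ i, i ∉ nb i) {t : ℝ} (ht : 0 ≤ t) {i j : ℕ}
    (h : pairSemigroup (nbWeight nb) t Γ i j ≠ ∞) :
    ∀ᵐ ω ∂Pr, pairEnergy Γ (walkLaw nb T t ω i) (walkLaw nb T t ω j) ≠ ∞ := by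
  refine (ae_lt_top (measurable_pairEnergy_walkLaw hT Γ t i j) ?_).mono fun ω hω => hω.ne
  rwa [lintegral_pairEnergy_walkLaw hT hTindep hnb ht]

/-- The sum defining the harness process converges absolutely at `i`. -/
lemma ae_summable_walkLaw (hT : ∀ n, IsPoissonProcess Pr (T n)) (hTindep : iIndepFun T Pr)
    (hnb : ∀ i, i ∉ nb i) (hsymm : ∀ i j, j ∈ nb i ↔ i ∈ nb j) {t : ℝ} (ht : 0 ≤ t)
    (hΓ : ∀ x y, Γ x y ≠ ∞ → Γ x y = ENNReal.ofReal ((g y - g x) ^ 2)) {i : ℕ}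
    (hi : (nb i).Nonempty) (h : pairSemigroup (nbWeight nb) t Γ i i ≠ ∞) :
    ∀ᵐ ω ∂Pr, Summable fun x => (walkLaw nb T t ω i x).toReal * g x := by
  filter_upwards [ae_tsum_walkLaw hT hTindep hnb hsymm ht hi,
    ae_pairEnergy_ne_top hT hTindep hnb ht h] with ω h1 h2
  exact (summable_of_pairEnergy_ne_top hΓ h1 h2).1

/-- The mean squared difference of the heights at two neighbors, in terms of the chain. -/
lemma lintegral_sq_add_pairSemigroup (hT : ∀ n, IsPoissonProcess Pr (T n))
    (hTindep : iIndepFun T Pr) (hnb : ∀ i, i ∉ nb i) (hsymm : ∀ i j, j ∈ nb i ↔ i ∈ nb j) {t : ℝ}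
    (ht : 0 ≤ t) (hΓ : ∀ x y, Γ x y ≠ ∞ → Γ x y = ENNReal.ofReal ((g y - g x) ^ 2)) {i j : ℕ}
    (hi : (nb i).Nonempty) (hj : (nb j).Nonempty)
    (hii : pairSemigroup (nbWeight nb) t Γ i i ≠ ∞) (hjj : pairSemigroup (nbWeight nb) t Γ j j ≠ ∞)
    (hij : pairSemigroup (nbWeight nb) t Γ i j ≠ ∞) :
    ∫⁻ ω, ENNReal.ofReal ((powMean g 1 (walkLaw nb T t ω j)
        - powMean g 1 (walkLaw nb T t ω i)) ^ 2) ∂Pr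
      + (2⁻¹ * pairSemigroup (nbWeight nb) t Γ i i + 2⁻¹ * pairSemigroup (nbWeight nb) t Γ j j)
      = pairSemigroup (nbWeight nb) t Γ i j := by
  have hm := fun i j => measurable_pairEnergy_walkLaw (nb := nb) hT Γ t i j
  have hsum : Measurable fun ω =>
      2⁻¹ * pairEnergy Γ (walkLaw nb T t ω i) (walkLaw nb T t ω i)
        + 2⁻¹ * pairEnergy Γ (walkLaw nb T t ω j) (walkLaw nb T t ω j) :=
    ((hm i i).const_mul _).add ((hm j j).const_mul _)
  rw [← lintegral_pairEnergy_walkLaw hT hTindep hnb ht Γ i i,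
    ← lintegral_pairEnergy_walkLaw hT hTindep hnb ht Γ j j,
    ← lintegral_pairEnergy_walkLaw hT hTindep hnb ht Γ i j,
    ← lintegral_const_mul _ (hm i i), ← lintegral_const_mul _ (hm j j),
    ← lintegral_add_left ((hm i i).const_mul _),
    ← lintegral_add_right _ hsum]
  refine lintegral_congr_ae ?_
  filter_upwards [ae_tsum_walkLaw hT hTindep hnb hsymm ht hi,
    ae_tsum_walkLaw hT hTindep hnb hsymm ht hj, ae_pairEnergy_ne_top hT hTindep hnb ht hii,
    ae_pairEnergy_ne_top hT hTindep hnb ht hjj,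
    ae_pairEnergy_ne_top hT hTindep hnb ht hij] with ω h1 h2 h3 h4 h5
  exact ofReal_sq_add_pairEnergy hΓ h1 h2 h3 h4 h5

/-- The mean dissipation at `o`, in terms of the chain. -/
lemma lintegral_dissipation_add_pairSemigroup (hT : ∀ n, IsPoissonProcess Pr (T n))
    (hTindep : iIndepFun T Pr) (hnb : ∀ i, i ∉ nb i) (hsymm : ∀ i j, j ∈ nb i ↔ i ∈ nb j) {t : ℝ}
    (ht : 0 ≤ t) (hΓ : ∀ x y, Γ x y ≠ ∞ → Γ x y = ENNReal.ofReal ((g y - g x) ^ 2)) {o : ℕ}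
    (ho : (nb o).Nonempty)
    (hfin : ∀ j ∈ insert o (nb o), ∀ k ∈ insert o (nb o),
      pairSemigroup (nbWeight nb) t Γ j k ≠ ∞) :
    2 * ∫⁻ ω, ENNReal.ofReal (((nb o).card : ℝ)⁻¹ * (∑ j ∈ nb o,
        (powMean g 1 (walkLaw nb T t ω j) - powMean g 1 (walkLaw nb T t ω o))) ^ 2) ∂Pr
      + (((nb o).card : ℝ≥0∞)⁻¹ * ∑ j ∈ nb o, ∑ k ∈ nb o, pairSemigroup (nbWeight nb) t Γ j k
        + (nb o).card * pairSemigroup (nbWeight nb) t Γ o o)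
      = 2 * ∑ j ∈ nb o, pairSemigroup (nbWeight nb) t Γ o j := by
  have hm := fun i j => measurable_pairEnergy_walkLaw (nb := nb) hT Γ t i j
  have hne (j : ℕ) (hj : j ∈ insert o (nb o)) : (nb j).Nonempty := by
    rcases Finset.mem_insert.1 hj with rfl | hj
    · exact ho
    · exact ⟨o, (hsymm o j).1 hj⟩
  have hm2 : Measurable fun ω => ∑ j ∈ nb o, ∑ k ∈ nb o,
      pairEnergy Γ (walkLaw nb T t ω j) (walkLaw nb T t ω k) :=
    Finset.measurable_sum _ fun j _ => Finset.measurable_sum _ fun k _ => hm j k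
  have hsum : Measurable fun ω =>
      ((nb o).card : ℝ≥0∞)⁻¹ * ∑ j ∈ nb o, ∑ k ∈ nb o,
        pairEnergy Γ (walkLaw nb T t ω j) (walkLaw nb T t ω k)
        + (nb o).card * pairEnergy Γ (walkLaw nb T t ω o) (walkLaw nb T t ω o) :=
    (hm2.const_mul _).add ((hm o o).const_mul _)
  simp only [← lintegral_pairEnergy_walkLaw hT hTindep hnb ht Γ]
  rw [← lintegral_finsetSum _ fun j _ => hm o j,
    Finset.sum_congr rfl fun j _ => (lintegral_finsetSum (nb o) fun k _ => hm j k).symm,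
    ← lintegral_finsetSum _ fun j _ => Finset.measurable_sum _ fun k _ => hm j k,
    ← lintegral_const_mul _ hm2, ← lintegral_const_mul _ (hm o o),
    ← lintegral_add_left (hm2.const_mul _), ← lintegral_const_mul' _ _ ENNReal.ofNat_ne_top,
    ← lintegral_const_mul' _ _ ENNReal.ofNat_ne_top,
    ← lintegral_add_right _ hsum]
  refine lintegral_congr_ae ?_
  have h1 : ∀ᵐ ω ∂Pr, ∀ j ∈ insert o (nb o), ∑' x, walkLaw nb T t ω j x = 1 :=
    (Finset.eventually_all _).2 fun j hj => ae_tsum_walkLaw hT hTindep hnb hsymm ht (hne j hj)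
  have h2 : ∀ᵐ ω ∂Pr, ∀ j ∈ insert o (nb o), ∀ k ∈ insert o (nb o),
      pairEnergy Γ (walkLaw nb T t ω j) (walkLaw nb T t ω k) ≠ ∞ :=
    (Finset.eventually_all _).2 fun j hj => (Finset.eventually_all _).2 fun k hk =>
      ae_pairEnergy_ne_top hT hTindep hnb ht (hfin j hj k hk)
  filter_upwards [h1, h2] with ω h1 h2
  exact ofReal_sum_sq_add_pairEnergy ho hΓ h1 h2

end WalkMoments

/-! ### Poisson averages of sequences -/

section PoissonSum

/-- The mean of `c N`, with `N` a Poisson variable of mean `2t`. -/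
def poissonSum (c : ℕ → ℝ≥0∞) (t : ℝ) : ℝ≥0∞ := ∑' k, stepWeight t k * c k

lemma stepWeight_ne_top (t : ℝ) (k : ℕ) : stepWeight t k ≠ ∞ := ENNReal.ofReal_ne_top

/-- Termwise differentiation of an exponential generating function. -/
lemma hasDerivAt_expSeries {c : ℕ → ℝ} {C : ℝ} (hc : ∀ k, |c k| ≤ C * 2 ^ k) (u : ℝ) :
    HasDerivAt (fun u : ℝ => ∑' k, c k * (u ^ k / k.factorial))
      (∑' k, c (k + 1) * (u ^ k / k.factorial)) u := by
  let R : ℝ := |u| + 1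
  have hR : 0 ≤ R := by positivity
  have hC : 0 ≤ C := by simpa using (abs_nonneg _).trans (hc 0)
  let g' (k : ℕ) (y : ℝ) : ℝ := Nat.casesOn k 0 fun k => c (k + 1) * (y ^ k / k.factorial)
  let b (k : ℕ) : ℝ := Nat.casesOn k 0 fun k => 2 * C * ((2 * R) ^ k / k.factorial)
  have hb : Summable b := by
    rw [← summable_nat_add_iff 1]
    exact (Real.summable_pow_div_factorial (2 * R)).mul_left (2 * C)
  have hg (k : ℕ) (y : ℝ) : HasDerivAt (fun u : ℝ => c k * (u ^ k / k.factorial)) (g' k y) y := by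
    cases k with
    | zero => simpa [g'] using hasDerivAt_const y (c 0)
    | succ k =>
      refine (((hasDerivAt_pow (k + 1) y).div_const _).const_mul (c (k + 1))).congr_deriv ?_
      simp only [g']
      rw [Nat.factorial_succ]
      push_cast
      field_simp
  have hg' (k : ℕ) (y : ℝ) (hy : y ∈ Metric.ball (0 : ℝ) R) : ‖g' k y‖ ≤ b k := by
    cases k with
    | zero => simp [g', b]
    | succ k =>
      have hy' : |y| ≤ R := by simpa using (mem_ball_zero_iff.1 hy).le
      simp only [g', b, norm_mul, norm_div, norm_pow, Real.norm_eq_abs, Nat.abs_cast]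
      calc |c (k + 1)| * (|y| ^ k / k.factorial)
          ≤ C * 2 ^ (k + 1) * (R ^ k / k.factorial) := by
            gcongr
            exact hc _
        _ = 2 * C * ((2 * R) ^ k / k.factorial) := by
            rw [mul_pow]
            ring
  have h0 : Summable fun k => c k * ((0 : ℝ) ^ k / k.factorial) := by
    refine summable_of_ne_finset_zero (s := {0}) fun k hk => ?_
    rw [zero_pow (by simpa using hk)]
    simp
  have hu : u ∈ Metric.ball (0 : ℝ) R := by simp [R]
  have h := hasDerivAt_tsum_of_isPreconnected hb Metric.isOpen_ball
    (convex_ball (0 : ℝ) R).isPreconnected (fun k y _ => hg k y) hg'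
    (Metric.mem_ball_self (by positivity)) h0 hu
  refine h.congr_deriv ?_
  have hs : Summable fun k => g' k u := Summable.of_norm_bounded hb fun k => hg' k u hu
  rw [hs.tsum_eq_zero_add]
  simp [g']

variable {c : ℕ → ℝ≥0∞} {C : ℝ≥0∞}

lemma ne_top_of_le_two_pow (hC : C ≠ ∞) (hc : ∀ k, c k ≤ C * 2 ^ k) (k : ℕ) : c k ≠ ∞ :=
  ((hc k).trans_lt (ENNReal.mul_lt_top hC.lt_top (by simp))).ne

lemma abs_toReal_le_two_pow (hC : C ≠ ∞) (hc : ∀ k, c k ≤ C * 2 ^ k) (k : ℕ) :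
    |(c k).toReal| ≤ C.toReal * 2 ^ k := by
  rw [abs_of_nonneg ENNReal.toReal_nonneg]
  have := ENNReal.toReal_mono (ENNReal.mul_ne_top hC (by simp)) (hc k)
  simpa using this

lemma poissonSum_ne_top (hC : C ≠ ∞) (hc : ∀ k, c k ≤ C * 2 ^ k) {t : ℝ} (ht : 0 ≤ t) :
    poissonSum c t ≠ ∞ := by
  have h1 : poissonSum c t ≤ C * ∑' k : ℕ, ENNReal.ofReal ((4 * t) ^ k / k.factorial) := by
    rw [← ENNReal.tsum_mul_left]
    refine ENNReal.tsum_le_tsum fun k => ?_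
    calc stepWeight t k * c k
        ≤ ENNReal.ofReal ((2 * t) ^ k / k.factorial) * (C * 2 ^ k) := by
          refine mul_le_mul' (ENNReal.ofReal_le_ofReal ?_) (hc k)
          exact mul_le_of_le_one_left (by positivity)
            (Real.exp_le_one_iff.2 (by linarith))
      _ = C * (ENNReal.ofReal (2 ^ k) * ENNReal.ofReal ((2 * t) ^ k / k.factorial)) := by
          rw [ENNReal.ofReal_pow zero_le_two, ENNReal.ofReal_ofNat]
          ring
      _ = C * ENNReal.ofReal ((4 * t) ^ k / k.factorial) := by
          rw [← ENNReal.ofReal_mul (by positivity), ← mul_div_assoc, ← mul_pow]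
          norm_num [← mul_assoc]
  refine (h1.trans_lt (ENNReal.mul_lt_top hC.lt_top ?_)).ne
  rw [← ENNReal.ofReal_tsum_of_nonneg (fun k => by positivity)
    (Real.summable_pow_div_factorial (4 * t))]
  exact ENNReal.ofReal_lt_top

lemma toReal_poissonSum (hC : C ≠ ∞) (hc : ∀ k, c k ≤ C * 2 ^ k) {t : ℝ} (ht : 0 ≤ t) :
    (poissonSum c t).toReal
      = Real.exp (-(2 * t)) * ∑' k, (c k).toReal * ((2 * t) ^ k / k.factorial) := by
  unfold poissonSum
  rw [ENNReal.tsum_toReal_eq fun k =>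
    ENNReal.mul_ne_top (stepWeight_ne_top t k) (ne_top_of_le_two_pow hC hc k), ← tsum_mul_left]
  refine tsum_congr fun k => ?_
  rw [ENNReal.toReal_mul, stepWeight, ENNReal.toReal_ofReal (by positivity)]
  ring

lemma hasDerivAt_toReal_poissonSum (hC : C ≠ ∞) (hc : ∀ k, c k ≤ C * 2 ^ k) {t : ℝ} (ht : 0 < t) :
    HasDerivAt (fun t => (poissonSum c t).toReal)
      (2 * ((poissonSum (fun k => c (k + 1)) t).toReal - (poissonSum c t).toReal)) t := by
  have hC' : 2 * C ≠ ∞ := ENNReal.mul_ne_top ENNReal.ofNat_ne_top hC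
  have hc' (k : ℕ) : c (k + 1) ≤ 2 * C * 2 ^ k := (hc (k + 1)).trans_eq (by ring)
  have h1 : HasDerivAt (fun s : ℝ => 2 * s) (2 * 1) t := (hasDerivAt_id t).const_mul 2
  have h2 := h1.neg.exp.mul
    ((hasDerivAt_expSeries (abs_toReal_le_two_pow hC hc) (2 * t)).comp t h1)
  refine (h2.congr_deriv ?_).congr_of_eventuallyEq ?_
  · rw [toReal_poissonSum hC hc ht.le, toReal_poissonSum hC' hc' ht.le]
    simp only [Function.comp_apply, Pi.neg_apply]
    ring
  · filter_upwards [Ioi_mem_nhds ht] with s hs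
    rw [toReal_poissonSum hC hc (le_of_lt hs)]
    rfl

end PoissonSum

/-! ### The flow of the squared height differences -/

section GapFlow

variable {d : ℕ}

lemma edgeMass_tsum {P : Measure (Config (Space d))} {c : ℕ → ℝ≥0∞}
    {F : ℕ → Space d → Space d → Config (Space d) → ℝ≥0∞} (hF : ∀ k, IsField (F k)) :
    edgeMass P (fun s s' S => ∑' k, c k * F k s s' S) = ∑' k, c k * edgeMass P (F k) := by
  have h (S : Config (Space d)) : ∑' z, edge S 0 z * ∑' k, c k * F k 0 z S
      = ∑' k, c k * ∑' z, edge S 0 z * F k 0 z S := by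
    simp only [← ENNReal.tsum_mul_left]
    rw [ENNReal.tsum_comm]
    exact tsum_congr fun k => tsum_congr fun z => by ring
  unfold edgeMass
  simp only [h]
  rw [lintegral_tsum fun k => ((measurable_edgeSum (hF k)).const_mul _).aemeasurable]
  exact tsum_congr fun k => lintegral_const_mul _ (measurable_edgeSum (hF k))

lemma diagMass_tsum {P : Measure (Config (Space d))} {c : ℕ → ℝ≥0∞}
    {F : ℕ → Space d → Space d → Config (Space d) → ℝ≥0∞} (hF : ∀ k, IsField (F k)) :
    diagMass P (fun s s' S => ∑' k, c k * F k s s' S) = ∑' k, c k * diagMass P (F k) := by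
  have h (S : Config (Space d)) : deg (edge S) 0 * ∑' k, c k * F k 0 0 S
      = ∑' k, c k * (deg (edge S) 0 * F k 0 0 S) := by
    rw [← ENNReal.tsum_mul_left]
    exact tsum_congr fun k => by ring
  unfold diagMass
  simp only [h]
  rw [lintegral_tsum fun k => ((measurable_deg_mul (hF k)).const_mul _).aemeasurable]
  exact tsum_congr fun k => lintegral_const_mul _ (measurable_deg_mul (hF k))

lemma cornerMass_tsum {P : Measure (Config (Space d))} {c : ℕ → ℝ≥0∞}
    {F : ℕ → Space d → Space d → Config (Space d) → ℝ≥0∞} (hF : ∀ k, IsField (F k)) :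
    cornerMass P (fun s s' S => ∑' k, c k * F k s s' S) = ∑' k, c k * cornerMass P (F k) := by
  have h (S : Config (Space d)) :
      avgLeft (edge S) (avgRight (edge S) fun x y => ∑' k, c k * F k x y S) 0 0
        = ∑' k, c k * avgLeft (edge S) (avgRight (edge S) fun x y => F k x y S) 0 0 := by
    simp only [avgLeft, avgRight, avg_tsum, avg_const_mul]
  refine Eq.trans ?_ (diagMass_tsum (P := P) (c := c) fun k => (hF k).avgRight.avgLeft)
  exact lintegral_congr fun S => congrArg _ (h S)

/-- The mean of the squared height difference over the positions at time `t` of the two-walker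
chain in continuous time. -/
def gapFlow (γ : Surface d) (t : ℝ) (s s' : Space d) (S : Config (Space d)) : ℝ≥0∞ :=
  pairSemigroup (edge S) t (fun x y => heightGap γ x y S) s s'

/-- The same after `k` steps of the chain in discrete time. -/
def gapStep (γ : Surface d) (k : ℕ) (s s' : Space d) (S : Config (Space d)) : ℝ≥0∞ :=
  (pairStep (edge S))^[k] (fun x y => heightGap γ x y S) s s'

variable {γ : Surface d} {P : Measure (Config (Space d))}

lemma isField_gapStep (hm : γ.IsMeasurable) (hγ : γ.HasCovariantGrad) (k : ℕ) :
    IsField (gapStep γ k) :=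
  (isField_heightGap hm hγ).pairStep_iterate k

lemma isField_gapFlow (hm : γ.IsMeasurable) (hγ : γ.HasCovariantGrad) (t : ℝ) :
    IsField (gapFlow γ t) :=
  ⟨Measurable.tsum fun k => (isField_gapStep hm hγ k).measurable.const_mul _,
    fun x S s s' => tsum_congr fun k => by
      rw [show (pairStep (edge (S.shift x)))^[k] (fun y y' => heightGap γ y y' (S.shift x)) (s - x)
        (s' - x) = _ from (isField_gapStep hm hγ k).covariant x S s s']
      rfl⟩

lemma edgeMass_gapFlow (hm : γ.IsMeasurable) (hγ : γ.HasCovariantGrad) (t : ℝ) :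
    edgeMass P (gapFlow γ t) = poissonSum (fun k => edgeMass P (gapStep γ k)) t :=
  edgeMass_tsum fun k => isField_gapStep hm hγ k

lemma diagMass_gapFlow (hm : γ.IsMeasurable) (hγ : γ.HasCovariantGrad) (t : ℝ) :
    diagMass P (gapFlow γ t) = poissonSum (fun k => diagMass P (gapStep γ k)) t :=
  diagMass_tsum fun k => isField_gapStep hm hγ k

lemma cornerMass_gapFlow (hm : γ.IsMeasurable) (hγ : γ.HasCovariantGrad) (t : ℝ) :
    cornerMass P (gapFlow γ t) = poissonSum (fun k => cornerMass P (gapStep γ k)) t :=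
  cornerMass_tsum fun k => isField_gapStep hm hγ k

lemma edgeMass_gapStep_succ (hP : Assumptions P) (hm : γ.IsMeasurable) (hγ : γ.HasCovariantGrad)
    (k : ℕ) : edgeMass P (gapStep γ (k + 1)) = cornerMass P (gapStep γ k) := by
  rw [← edgeMass_pairStep hP hP.ae_deg_ne_top (isField_gapStep hm hγ k) fun s s' S =>
    pairStep_iterate_symm (fun x y => heightGap_comm γ x y S) k s s']
  congr 1
  funext s s' S
  unfold gapStep
  rw [Function.iterate_succ_apply']

lemma diagMass_gapStep_succ (hm : γ.IsMeasurable) (hγ : γ.HasCovariantGrad) (k : ℕ) :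
    diagMass P (gapStep γ (k + 1))
      = 2⁻¹ * (cornerMass P (gapStep γ k) + diagMass P (gapStep γ k)) := by
  rw [← diagMass_pairStep (isField_gapStep hm hγ k)]
  congr 1
  funext s s' S
  unfold gapStep
  rw [Function.iterate_succ_apply']

lemma edgeMass_gapStep_le (hP : Assumptions P) (hm : γ.IsMeasurable) (hγ : γ.HasCovariantGrad)
    (k : ℕ) : edgeMass P (gapStep γ k) ≤ 18 * edgeMass P (heightGap γ) * 2 ^ k := by
  refine (edgeMass_pairStep_iterate_le hP (isField_heightGap hm hγ)
    (fun s S => heightGap_self γ s S) (fun s x z S => heightGap_le_two_mul γ s x z S)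
    (fun x y s s' S => heightGap_le_three_mul γ x y s s' S) k).trans ?_
  rw [mul_right_comm]
  gcongr
  norm_num

lemma diagMass_gapStep_le (hP : Assumptions P) (hm : γ.IsMeasurable) (hγ : γ.HasCovariantGrad)
    (k : ℕ) : diagMass P (gapStep γ k) ≤ 18 * edgeMass P (heightGap γ) * 2 ^ k := by
  refine (diagMass_pairStep_iterate_le hP (isField_heightGap hm hγ)
    (fun s S => heightGap_self γ s S) (fun s x z S => heightGap_le_two_mul γ s x z S)
    (fun x y s s' S => heightGap_le_three_mul γ x y s s' S) k).trans ?_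
  rw [mul_right_comm]
  gcongr
  norm_num

lemma cornerMass_gapStep_le (hP : Assumptions P) (hm : γ.IsMeasurable) (hγ : γ.HasCovariantGrad)
    (k : ℕ) : cornerMass P (gapStep γ k) ≤ 36 * edgeMass P (heightGap γ) * 2 ^ k := by
  rw [← edgeMass_gapStep_succ hP hm hγ]
  refine (edgeMass_gapStep_le hP hm hγ (k + 1)).trans_eq ?_
  ring

lemma edgeMass_gapFlow_ne_top (hP : Assumptions P) (hm : γ.IsMeasurable)
    (hγ : γ.HasCovariantGrad) (hfin : edgeMass P (heightGap γ) ≠ ∞) {t : ℝ} (ht : 0 ≤ t) :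
    edgeMass P (gapFlow γ t) ≠ ∞ := by
  rw [edgeMass_gapFlow hm hγ]
  exact poissonSum_ne_top (ENNReal.mul_ne_top ENNReal.ofNat_ne_top hfin)
    (edgeMass_gapStep_le hP hm hγ) ht

lemma diagMass_gapFlow_ne_top (hP : Assumptions P) (hm : γ.IsMeasurable)
    (hγ : γ.HasCovariantGrad) (hfin : edgeMass P (heightGap γ) ≠ ∞) {t : ℝ} (ht : 0 ≤ t) :
    diagMass P (gapFlow γ t) ≠ ∞ := by
  rw [diagMass_gapFlow hm hγ]
  exact poissonSum_ne_top (ENNReal.mul_ne_top ENNReal.ofNat_ne_top hfin)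
    (diagMass_gapStep_le hP hm hγ) ht

lemma cornerMass_gapFlow_ne_top (hP : Assumptions P) (hm : γ.IsMeasurable)
    (hγ : γ.HasCovariantGrad) (hfin : edgeMass P (heightGap γ) ≠ ∞) {t : ℝ} (ht : 0 ≤ t) :
    cornerMass P (gapFlow γ t) ≠ ∞ := by
  rw [cornerMass_gapFlow hm hγ]
  exact poissonSum_ne_top (ENNReal.mul_ne_top ENNReal.ofNat_ne_top hfin)
    (cornerMass_gapStep_le hP hm hγ) ht

/-- The evolution of the energy of two walkers at neighboring sites. -/
lemma hasDerivAt_edgeMass_gapFlow (hP : Assumptions P) (hm : γ.IsMeasurable)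
    (hγ : γ.HasCovariantGrad) (hfin : edgeMass P (heightGap γ) ≠ ∞) {t : ℝ} (ht : 0 < t) :
    HasDerivAt (fun t => (edgeMass P (gapFlow γ t)).toReal)
      (2 * ((cornerMass P (gapFlow γ t)).toReal - (edgeMass P (gapFlow γ t)).toReal)) t := by
  have h := hasDerivAt_toReal_poissonSum (ENNReal.mul_ne_top ENNReal.ofNat_ne_top hfin)
    (edgeMass_gapStep_le hP hm hγ) ht
  simpa only [edgeMass_gapStep_succ hP hm hγ, edgeMass_gapFlow hm hγ, cornerMass_gapFlow hm hγ]
    using h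

/-- The evolution of the energy of two walkers at the same site. -/
lemma hasDerivAt_diagMass_gapFlow (hP : Assumptions P) (hm : γ.IsMeasurable)
    (hγ : γ.HasCovariantGrad) (hfin : edgeMass P (heightGap γ) ≠ ∞) {t : ℝ} (ht : 0 < t) :
    HasDerivAt (fun t => (diagMass P (gapFlow γ t)).toReal)
      ((cornerMass P (gapFlow γ t)).toReal - (diagMass P (gapFlow γ t)).toReal) t := by
  have h := hasDerivAt_toReal_poissonSum (ENNReal.mul_ne_top ENNReal.ofNat_ne_top hfin)
    (diagMass_gapStep_le hP hm hγ) ht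
  have h1 : poissonSum (fun k => diagMass P (gapStep γ (k + 1))) t
      = 2⁻¹ * (cornerMass P (gapFlow γ t) + diagMass P (gapFlow γ t)) := by
    rw [cornerMass_gapFlow hm hγ, diagMass_gapFlow hm hγ]
    unfold poissonSum
    rw [← ENNReal.tsum_add, ← ENNReal.tsum_mul_left]
    refine tsum_congr fun k => ?_
    beta_reduce
    rw [diagMass_gapStep_succ hm hγ]
    ring
  rw [h1, ENNReal.toReal_mul, ENNReal.toReal_add (cornerMass_gapFlow_ne_top hP hm hγ hfin ht.le)
    (diagMass_gapFlow_ne_top hP hm hγ hfin ht.le)] at h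
  simp only [← diagMass_gapFlow hm hγ] at h
  refine h.congr_deriv ?_
  rw [ENNReal.toReal_inv, ENNReal.toReal_ofNat]
  ring

end GapFlow

/-! ### The graph of a configuration labelled by an enumeration -/

section Labelled

variable {d : ℕ} {e : ℕ → Config (Space d) → Space d} {S : Config (Space d)}

/-- The enumeration labels the points of the configuration `S`, one of which is the origin, and all
of which have finitely many neighbors. -/
structure IsLabelled (e : ℕ → Config (Space d) → Space d) (S : Config (Space d)) : Prop where
  injective : Function.Injective fun n => e n S
  range_eq : range (fun n => e n S) = (S : Set (Space d))
  finite : ∀ s ∈ S, deg (edge S) s ≠ ∞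
  zero_mem : (0 : Space d) ∈ S

lemma ae_isLabelled {P : Measure (Config (Space d))} (hP : Assumptions P)
    (he : IsEnumeration (palm P) e) : ∀ᵐ S ∂palm P, IsLabelled e S := by
  filter_upwards [he.enumerates, hP.ae_forall_deg_ne_top, ae_palm_zero_mem P] with S h1 h2 h3
  exact ⟨h1.1, h1.2, h2, h3⟩

/-- The weights between the labels. -/
def labelWeight (e : ℕ → Config (Space d) → Space d) (S : Config (Space d)) : ℕ → ℕ → ℝ≥0∞ :=
  pullWeight (edge S) fun n => e n S

open Classical in
/-- The labels of the neighbors, for a configuration in which they are finite in number. -/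
def labelNb (e : ℕ → Config (Space d) → Space d) (S : Config (Space d)) (i : ℕ) : Finset ℕ :=
  if h : {j | IsNeighbor S (e i S) (e j S)}.Finite then h.toFinset else ∅

lemma IsLabelled.mem (hS : IsLabelled e S) (i : ℕ) : e i S ∈ S := by
  have : e i S ∈ range fun n => e n S := ⟨i, rfl⟩
  rwa [hS.range_eq] at this

lemma IsLabelled.exists_eq (hS : IsLabelled e S) {s : Space d} (hs : s ∈ S) : ∃ i, e i S = s := by
  have : s ∈ range fun n => e n S := by rwa [hS.range_eq]
  exact this

lemma IsLabelled.mem_labelNb (hS : IsLabelled e S) {i j : ℕ} :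
    j ∈ labelNb e S i ↔ IsNeighbor S (e i S) (e j S) := by
  have h : {j | IsNeighbor S (e i S) (e j S)}.Finite :=
    (finite_of_deg_edge (hS.finite _ (hS.mem i))).preimage (f := fun n => e n S)
      hS.injective.injOn
  rw [labelNb, dif_pos h, Set.Finite.mem_toFinset]
  rfl

lemma IsLabelled.notMem_labelNb (hS : IsLabelled e S) (i : ℕ) : i ∉ labelNb e S i := fun h =>
  (hS.mem_labelNb.1 h).2.2.1 rfl

lemma IsLabelled.labelNb_symm (hS : IsLabelled e S) (i j : ℕ) :
    j ∈ labelNb e S i ↔ i ∈ labelNb e S j := by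
  rw [hS.mem_labelNb, hS.mem_labelNb]
  exact ⟨IsNeighbor.symm, IsNeighbor.symm⟩

lemma IsLabelled.labelWeight_eq (hS : IsLabelled e S) :
    labelWeight e S = nbWeight (labelNb e S) := by
  classical
  funext i j
  rw [labelWeight, pullWeight, edge_eq, nbWeight]
  exact if_congr hS.mem_labelNb.symm rfl rfl

lemma IsLabelled.edge_mem_range (hS : IsLabelled e S) (i : ℕ) (z : Space d)
    (h : edge S (e i S) z ≠ 0) : z ∈ range fun n => e n S := by
  rw [hS.range_eq]
  exact (edge_ne_zero.1 h).2.1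

/-- The labels as an equivalence with the points. -/
def IsLabelled.equiv (hS : IsLabelled e S) : ℕ ≃ S :=
  Equiv.ofBijective (fun n => ⟨e n S, hS.mem n⟩)
    ⟨fun _ _ hij => hS.injective (congrArg Subtype.val hij),
      fun s => (hS.exists_eq s.2).imp fun _ hi => Subtype.ext hi⟩

lemma IsLabelled.coe_equiv (hS : IsLabelled e S) (n : ℕ) : (hS.equiv n : Space d) = e n S := rfl

lemma IsLabelled.tsum_edge_mul (hS : IsLabelled e S) (i : ℕ) (F : Space d → ℝ≥0∞) :
    ∑' z, edge S (e i S) z * F z = ∑ j ∈ labelNb e S i, F (e j S) := by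
  rw [tsum_weight_relabel hS.injective hS.edge_mem_range F i]
  exact (congrArg (fun a : ℕ → ℕ → ℝ≥0∞ => ∑' j, a i j * F (e j S)) hS.labelWeight_eq).trans
    (tsum_nbWeight_mul _ _)

lemma IsLabelled.deg_edge (hS : IsLabelled e S) (i : ℕ) :
    deg (edge S) (e i S) = (labelNb e S i).card := by
  rw [← deg_nbWeight, ← hS.labelWeight_eq]
  exact deg_relabel hS.injective hS.edge_mem_range i

lemma IsLabelled.degree_eq (hS : IsLabelled e S) (i : ℕ) :
    degree S (e i S) = (labelNb e S i).card := by
  have h := hS.deg_edge i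
  rw [deg_edge_of_finite (finite_of_deg_edge (hS.finite _ (hS.mem i)))] at h
  exact_mod_cast h

lemma IsLabelled.laplacian_eq (hS : IsLabelled e S) (f : Space d → ℝ) (i : ℕ) :
    laplacian S f (e i S) = ∑ j ∈ labelNb e S i, (f (e j S) - f (e i S)) := by
  unfold laplacian
  rw [← hS.equiv.tsum_eq, tsum_eq_sum (s := labelNb e S i) fun j hj => ?_]
  · refine Finset.sum_congr rfl fun j hj => ?_
    rw [hS.coe_equiv, conductance_of_isNeighbor (hS.mem_labelNb.1 hj), one_mul]
  · rw [hS.coe_equiv, conductance, if_neg fun h => hj (hS.mem_labelNb.2 h), zero_mul]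

lemma IsLabelled.tsum_grad_sq (hS : IsLabelled e S) (f : Space d → ℝ) (i : ℕ) :
    ∑' s : S, ENNReal.ofReal (conductance S (e i S) s)
        * ENNReal.ofReal (|grad S f (e i S) s| ^ 2)
      = ∑ j ∈ labelNb e S i, ENNReal.ofReal ((f (e j S) - f (e i S)) ^ 2) := by
  refine (Harness.tsum_edge_mul S (e i S)
    fun s => ENNReal.ofReal (|grad S f (e i S) s| ^ 2)).symm.trans ?_
  rw [hS.tsum_edge_mul]
  refine Finset.sum_congr rfl fun j hj => ?_
  rw [grad, conductance_of_isNeighbor (hS.mem_labelNb.1 hj), one_mul, sq_abs]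

/-- The gap flow in terms of the labels. -/
lemma IsLabelled.pairSemigroup_eq (hS : IsLabelled e S) (γ : Surface d) (t : ℝ) (i j : ℕ) :
    pairSemigroup (nbWeight (labelNb e S)) t (fun i j => heightGap γ (e i S) (e j S) S) i j
      = gapFlow γ t (e i S) (e j S) S := by
  unfold gapFlow pairSemigroup
  refine tsum_congr fun k => congrArg _ ?_
  rw [← hS.labelWeight_eq]
  exact (pairStep_iterate_relabel hS.injective hS.edge_mem_range
    (fun x y => heightGap γ x y S) k i j).symm

variable {Ω : Type*} {T : ℕ → Ω → Config ℝ}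

lemma IsLabelled.epochs_eq (hS : IsLabelled e S) (ω : Ω) (i : ℕ) :
    epochs e T S ω (e i S) = (T i ω : Set ℝ) := by
  ext τ
  constructor
  · rintro ⟨n, hn, hτ⟩
    rwa [← hS.injective hn]
  · exact fun hτ => ⟨i, rfl, hτ⟩

lemma IsLabelled.transProb_eq (hS : IsLabelled e S) (t : ℝ) (ω : Ω) (i j : ℕ) :
    transProb S (epochs e T S ω) t (e i S) (e j S)
      = (walkLaw (labelNb e S) T t ω i j).toReal := by
  rw [transProb_eq_toReal hS.finite _ t (hS.mem i), walkLaw, ← hS.labelWeight_eq, labelWeight]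
  congr 1
  refine (walkKernel_relabel hS.injective hS.edge_mem_range t i j).trans ?_
  simp only [hS.epochs_eq]

lemma height_of_mem {γ : Surface d} {s : Space d} (hs : s ∈ S) : height γ S s = γ s S := if_pos hs

lemma IsLabelled.harness_eq (hS : IsLabelled e S) (γ : Surface d) (t : ℝ) (ω : Ω) (i : ℕ) :
    harness e T γ t (S, ω) (e i S)
      = powMean (fun j => height γ S (e j S)) 1 (walkLaw (labelNb e S) T t ω i) := by
  unfold harness powMean
  rw [← hS.equiv.tsum_eq]
  refine tsum_congr fun j => ?_
  rw [hS.coe_equiv, hS.transProb_eq, pow_one]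
  exact congrArg _ (height_of_mem (hS.mem j)).symm

lemma IsLabelled.summable_iff (hS : IsLabelled e S) (γ : Surface d) (t : ℝ) (ω : Ω) (i : ℕ) :
    (Summable fun s' : S => transProb S (epochs e T S ω) t (e i S) s' * γ s' S)
      ↔ Summable fun j => (walkLaw (labelNb e S) T t ω i j).toReal * height γ S (e j S) := by
  rw [← hS.equiv.summable_iff]
  refine summable_congr fun j => ?_
  rw [Function.comp_apply, hS.coe_equiv, hS.transProb_eq, height_of_mem (hS.mem j)]

/-- A walk started at an isolated point stays there, or dies. -/
lemma walkLaw_of_isolated {nb : ℕ → Finset ℕ} {i : ℕ} (hi : nb i = ∅) (t : ℝ) (ω : Ω) {x : ℕ}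
    (hx : x ≠ i) : walkLaw nb T t ω i x = 0 := by
  refine ENNReal.tsum_eq_zero.2 fun k => ?_
  cases k with
  | zero => simp [walkProb, hx.symm]
  | succ k =>
    have (g : ℕ → ℝ≥0∞) : avg (nbWeight nb) g i = 0 := by
      rw [avg, tsum_nbWeight_mul, hi, Finset.sum_empty, mul_zero]
    simp [walkProb, this]

end Labelled

section Quenched

variable {d : ℕ} {e : ℕ → Config (Space d) → Space d} {S : Config (Space d)} {γ : Surface d}
  {Ω : Type*} [MeasurableSpace Ω] {Pr : Measure Ω} {T : ℕ → Ω → Config ℝ}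

lemma heightGap_of_ne_top {s s' : Space d} (h : heightGap γ s s' S ≠ ∞) :
    heightGap γ s s' S = ENNReal.ofReal ((height γ S s' - height γ S s) ^ 2) := by
  classical
  unfold heightGap at h ⊢
  split_ifs at h ⊢ with hJ
  · rfl
  · exact absurd rfl h

lemma measurable_powMean_walkLaw (hT : ∀ n, IsPoissonProcess Pr (T n)) {nb : ℕ → Finset ℕ}
    (g : ℕ → ℝ) (n : ℕ) (t : ℝ) (i : ℕ) :
    Measurable fun ω => powMean g n (walkLaw nb T t ω i) :=
  Measurable.tsum fun x => (measurable_walkLaw hT t i x).ennreal_toReal.mul_const _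

variable [IsProbabilityMeasure Pr]

/-- The mean energy at the origin, given the configuration. -/
lemma IsLabelled.lintegral_energy_add (hS : IsLabelled e S)
    (hT : ∀ n, IsPoissonProcess Pr (T n)) (hTindep : iIndepFun T Pr) {t : ℝ} (ht : 0 ≤ t)
    (h0 : deg (edge S) 0 ≠ 0 → gapFlow γ t 0 0 S ≠ ∞)
    (hz : ∀ z, edge S 0 z ≠ 0 → gapFlow γ t 0 z S ≠ ∞ ∧ gapFlow γ t z z S ≠ ∞) :
    ∫⁻ ω, ∑' s : S, ENNReal.ofReal (conductance S 0 s)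
        * ENNReal.ofReal (|grad S (harness e T γ t (S, ω)) 0 s| ^ 2) ∂Pr
      + (2⁻¹ * (deg (edge S) 0 * gapFlow γ t 0 0 S) + 2⁻¹ * ∑' z, edge S 0 z * gapFlow γ t z z S)
      = ∑' z, edge S 0 z * gapFlow γ t 0 z S := by
  obtain ⟨o, ho⟩ := hS.exists_eq hS.zero_mem
  rw [← ho] at h0 hz ⊢
  simp only [hS.tsum_grad_sq, hS.tsum_edge_mul, hS.deg_edge, hS.harness_eq]
  have hm (j : ℕ) : Measurable fun ω => ENNReal.ofReal
      ((powMean (fun j => height γ S (e j S)) 1 (walkLaw (labelNb e S) T t ω j)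
        - powMean (fun j => height γ S (e j S)) 1 (walkLaw (labelNb e S) T t ω o)) ^ 2) :=
    (((measurable_powMean_walkLaw hT _ 1 t j).sub
      (measurable_powMean_walkLaw hT _ 1 t o)).pow_const 2).ennreal_ofReal
  rw [lintegral_finsetSum _ fun j _ => hm j, Finset.mul_sum, ← nsmul_eq_mul, ← Finset.sum_const,
    Finset.mul_sum, ← Finset.sum_add_distrib, ← Finset.sum_add_distrib]
  refine Finset.sum_congr rfl fun j hj => ?_
  have hjo := hS.mem_labelNb.1 hj
  have hjz := hz _ (edge_ne_zero.2 hjo)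
  have hoo : gapFlow γ t (e o S) (e o S) S ≠ ∞ := h0 (by
    rw [hS.deg_edge]
    exact_mod_cast (Finset.card_pos.2 ⟨j, hj⟩).ne')
  have h := lintegral_sq_add_pairSemigroup (nb := labelNb e S) (i := o) (j := j)
    (Γ := fun i j => heightGap γ (e i S) (e j S) S) (g := fun j => height γ S (e j S))
    hT hTindep hS.notMem_labelNb hS.labelNb_symm ht (fun x y => heightGap_of_ne_top) ⟨j, hj⟩
    ⟨o, (hS.labelNb_symm o j).1 hj⟩
  simp only [hS.pairSemigroup_eq] at h
  exact h hoo hjz.2 hjz.1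

/-- The mean dissipation at the origin, given the configuration. -/
lemma IsLabelled.lintegral_dissipation_add (hS : IsLabelled e S)
    (hT : ∀ n, IsPoissonProcess Pr (T n)) (hTindep : iIndepFun T Pr) {t : ℝ} (ht : 0 ≤ t)
    (h0 : deg (edge S) 0 ≠ 0 → gapFlow γ t 0 0 S ≠ ∞)
    (hz : ∀ z, edge S 0 z ≠ 0 → gapFlow γ t 0 z S ≠ ∞ ∧ gapFlow γ t z 0 S ≠ ∞)
    (hzz : ∀ z z', edge S 0 z ≠ 0 → edge S 0 z' ≠ 0 → gapFlow γ t z z' S ≠ ∞) :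
    2 * ∫⁻ ω, ENNReal.ofReal ((degree S 0 : ℝ)⁻¹
        * |laplacian S (harness e T γ t (S, ω)) 0| ^ 2) ∂Pr
      + (deg (edge S) 0 * avgLeft (edge S) (avgRight (edge S) fun x y => gapFlow γ t x y S) 0 0
        + deg (edge S) 0 * gapFlow γ t 0 0 S)
      = 2 * ∑' z, edge S 0 z * gapFlow γ t 0 z S := by
  obtain ⟨o, ho⟩ := hS.exists_eq hS.zero_mem
  rw [← ho] at h0 hz hzz ⊢
  have hdeg : deg (edge S) (e o S) ≠ ∞ := hS.finite _ (hS.mem o)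
  rw [avgLeft, deg_mul_avg hdeg]
  simp only [avgRight, avg, hS.tsum_edge_mul, hS.deg_edge, hS.harness_eq, hS.laplacian_eq,
    hS.degree_eq, sq_abs, ← Finset.mul_sum]
  rcases (labelNb e S o).eq_empty_or_nonempty with hempty | hne
  · simp [hempty]
  have hoo : gapFlow γ t (e o S) (e o S) S ≠ ∞ := h0 (by
    rw [hS.deg_edge]
    exact_mod_cast hne.card_pos.ne')
  have h := lintegral_dissipation_add_pairSemigroup (nb := labelNb e S) (o := o)
    (Γ := fun i j => heightGap γ (e i S) (e j S) S) (g := fun j => height γ S (e j S))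
    hT hTindep hS.notMem_labelNb hS.labelNb_symm ht (fun x y => heightGap_of_ne_top) hne
  simp only [hS.pairSemigroup_eq] at h
  refine h fun j hj k hk => ?_
  have hed {j : ℕ} (hj : j ∈ labelNb e S o) : edge S (e o S) (e j S) ≠ 0 :=
    edge_ne_zero.2 (hS.mem_labelNb.1 hj)
  rcases Finset.mem_insert.1 hj with rfl | hj <;> rcases Finset.mem_insert.1 hk with rfl | hk
  · exact hoo
  · exact (hz _ (hed hk)).1
  · exact (hz _ (hed hj)).2
  · exact hzz _ _ (hed hj) (hed hk)

/-- Given the configuration, almost surely the sums defining the harness process converge. -/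
lemma IsLabelled.ae_summable (hS : IsLabelled e S)
    (hT : ∀ n, IsPoissonProcess Pr (T n)) (hTindep : iIndepFun T Pr) {t : ℝ} (ht : 0 ≤ t)
    (h : ∀ s ∈ S, deg (edge S) s ≠ 0 → gapFlow γ t s s S ≠ ∞) :
    ∀ᵐ ω ∂Pr, ∀ i, Summable fun j =>
      (walkLaw (labelNb e S) T t ω i j).toReal * height γ S (e j S) := by
  refine ae_all_iff.2 fun i => ?_
  rcases (labelNb e S i).eq_empty_or_nonempty with hi | hi
  · refine ae_of_all _ fun ω => summable_of_ne_finset_zero (s := {i}) fun j hj => ?_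
    rw [walkLaw_of_isolated hi t ω (by simpa using hj), ENNReal.toReal_zero, zero_mul]
  · refine ae_summable_walkLaw (Γ := fun i j => heightGap γ (e i S) (e j S) S) hT hTindep
      hS.notMem_labelNb hS.labelNb_symm ht (fun x y => heightGap_of_ne_top) hi ?_
    rw [hS.pairSemigroup_eq]
    refine h _ (hS.mem i) ?_
    rw [hS.deg_edge]
    exact_mod_cast hi.card_pos.ne'

end Quenched

/-! ### Averaging over the configuration -/

section Annealed

variable {d : ℕ} {e : ℕ → Config (Space d) → Space d} {γ : Surface d}
  {P : Measure (Config (Space d))} {Ω : Type*} {T : ℕ → Ω → Config ℝ}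

/-- The harness process in terms of the labels, jointly measurable in the configuration and the
clocks. -/
def labelHarness (e : ℕ → Config (Space d) → Space d) (T : ℕ → Ω → Config ℝ) (γ : Surface d)
    (t : ℝ) (i : ℕ) (x : Config (Space d) × Ω) : ℝ :=
  ∑' j, (walkKernel (labelWeight e x.1) (fun n => (T n x.2 : Set ℝ)) t i j).toReal
    * height γ x.1 (e j x.1)

lemma IsLabelled.harness_eq_labelHarness {S : Config (Space d)} (hS : IsLabelled e S) (t : ℝ)
    (ω : Ω) (i : ℕ) : harness e T γ t (S, ω) (e i S) = labelHarness e T γ t i (S, ω) := by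
  rw [hS.harness_eq]
  simp only [labelHarness, hS.labelWeight_eq, powMean, walkLaw, pow_one]

variable [MeasurableSpace Ω] {Pr : Measure Ω}

lemma measurable_labelWeight (he : ∀ n, Measurable (e n)) (i j : ℕ) :
    Measurable fun S => labelWeight e S i j :=
  isField_edge.measurable_comp (he i) (he j) measurable_id

lemma measurable_labelHeight (he : ∀ n, Measurable (e n)) (hγ : γ.IsMeasurable) (j : ℕ) :
    Measurable fun S : Config (Space d) => height γ S (e j S) :=
  (measurable_height hγ).comp ((he j).prodMk measurable_id)

lemma measurable_labelKernel (he : ∀ n, Measurable (e n)) (hT : ∀ n, Measurable (T n)) (t : ℝ)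
    (i j : ℕ) : Measurable fun x : Config (Space d) × Ω =>
      walkKernel (labelWeight e x.1) (fun n => (T n x.2 : Set ℝ)) t i j := by
  refine measurable_walkKernel (C := fun x : Config (Space d) × Ω => fun n => (T n x.2 : Set ℝ))
    (fun i j => (measurable_labelWeight he i j).comp measurable_fst)
    (fun n c q _ => ?_) (fun x n c q => (T n x.2).locallyFinite _ (Metric.isBounded_Ioc _ _)) t i j
  have h : {x : Config (Space d) × Ω | ((T n x.2 : Set ℝ) ∩ Ioc c q).Nonempty}
      = (fun x => Config.count (Ioc c q) (T n x.2)) ⁻¹' {0}ᶜ := by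
    ext x
    rw [mem_ofPred_eq, nonempty_iff_ne_empty, Ne, ← Config.count_eq_zero_iff]
    rfl
  rw [h]
  exact (Config.measurable_count (Metric.isBounded_Ioc _ _) measurableSet_Ioc).comp
    ((hT n).comp measurable_snd) (measurableSet_singleton 0).compl

lemma measurable_labelHarness (he : ∀ n, Measurable (e n)) (hT : ∀ n, Measurable (T n))
    (hγ : γ.IsMeasurable) (t : ℝ) (i : ℕ) : Measurable (labelHarness e T γ t i) :=
  Measurable.tsum fun j => (measurable_labelKernel he hT t i j).ennreal_toReal.mul
    ((measurable_labelHeight he hγ j).comp measurable_fst)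

lemma ae_fst {Q : Measure (Config (Space d))} [SFinite Pr] {p : Config (Space d) → Prop}
    (h : ∀ᵐ S ∂Q, p S) : ∀ᵐ x ∂Q.prod Pr, p x.1 :=
  Measure.quasiMeasurePreserving_fst.ae h

/-- A function of a labelled configuration, given at the label of the origin by a measurable
expression, is measurable. -/
lemma aemeasurable_of_label {β : Type*} [MeasurableSpace β] [AddCommMonoid β] [TopologicalSpace β]
    [TopologicalSpace.IsCompletelyPseudoMetrizableSpace β] [SecondCountableTopology β]
    [BorelSpace β] [MeasurableAdd₂ β] [SFinite Pr]
    (hP : Assumptions P) (he : IsEnumeration (palm P) e)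
    {f : Config (Space d) × Ω → β} {F : ℕ → Config (Space d) × Ω → β} (hF : ∀ i, Measurable (F i))
    (h : ∀ S ω i, IsLabelled e S → e i S = 0 → f (S, ω) = F i (S, ω)) :
    AEMeasurable f ((palm P).prod Pr) := by
  classical
  refine ⟨fun x => ∑' i, if e i x.1 = 0 then F i x else 0, Measurable.tsum fun i =>
    Measurable.ite (((he.measurable i).comp measurable_fst) (measurableSet_singleton 0)) (hF i)
      measurable_const, ?_⟩
  filter_upwards [ae_fst (Pr := Pr) (ae_isLabelled hP he)] with x hx
  obtain ⟨o, ho⟩ := hx.exists_eq hx.zero_mem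
  rw [tsum_eq_single o fun j hj => if_neg fun hj' => hj (hx.injective (hj'.trans ho.symm)),
    if_pos ho]
  exact h x.1 x.2 o hx ho

lemma aemeasurable_energy [SFinite Pr] (hP : Assumptions P) (he : IsEnumeration (palm P) e)
    (hT : ∀ n, Measurable (T n)) (hγ : γ.IsMeasurable) (t : ℝ) :
    AEMeasurable (fun x : Config (Space d) × Ω => ∑' s : x.1,
      ENNReal.ofReal (conductance x.1 0 s)
        * ENNReal.ofReal (|grad x.1 (harness e T γ t x) 0 s| ^ 2)) ((palm P).prod Pr) := by
  refine aemeasurable_of_label hP he (F := fun i x => ∑' j, labelWeight e x.1 i j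
    * ENNReal.ofReal ((labelHarness e T γ t j x - labelHarness e T γ t i x) ^ 2))
    (fun i => Measurable.tsum fun j => ((measurable_labelWeight he.measurable i j).comp
      measurable_fst).mul (((measurable_labelHarness he.measurable hT hγ t j).sub
      (measurable_labelHarness he.measurable hT hγ t i)).pow_const 2).ennreal_ofReal)
    fun S ω i hS hi => ?_
  simp only [← hi, hS.tsum_grad_sq, hS.harness_eq_labelHarness, hS.labelWeight_eq,
    tsum_nbWeight_mul]

lemma aemeasurable_dissipation [SFinite Pr] (hP : Assumptions P) (he : IsEnumeration (palm P) e)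
    (hT : ∀ n, Measurable (T n)) (hγ : γ.IsMeasurable) (t : ℝ) :
    AEMeasurable (fun x : Config (Space d) × Ω =>
      (degree x.1 0 : ℝ)⁻¹ * |laplacian x.1 (harness e T γ t x) 0| ^ 2) ((palm P).prod Pr) := by
  refine aemeasurable_of_label hP he (F := fun i x => (deg (labelWeight e x.1) i).toReal⁻¹
    * |∑' j, (labelWeight e x.1 i j).toReal
      * (labelHarness e T γ t j x - labelHarness e T γ t i x)| ^ 2)
    (fun i => ?_) fun S ω i hS hi => ?_
  · have h1 : Measurable fun x : Config (Space d) × Ω => deg (labelWeight e x.1) i :=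
      Measurable.tsum fun j => (measurable_labelWeight he.measurable i j).comp measurable_fst
    have h2 : Measurable fun x : Config (Space d) × Ω => ∑' j, (labelWeight e x.1 i j).toReal
        * (labelHarness e T γ t j x - labelHarness e T γ t i x) :=
      Measurable.tsum fun j => ((measurable_labelWeight he.measurable i j).comp
        measurable_fst).ennreal_toReal.mul ((measurable_labelHarness he.measurable hT hγ t j).sub
        (measurable_labelHarness he.measurable hT hγ t i))
    exact h1.ennreal_toReal.inv.mul (h2.abs.pow_const 2)
  · simp only [← hi, hS.laplacian_eq, hS.degree_eq, hS.harness_eq_labelHarness, hS.labelWeight_eq,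
      deg_nbWeight, ENNReal.toReal_natCast]
    rw [tsum_eq_sum (s := labelNb e S i) fun j hj => by simp [nbWeight, hj]]
    congr 3
    exact Finset.sum_congr rfl fun j hj => by simp [nbWeight, hj]

lemma edge_mul_ne_top_iff {S : Config (Space d)} {s s' : Space d} {c : ℝ≥0∞} :
    edge S s s' * c ≠ ∞ ↔ (edge S s s' ≠ 0 → c ≠ ∞) := by
  classical
  rw [edge_eq]
  split_ifs with h <;> simp

/-- The values of the gap flow at and around the origin are finite. -/
lemma ae_gapFlow_ne_top (hP : Assumptions P) (hm : γ.IsMeasurable) (hγ : γ.HasCovariantGrad)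
    (hfin : edgeMass P (heightGap γ) ≠ ∞) {t : ℝ} (ht : 0 ≤ t) :
    ∀ᵐ S ∂palm P, (deg (edge S) (0 : Space d) ≠ 0 → gapFlow γ t 0 0 S ≠ ∞) ∧
      (∀ z, edge S 0 z ≠ 0 → gapFlow γ t 0 z S ≠ ∞ ∧ gapFlow γ t z z S ≠ ∞) ∧
      (∀ z z', edge S 0 z ≠ 0 → edge S 0 z' ≠ 0 → gapFlow γ t z z' S ≠ ∞) := by
  have hF := isField_gapFlow hm hγ t
  have h2 := ae_lt_top (measurable_edgeSum hF) (edgeMass_gapFlow_ne_top hP hm hγ hfin ht)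
  have h3 := ae_lt_top (measurable_deg_mul hF) (diagMass_gapFlow_ne_top hP hm hγ hfin ht)
  have h4 := ae_lt_top (measurable_edgeSum hF.diag.swap)
    ((edgeMass_diag hP hF).trans_ne (diagMass_gapFlow_ne_top hP hm hγ hfin ht))
  have h5 := ae_lt_top (measurable_deg_mul hF.avgRight.avgLeft)
    (cornerMass_gapFlow_ne_top hP hm hγ hfin ht)
  filter_upwards [h2, h3, h4, h5, hP.ae_deg_ne_top] with S h2 h3 h4 h5 h6
  refine ⟨fun h0 h => ?_, fun z hz => ⟨?_, ?_⟩, fun z z' hz hz' => ?_⟩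
  · rw [h, ENNReal.mul_top h0] at h3
    exact h3.ne rfl
  · exact edge_mul_ne_top_iff.1 (ENNReal.ne_top_of_tsum_ne_top h2.ne z) hz
  · exact edge_mul_ne_top_iff.1 (ENNReal.ne_top_of_tsum_ne_top h4.ne z) hz
  · rw [avgLeft, deg_mul_avg h6] at h5
    have h7 := edge_mul_ne_top_iff.1 (ENNReal.ne_top_of_tsum_ne_top h5.ne z) hz
    rw [avgRight, avg] at h7
    have h8 : ∑' z', edge S 0 z' * gapFlow γ t z z' S ≠ ∞ := fun h => h7 (by
      rw [h, ENNReal.mul_top (ENNReal.inv_ne_zero.2 h6)])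
    exact edge_mul_ne_top_iff.1 (ENNReal.ne_top_of_tsum_ne_top h8 z') hz'

lemma gapFlow_comm (γ : Surface d) (t : ℝ) (s s' : Space d) (S : Config (Space d)) :
    gapFlow γ t s s' S = gapFlow γ t s' s S :=
  tsum_congr fun k => congrArg _
    (pairStep_iterate_symm (fun x y => heightGap_comm γ x y S) k s s')

variable [IsProbabilityMeasure Pr]

/-- Twice the energy is the mean squared height difference of two walkers started at neighbors, less
that of two walkers started at the same site. -/
lemma energy_add_diagMass (hP : Assumptions P) (he : IsEnumeration (palm P) e)
    (hT : ∀ n, IsPoissonProcess Pr (T n)) (hTindep : iIndepFun T Pr) (hm : γ.IsMeasurable)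
    (hγ : γ.HasCovariantGrad) (hfin : edgeMass P (heightGap γ) ≠ ∞) {t : ℝ} (ht : 0 ≤ t) :
    2 * campbell ((palm P).prod Pr) Prod.fst
        (fun s s' x => ENNReal.ofReal (|grad x.1 (harness e T γ t x) s s'| ^ 2))
      + diagMass P (gapFlow γ t) = edgeMass P (gapFlow γ t) := by
  have hF := isField_gapFlow hm hγ t
  rw [campbell, ← mul_assoc, ENNReal.mul_inv_cancel two_ne_zero ENNReal.ofNat_ne_top, one_mul,
    lintegral_prod _ (aemeasurable_energy hP he (fun n => (hT n).measurable) hm t)]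
  have h1 : diagMass P (gapFlow γ t) = ∫⁻ S, (2⁻¹ * (deg (edge S) 0 * gapFlow γ t 0 0 S)
      + 2⁻¹ * ∑' z, edge S 0 z * gapFlow γ t z z S) ∂palm P := by
    rw [lintegral_add_left ((measurable_deg_mul hF).const_mul _), lintegral_const_mul _
      (measurable_deg_mul hF), lintegral_const_mul _ (measurable_edgeSum hF.diag.swap)]
    have h2 := edgeMass_diag hP hF
    unfold edgeMass at h2
    rw [h2, ← mul_add]
    exact (half_add_self _).symm
  have hms : Measurable fun S => 2⁻¹ * (deg (edge S) 0 * gapFlow γ t 0 0 S)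
      + 2⁻¹ * ∑' z, edge S 0 z * gapFlow γ t z z S :=
    ((measurable_deg_mul hF).const_mul _).add ((measurable_edgeSum hF.diag.swap).const_mul _)
  rw [h1, ← lintegral_add_right _ hms]
  refine lintegral_congr_ae ?_
  filter_upwards [ae_isLabelled hP he, ae_gapFlow_ne_top hP hm hγ hfin ht] with S hS h
  exact hS.lintegral_energy_add hT hTindep ht h.1 h.2.1

/-- Twice the dissipation at the origin is twice the mean squared height difference of two walkers
started at neighbors, less that of two walkers started at two independent neighbors of the origin,
less that of two walkers started at the origin. -/
lemma dissipation_add_cornerMass (hP : Assumptions P) (he : IsEnumeration (palm P) e)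
    (hT : ∀ n, IsPoissonProcess Pr (T n)) (hTindep : iIndepFun T Pr) (hm : γ.IsMeasurable)
    (hγ : γ.HasCovariantGrad) (hfin : edgeMass P (heightGap γ) ≠ ∞) {t : ℝ} (ht : 0 ≤ t) :
    2 * ∫⁻ x : Config (Space d) × Ω, ENNReal.ofReal
        ((degree x.1 0 : ℝ)⁻¹ * |laplacian x.1 (harness e T γ t x) 0| ^ 2) ∂(palm P).prod Pr
      + (cornerMass P (gapFlow γ t) + diagMass P (gapFlow γ t))
      = 2 * edgeMass P (gapFlow γ t) := by
  have hF := isField_gapFlow hm hγ t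
  rw [lintegral_prod _ (aemeasurable_dissipation hP he (fun n => (hT n).measurable) hm
    t).ennreal_ofReal, cornerMass, diagMass, edgeMass,
    ← lintegral_add_left (measurable_deg_mul hF.avgRight.avgLeft),
    ← lintegral_const_mul' _ _ ENNReal.ofNat_ne_top,
    ← lintegral_const_mul' _ _ ENNReal.ofNat_ne_top]
  have hms : Measurable fun S => deg (edge S) 0
      * avgLeft (edge S) (avgRight (edge S) fun x y => gapFlow γ t x y S) 0 0
      + deg (edge S) 0 * gapFlow γ t 0 0 S :=
    (measurable_deg_mul hF.avgRight.avgLeft).add (measurable_deg_mul hF)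
  rw [← lintegral_add_right _ hms]
  refine lintegral_congr_ae ?_
  filter_upwards [ae_isLabelled hP he, ae_gapFlow_ne_top hP hm hγ hfin ht] with S hS h
  exact hS.lintegral_dissipation_add hT hTindep ht h.1
    (fun z hz => ⟨(h.2.1 z hz).1, gapFlow_comm γ t 0 z S ▸ (h.2.1 z hz).1⟩) h.2.2

/-- The harness process is well defined: by mass transport, the flow of the squared height
differences is finite on the diagonal at all non-isolated points, not just at the origin. -/
lemma ae_forall_summable_harness (hP : Assumptions P) (he : IsEnumeration (palm P) e)
    (hT : ∀ n, IsPoissonProcess Pr (T n)) (hTindep : iIndepFun T Pr) (hm : γ.IsMeasurable)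
    (hγ : γ.HasCovariantGrad) (hfin : edgeMass P (heightGap γ) ≠ ∞) {t : ℝ} (ht : 0 ≤ t) :
    ∀ᵐ x ∂(palm P).prod Pr, ∀ s ∈ x.1,
      Summable fun s' : x.1 => transProb x.1 (epochs e T x.1 x.2) t s s' * γ s' x.1 := by
  have hF := isField_gapFlow hm hγ t
  have h1 : ∀ᵐ S ∂palm P, ∀ s ∈ S, deg (edge S) s ≠ 0 → gapFlow γ t s s S ≠ ∞ := by
    -- the covariant event that the degree-weighted value at `s` is infinite
    have hI : IsField fun s (_ : Space d) (S : Config (Space d)) =>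
        ({∞} : Set ℝ≥0∞).indicator 1 (deg (edge S) s * gapFlow γ t s s S) :=
      ⟨((measurable_one : Measurable (1 : ℝ≥0∞ → ℝ≥0∞)).indicator
        (measurableSet_singleton ∞)).comp (isField_deg.mul hF.diag).measurable, fun x S s s' =>
        congrArg _ ((isField_deg.mul hF.diag).covariant x S s s')⟩
    filter_upwards [ae_forall_mem_of_ae_zero hP hI (by
      filter_upwards [ae_lt_top (measurable_deg_mul hF)
        (diagMass_gapFlow_ne_top hP hm hγ hfin ht)] with S hS
      exact indicator_of_notMem (s := ({∞} : Set ℝ≥0∞)) (f := (1 : ℝ≥0∞ → ℝ≥0∞)) hS.ne)]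
      with S hS s hs h0 h
    have := hS s hs
    rw [h, ENNReal.mul_top h0] at this
    simp at this
  let A : Set (Config (Space d) × Ω) := {x | ∀ i, ∑' j,
    walkKernel (labelWeight e x.1) (fun n => (T n x.2 : Set ℝ)) t i j
      * ENNReal.ofReal |height γ x.1 (e j x.1)| ≠ ∞}
  have hA : MeasurableSet A := by
    have : A = ⋂ i, {x | ∑' j, walkKernel (labelWeight e x.1) (fun n => (T n x.2 : Set ℝ)) t i j
        * ENNReal.ofReal |height γ x.1 (e j x.1)| ≠ ∞} := by
      ext x
      simp [A]
    rw [this]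
    refine MeasurableSet.iInter fun i => ?_
    have hmi : Measurable fun x : Config (Space d) × Ω => ∑' j,
        walkKernel (labelWeight e x.1) (fun n => (T n x.2 : Set ℝ)) t i j
          * ENNReal.ofReal |height γ x.1 (e j x.1)| :=
      Measurable.tsum fun j => (measurable_labelKernel he.measurable (fun n => (hT n).measurable)
        t i j).mul (((measurable_labelHeight he.measurable hm j).comp
          measurable_fst).abs.ennreal_ofReal)
    exact hmi (measurableSet_singleton ∞).compl
  have hterm {S : Config (Space d)} (hS : IsLabelled e S) (ω : Ω) (i j : ℕ) :
      walkKernel (labelWeight e S) (fun n => (T n ω : Set ℝ)) t i j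
        * ENNReal.ofReal |height γ S (e j S)|
      = ENNReal.ofReal |(walkLaw (labelNb e S) T t ω i j).toReal * height γ S (e j S)| := by
    have hne : walkLaw (labelNb e S) T t ω i j ≠ ∞ :=
      ((walkKernel_le_one t i j).trans_lt ENNReal.one_lt_top).ne
    rw [hS.labelWeight_eq, abs_mul, ENNReal.ofReal_mul (abs_nonneg _), ENNReal.abs_toReal,
      ENNReal.ofReal_toReal hne]
    rfl
  have h2 : ∀ᵐ x ∂(palm P).prod Pr, x ∈ A := by
    refine (Measure.ae_prod_mem_iff_ae_ae_mem hA).2 ?_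
    filter_upwards [h1, ae_isLabelled hP he] with S h1 hS
    filter_upwards [hS.ae_summable hT hTindep ht h1] with ω hω i
    simp only [hterm hS]
    exact (hω i).abs.tsum_ofReal_ne_top
  filter_upwards [h2, ae_fst (Pr := Pr) (ae_isLabelled hP he)] with x hx hS s hs
  obtain ⟨i, rfl⟩ := hS.exists_eq hs
  refine (hS.summable_iff γ t x.2 i).2 ?_
  have h3 := hx i
  simp only [hterm hS] at h3
  refine Summable.of_abs ((ENNReal.summable_toReal h3).congr fun j => ?_)
  exact ENNReal.toReal_ofReal (abs_nonneg _)

end Annealed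

end Harness

end

theorem mainTheorem4 (d : ℕ) (hd : 1 ≤ d)
    (P : Measure (Config (Space d))) (hP : Assumptions P)
    {Ω : Type*} [MeasurableSpace Ω] (Pr : Measure Ω) [IsProbabilityMeasure Pr]
    (e : ℕ → Config (Space d) → Space d) (he : IsEnumeration (palm P) e)
    (T : ℕ → Ω → Config ℝ) (hT : ∀ n, IsPoissonProcess Pr (T n)) (hTindep : iIndepFun T Pr)
    (γ : Surface d) (hγ_meas : γ.IsMeasurable) (hγ_cov : γ.HasCovariantGrad)
    (r : ℝ) (hr : 4 < r)
    (hγ : campbell (palm P) id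
      (fun s s' S => ENNReal.ofReal (|grad S (fun v => γ v S) s s'| ^ r)) < ∞) :
    -- the process is well defined
    (∀ t : ℝ, 0 ≤ t → ∀ᵐ x ∂((palm P).prod Pr), ∀ s ∈ x.1,
      Summable fun s' : x.1 => transProb x.1 (epochs e T x.1 x.2) t s s' * γ s' x.1) ∧
    -- the energy is finite
    (∀ t : ℝ, 0 ≤ t → campbell ((palm P).prod Pr) Prod.fst
      (fun s s' x => ENNReal.ofReal (|grad x.1 (harness e T γ t x) s s'| ^ 2)) < ∞) ∧
    -- the dissipation identity
    (∀ t : ℝ, 0 < t →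
      Integrable (fun x : Config (Space d) × Ω =>
        (degree x.1 0 : ℝ)⁻¹ * |laplacian x.1 (harness e T γ t x) 0| ^ 2) ((palm P).prod Pr) ∧
      HasDerivAt
        (fun u : ℝ => (campbell ((palm P).prod Pr) Prod.fst
          (fun s s' x => ENNReal.ofReal (|grad x.1 (harness e T γ u x) s s'| ^ 2))).toReal)
        (-∫ x : Config (Space d) × Ω,
          (degree x.1 0 : ℝ)⁻¹ * |laplacian x.1 (harness e T γ t x) 0| ^ 2 ∂((palm P).prod Pr))
        t) := by
  have hfin : edgeMass P (heightGap γ) ≠ ∞ :=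
    (edgeMass_heightGap_lt_top hP (by linarith : (2 : ℝ) ≤ r) hγ).ne
  refine ⟨fun t ht => ae_forall_summable_harness hP he hT hTindep hγ_meas hγ_cov hfin ht,
    fun t ht => ?_, fun t ht => ⟨?_, ?_⟩⟩
  · -- twice the energy is at most the edge mass of the gap flow
    refine lt_of_le_of_lt ?_
      (edgeMass_gapFlow_ne_top hP hγ_meas hγ_cov hfin ht).lt_top
    rw [← energy_add_diagMass hP he hT hTindep hγ_meas hγ_cov hfin ht, two_mul, add_assoc]
    exact le_self_add
  · refine ⟨(aemeasurable_dissipation hP he (fun n => (hT n).measurable) hγ_meas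
      t).aestronglyMeasurable, ?_⟩
    rw [hasFiniteIntegral_iff_ofReal (Eventually.of_forall fun x => by positivity)]
    refine lt_of_le_of_lt ?_ (ENNReal.mul_ne_top (ENNReal.ofNat_ne_top (n := 2))
      (edgeMass_gapFlow_ne_top hP hγ_meas hγ_cov hfin ht.le)).lt_top
    rw [← dissipation_add_cornerMass hP he hT hTindep hγ_meas hγ_cov hfin ht.le, two_mul, add_assoc]
    exact le_self_add
  · -- with `H` the energy and `α`, `β`, `w` the edge, diagonal and corner masses of the gap flow,
    -- `2 H' = α' - β' = 2 (w - α) - (w - β) = -2 D`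
    have hD := dissipation_add_cornerMass hP he hT hTindep hγ_meas hγ_cov hfin ht.le
    rw [integral_eq_lintegral_of_nonneg_ae (Eventually.of_forall fun x => by positivity)
      (aemeasurable_dissipation hP he (fun n => (hT n).measurable) hγ_meas
        t).aestronglyMeasurable]
    set D := ∫⁻ x : Config (Space d) × Ω, ENNReal.ofReal
      ((degree x.1 0 : ℝ)⁻¹ * |laplacian x.1 (harness e T γ t x) 0| ^ 2) ∂(palm P).prod Pr
    have h2D : 2 * D ≠ ∞ := ne_top_of_le_ne_top (ENNReal.mul_ne_top ENNReal.ofNat_ne_top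
      (edgeMass_gapFlow_ne_top hP hγ_meas hγ_cov hfin ht.le)) (hD ▸ le_self_add)
    have hw := cornerMass_gapFlow_ne_top hP hγ_meas hγ_cov hfin ht.le
    have hb := diagMass_gapFlow_ne_top hP hγ_meas hγ_cov hfin ht.le
    have hD' := congrArg ENNReal.toReal hD
    rw [ENNReal.toReal_add h2D (ENNReal.add_ne_top.2 ⟨hw, hb⟩), ENNReal.toReal_add hw hb,
      ENNReal.toReal_mul, ENNReal.toReal_mul, ENNReal.toReal_ofNat] at hD'
    refine ((((hasDerivAt_edgeMass_gapFlow hP hγ_meas hγ_cov hfin ht).sub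
      (hasDerivAt_diagMass_gapFlow hP hγ_meas hγ_cov hfin ht)).const_mul 2⁻¹).congr_deriv
      (by linarith)).congr_of_eventuallyEq ?_
    filter_upwards [eventually_gt_nhds ht] with u hu
    have hH := energy_add_diagMass hP he hT hTindep hγ_meas hγ_cov hfin hu.le
    have hα := edgeMass_gapFlow_ne_top hP hγ_meas hγ_cov hfin hu.le
    have hH' := congrArg ENNReal.toReal hH
    rw [ENNReal.toReal_add (ne_top_of_le_ne_top hα (hH ▸ le_self_add))
      (diagMass_gapFlow_ne_top hP hγ_meas hγ_cov hfin hu.le), ENNReal.toReal_mul,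
      ENNReal.toReal_ofNat] at hH'
    simp only [Pi.sub_apply]
    linarith
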